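/- Let $\mathbb{K}$ be an algebraically closed field of characteristic zero. An \emph{orbifold} over $\mathbb{K}$ is a smooth separated Deligne--Mumford stack of finite type over $\mathbb{K}$, or, if $\mathbb{K}=\mathbb{C}$, a complex analytic orbifold. A \emph{Poisson triple of dimension $(3,1)$} is a triple $(\mathsf{X},\mathsf{Y},\sigma)$ in which $\mathsf{X}$ is an orbifold over $\mathbb{K}$ of dimension $3$, $\sigma$ is a Poisson structure on $\mathsf{X}$ (a $\mathbb{K}$-bilinear Poisson bracket $\{-,-\}$ on $\mathcal{O}_{\mathsf{X}}$), and $\mathsf{Y}\subset\mathsf{X}$ is a reduced closed orbifold subscheme of pure dimension $1$ whose coherent ideal sheaf $\mathcal{J}$ satisfies $\{\mathcal{O}_{\mathsf{X}},\mathcal{J}\}\subset\mathcal{J}$. In this situation $\sigma$ vanishes along $\mathsf{Y}$, so at every point $p\in\mathsf{Y}$ the bracket induces a Lie algebra structure $[\mathrm{d}a,\mathrm{d}b]=\mathrm{d}\{a,b\}$ on the cotangent space $\mathfrak{h}_p:=\mathfrak{m}_p/\mathfrak{m}_p^2$ of $\mathsf{X}$ at $p$. A \emph{non-nilpotent point}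 of the triple is a singular point $p$ of $\mathsf{Y}$ for which the Lie algebra $\mathfrak{h}_p$ is not nilpotent. \textbf{Proposition.} Let $p$ be a non-nilpotent point of a Poisson triple $(\mathsf{X},\mathsf{Y},\sigma)$ of dimension $(3,1)$. Then there exist formal coordinates $(x,y,z)$ at $p$, i.e.\ an isomorphism of $\mathbb{K}$-algebras $\widehat{\mathcal{O}}_{\mathsf{X},p}\cong\mathbb{K}[[x,y,z]]$, and an element $f\in\mathbb{K}[[y,z]]$ such that \[ \sigma = x\,\partial_x\wedge\partial_y \qquad\text{and}\qquad \mathsf{Y}=\{x=f(y,z)=0\} \] in the formal neighbourhood of $p$ in $\mathsf{X}$; the second equation means that $\mathcal{J}\,\widehat{\mathcal{O}}_{\mathsf{X},p}$ is the ideal generated by $x$ and $f(y,z)$. -/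

import Mathlib

open CategoryTheory AlgebraicGeometry TopologicalSpace Opposite IsLocalRing
open scoped Manifold ContDiff

universe u

noncomputable section

namespace PoissonTriples

/-! ### Spaces with a sheaf of functions over `K`, Poisson structures and ideal sheaves -/

/-- A locally ringed space together with a compatible `K`-algebra structure on its functions. It is
the common language for schemes over `K` and for complex manifolds. -/
structure KSpace (K : Type u) [Field K] where
  /-- the underlying locally ringed space -/
  toLRS : LocallyRingedSpace.{u}
  /-- the constant functions -/
  scalars : K →+* toLRS.presheaf.obj (op ⊤)

namespace KSpace

variable {K : Type u} [Field K] (X : KSpace K)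

/-- The functions on an open set. -/
abbrev Fun (V : Opens X.toLRS) : CommRingCat.{u} := X.toLRS.presheaf.obj (op V)

/-- Restriction of functions to a smaller open set. -/
abbrev res {V W : Opens X.toLRS} (h : V ≤ W) : X.Fun W →+* X.Fun V :=
  (X.toLRS.presheaf.map (homOfLE h).op).hom

/-- Constant functions on an open set. -/
def const (V : Opens X.toLRS) : K →+* X.Fun V := (X.res le_top).comp X.scalars

/-- The local ring `𝒪_{X,p}`. -/
abbrev Stalk (p : X.toLRS) : CommRingCat.{u} := X.toLRS.presheaf.stalk p

/-- The germ at `p` of a function defined on a neighbourhood of `p`. -/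
abbrev germ (V : Opens X.toLRS) (p : X.toLRS) (hp : p ∈ V) : X.Fun V →+* X.Stalk p :=
  (X.toLRS.presheaf.germ V p hp).hom

/-- The completed local ring `𝒪̂_{X,p}`, i.e. the functions on the formal neighbourhood of `p`. -/
abbrev FormalNbhd (p : X.toLRS) : Type u :=
  AdicCompletion (maximalIdeal (X.Stalk p)) (X.Stalk p)

/-- The Taylor expansion at `p` of a function defined on a neighbourhood of `p`. -/
def toFormal (V : Opens X.toLRS) (p : X.toLRS) (hp : p ∈ V) : X.Fun V →+* X.FormalNbhd p :=
  (algebraMap (X.Stalk p) (X.FormalNbhd p)).comp (X.germ V p hp)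

/-- A system of `n` formal coordinates at `p`: an isomorphism of `K`-algebras
`K⟦x₁, …, xₙ⟧ ≃ 𝒪̂_{X,p}` (the coordinates themselves are the images of the variables). -/
structure FormalCoordinates (p : X.toLRS) (n : ℕ) where
  /-- the isomorphism -/
  iso : MvPowerSeries (Fin n) K ≃+* X.FormalNbhd p
  /-- the isomorphism is `K`-linear -/
  iso_const : ∀ c : K, iso (MvPowerSeries.C c) = X.toFormal ⊤ p trivial (X.const ⊤ c)

end KSpace

/-- A Poisson structure: a `K`-bilinear Poisson bracket on the sheaf of functions.
(`K`-bilinearity is biadditivity together with the vanishing of brackets with constants.) -/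
structure PoissonStructure {K : Type u} [Field K] (X : KSpace K) where
  /-- the bracket on functions on an open set -/
  bracket : ∀ V : Opens X.toLRS, X.Fun V → X.Fun V → X.Fun V
  bracket_res : ∀ {V W : Opens X.toLRS} (h : V ≤ W) (f g : X.Fun W),
    X.res h (bracket W f g) = bracket V (X.res h f) (X.res h g)
  add_bracket : ∀ V (f f' g : X.Fun V), bracket V (f + f') g = bracket V f g + bracket V f' g
  bracket_self : ∀ V (f : X.Fun V), bracket V f f = 0
  bracket_skew : ∀ V (f g : X.Fun V), bracket V f g = - bracket V g f
  bracket_mul : ∀ V (f g h : X.Fun V),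
    bracket V f (g * h) = bracket V f g * h + g * bracket V f h
  const_bracket : ∀ V (c : K) (g : X.Fun V), bracket V (X.const V c) g = 0
  jacobi : ∀ V (f g h : X.Fun V),
    bracket V f (bracket V g h) = bracket V (bracket V f g) h + bracket V g (bracket V f h)

/-- A morphism `φ : X ⟶ Y` is a Poisson map if pullback of functions preserves brackets. -/
def IsPoissonMap {K : Type u} [Field K] {X Y : KSpace K} (φ : X.toLRS ⟶ Y.toLRS)
    (σX : PoissonStructure X) (σY : PoissonStructure Y) : Prop :=
  ∀ (V : Opens Y.toLRS) (f g : Y.Fun V),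
    φ.c.app (op V) (σY.bracket V f g) =
      σX.bracket ((Opens.map φ.base).obj V) (φ.c.app (op V) f) (φ.c.app (op V) g)

/-- A coherent sheaf of ideals: a subsheaf of ideals of the structure sheaf that is locally
generated by finitely many sections. -/
structure CoherentIdealSheaf {K : Type u} [Field K] (X : KSpace K) where
  /-- the ideal of sections on an open set -/
  ideal : ∀ V : Opens X.toLRS, Ideal (X.Fun V)
  res_mem : ∀ {V W : Opens X.toLRS} (h : V ≤ W) (f : X.Fun W), f ∈ ideal W → X.res h f ∈ ideal V
  mem_of_locally_mem : ∀ (V : Opens X.toLRS) (f : X.Fun V),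
    (∀ p ∈ V, ∃ (W : Opens X.toLRS) (h : W ≤ V), p ∈ W ∧ X.res h f ∈ ideal W) → f ∈ ideal V
  locally_finitely_generated : ∀ p : X.toLRS, ∃ (W : Opens X.toLRS) (_ : p ∈ W)
    (s : Finset (X.Fun W)), (∀ f ∈ s, f ∈ ideal W) ∧
      ∀ (V : Opens X.toLRS) (hVW : V ≤ W) (g : X.Fun V), g ∈ ideal V →
        ∀ (q : X.toLRS) (hq : q ∈ V),
          X.germ V q hq g ∈ Ideal.span (X.germ W q (hVW hq) '' (s : Set (X.Fun W)))

namespace CoherentIdealSheaf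

variable {K : Type u} [Field K] {X : KSpace K} (J : CoherentIdealSheaf X)

/-- The stalk of the ideal sheaf at `p`, an ideal of the local ring at `p`. -/
def stalk (p : X.toLRS) : Ideal (X.Stalk p) :=
  Ideal.span {a | ∃ (V : Opens X.toLRS) (hp : p ∈ V), ∃ f ∈ J.ideal V, a = X.germ V p hp f}

/-- The points of the closed subspace `Y = V(J)`. -/
def support : Set X.toLRS := {p | J.stalk p ≠ ⊤}

/-- The subspace `Y = V(J)` is reduced: its structure sheaf has no nilpotent elements. -/
def IsReduced : Prop := ∀ V, (J.ideal V).IsRadical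

/-- The subspace `Y = V(J)` is Poisson: `J` is a sheaf of Poisson ideals. -/
def IsPoisson (σ : PoissonStructure X) : Prop :=
  ∀ (V : Opens X.toLRS) (f g : X.Fun V), g ∈ J.ideal V → σ.bracket V f g ∈ J.ideal V

/-- The subspace `Y = V(J)` has pure dimension `d`: at every closed point of `Y`, each irreducible
component of the germ of `Y` has dimension `d`. -/
def HasPureDimension (d : ℕ) : Prop :=
  ∀ p ∈ J.support, IsClosed {p} → ∀ P ∈ (J.stalk p).minimalPrimes,
    ringKrullDim (X.Stalk p ⧸ P) = d

/-- `p` is a singular point of `Y = V(J)`: a point of `Y` at which the local ring of `Y` is not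
regular. -/
def IsSingularAt (p : X.toLRS) : Prop :=
  p ∈ J.support ∧ ¬ IsRegularLocalRing (X.Stalk p ⧸ J.stalk p)

end CoherentIdealSheaf

/-! ### The linearization of a Poisson structure at a point -/

namespace PoissonStructure

variable {K : Type u} [Field K] {X : KSpace K} (σ : PoissonStructure X)

theorem bracket_add (V : Opens X.toLRS) (f g g' : X.Fun V) :
    σ.bracket V f (g + g') = σ.bracket V f g + σ.bracket V f g' := by
  rw [σ.bracket_skew, σ.add_bracket, σ.bracket_skew V f g, σ.bracket_skew V f g']
  ring

theorem exists_germ_pair {p : X.toLRS} (a b : X.Stalk p) :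
    ∃ (V : Opens X.toLRS) (hp : p ∈ V) (f g : X.Fun V),
      X.germ V p hp f = a ∧ X.germ V p hp g = b := by
  obtain ⟨V, hV, f, rfl⟩ := X.toLRS.presheaf.exists_germ_eq a
  obtain ⟨W, hW, g, rfl⟩ := X.toLRS.presheaf.exists_germ_eq b
  refine ⟨V ⊓ W, ⟨hV, hW⟩, X.res inf_le_left f, X.res inf_le_right g, ?_, ?_⟩
  · exact X.toLRS.presheaf.germ_res_apply (homOfLE inf_le_left) p ⟨hV, hW⟩ f
  · exact X.toLRS.presheaf.germ_res_apply (homOfLE inf_le_right) p ⟨hV, hW⟩ g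

theorem germ_res {V W : Opens X.toLRS} (h : V ≤ W) (p : X.toLRS) (hp : p ∈ V) (f : X.Fun W) :
    X.germ V p hp (X.res h f) = X.germ W p (h hp) f :=
  X.toLRS.presheaf.germ_res_apply (homOfLE h) p hp f

theorem exists_germ_triple {p : X.toLRS} (a b c : X.Stalk p) :
    ∃ (V : Opens X.toLRS) (hp : p ∈ V) (f g h : X.Fun V),
      X.germ V p hp f = a ∧ X.germ V p hp g = b ∧ X.germ V p hp h = c := by
  obtain ⟨V, hV, f, g, rfl, rfl⟩ := exists_germ_pair a b
  obtain ⟨W, hW, h, -, rfl, -⟩ := exists_germ_pair c c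
  exact ⟨V ⊓ W, ⟨hV, hW⟩, X.res inf_le_left f, X.res inf_le_left g, X.res inf_le_right h,
    germ_res _ _ _ _, germ_res _ _ _ _, germ_res _ _ _ _⟩

/-- The Poisson bracket on the local ring at `p`, computed on representatives; see
`stalkBracket_germ`. -/
def stalkBracket (p : X.toLRS) (a b : X.Stalk p) : X.Stalk p :=
  X.germ _ p (exists_germ_pair a b).choose_spec.choose
    (σ.bracket _ (exists_germ_pair a b).choose_spec.choose_spec.choose
      (exists_germ_pair a b).choose_spec.choose_spec.choose_spec.choose)

theorem germ_bracket_congr {p : X.toLRS} {V W : Opens X.toLRS} (hV : p ∈ V) (hW : p ∈ W)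
    (f g : X.Fun V) (f' g' : X.Fun W) (hf : X.germ V p hV f = X.germ W p hW f')
    (hg : X.germ V p hV g = X.germ W p hW g') :
    X.germ V p hV (σ.bracket V f g) = X.germ W p hW (σ.bracket W f' g') := by
  obtain ⟨A, hA, iV, iW, h⟩ := X.toLRS.presheaf.germ_eq p hV hW f f' hf
  obtain ⟨B, hB, jV, jW, h'⟩ := X.toLRS.presheaf.germ_eq p hV hW g g' hg
  have hp : p ∈ A ⊓ B := ⟨hA, hB⟩
  have lV : A ⊓ B ≤ V := inf_le_left.trans iV.le
  have lW : A ⊓ B ≤ W := inf_le_left.trans iW.le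
  have comp : ∀ {V₁ V₂ V₃ : Opens X.toLRS} (h₁ : V₁ ≤ V₂) (h₂ : V₂ ≤ V₃) (k : X.Fun V₃),
      X.res h₁ (X.res h₂ k) = X.res (h₁.trans h₂) k := by
    intro V₁ V₂ V₃ h₁ h₂ k
    have e : X.toLRS.presheaf.map (homOfLE (h₁.trans h₂)).op =
        X.toLRS.presheaf.map (homOfLE h₂).op ≫ X.toLRS.presheaf.map (homOfLE h₁).op := by
      rw [← Functor.map_comp]; rfl
    simp only [KSpace.res, e]
    rfl
  have ef : X.res lV f = X.res lW f' := by
    rw [← comp inf_le_left iV.le, ← comp inf_le_left iW.le]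
    exact congrArg _ h
  have eg : X.res lV g = X.res lW g' := by
    rw [← comp inf_le_right jV.le, ← comp inf_le_right jW.le]
    exact congrArg _ h'
  rw [← germ_res lV p hp, ← germ_res lW p hp, σ.bracket_res, σ.bracket_res, ef, eg]

theorem stalkBracket_germ {p : X.toLRS} {V : Opens X.toLRS} (hp : p ∈ V) (f g : X.Fun V) :
    σ.stalkBracket p (X.germ V p hp f) (X.germ V p hp g) = X.germ V p hp (σ.bracket V f g) := by
  have h := (exists_germ_pair (X.germ V p hp f)
    (X.germ V p hp g)).choose_spec.choose_spec.choose_spec.choose_spec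
  exact σ.germ_bracket_congr _ hp _ _ _ _ h.1 h.2

theorem stalkBracket_add {p : X.toLRS} (a b c : X.Stalk p) :
    σ.stalkBracket p a (b + c) = σ.stalkBracket p a b + σ.stalkBracket p a c := by
  obtain ⟨V, hp, f, g, h, rfl, rfl, rfl⟩ := exists_germ_triple a b c
  rw [← map_add, stalkBracket_germ, stalkBracket_germ, stalkBracket_germ, σ.bracket_add, map_add]

theorem stalkBracket_mul {p : X.toLRS} (a b c : X.Stalk p) :
    σ.stalkBracket p a (b * c) = σ.stalkBracket p a b * c + b * σ.stalkBracket p a c := by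
  obtain ⟨V, hp, f, g, h, rfl, rfl, rfl⟩ := exists_germ_triple a b c
  rw [← map_mul, stalkBracket_germ, stalkBracket_germ, stalkBracket_germ, σ.bracket_mul, map_add,
    map_mul, map_mul]

theorem stalkBracket_self {p : X.toLRS} (a : X.Stalk p) : σ.stalkBracket p a a = 0 := by
  obtain ⟨V, hp, f, -, rfl, -⟩ := exists_germ_pair a a
  rw [stalkBracket_germ, σ.bracket_self, map_zero]

theorem stalkBracket_skew {p : X.toLRS} (a b : X.Stalk p) :
    σ.stalkBracket p a b = - σ.stalkBracket p b a := by
  obtain ⟨V, hp, f, g, rfl, rfl⟩ := exists_germ_pair a b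
  rw [stalkBracket_germ, stalkBracket_germ, σ.bracket_skew, map_neg]

theorem stalkBracket_jacobi {p : X.toLRS} (a b c : X.Stalk p) :
    σ.stalkBracket p a (σ.stalkBracket p b c) =
      σ.stalkBracket p (σ.stalkBracket p a b) c + σ.stalkBracket p b (σ.stalkBracket p a c) := by
  obtain ⟨V, hp, f, g, h, rfl, rfl, rfl⟩ := exists_germ_triple a b c
  simp only [stalkBracket_germ, ← map_add]
  rw [σ.jacobi]

theorem stalkBracket_zero {p : X.toLRS} (a : X.Stalk p) : σ.stalkBracket p a 0 = 0 := by
  have h := σ.stalkBracket_add a 0 0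
  rw [add_zero] at h
  exact left_eq_add.mp h

/-- The Poisson bivector vanishes at `p`: every bracket of functions vanishes at `p`. -/
def VanishesAt (p : X.toLRS) : Prop :=
  ∀ a b : X.Stalk p, σ.stalkBracket p a b ∈ maximalIdeal (X.Stalk p)

/-- The underlying space of the Lie algebra `𝔥_p` given by the linearization of the Poisson
structure at a point `p` where it vanishes: the Zariski cotangent space `𝔪_p / 𝔪_p²`. -/
def Linearization (p : X.toLRS) (_ : σ.VanishesAt p) : Type u := CotangentSpace (X.Stalk p)

namespace Linearization

variable {σ} {p : X.toLRS} {hσ : σ.VanishesAt p}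

instance : AddCommGroup (σ.Linearization p hσ) :=
  inferInstanceAs (AddCommGroup (CotangentSpace (X.Stalk p)))

instance : Module (ResidueField (X.Stalk p)) (σ.Linearization p hσ) :=
  inferInstanceAs (Module (ResidueField (X.Stalk p)) (CotangentSpace (X.Stalk p)))

/-- The differential at `p` of a function vanishing at `p`. -/
def diff (hσ : σ.VanishesAt p) : maximalIdeal (X.Stalk p) →+ σ.Linearization p hσ :=
  (maximalIdeal (X.Stalk p)).toCotangent.toAddMonoidHom

theorem diff_surjective (hσ : σ.VanishesAt p) : Function.Surjective (diff hσ) :=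
  (maximalIdeal (X.Stalk p)).toCotangent_surjective

theorem diff_eq_iff (hσ : σ.VanishesAt p) (a b : maximalIdeal (X.Stalk p)) :
    diff hσ a = diff hσ b ↔ (a - b : X.Stalk p) ∈ maximalIdeal (X.Stalk p) ^ 2 :=
  (maximalIdeal (X.Stalk p)).toCotangent_eq

/-- The Poisson bracket of two functions vanishing at `p`. -/
def maxBracket (hσ : σ.VanishesAt p) (a b : maximalIdeal (X.Stalk p)) :
    maximalIdeal (X.Stalk p) := ⟨σ.stalkBracket p a b, hσ a b⟩

/-- The Lie bracket on `𝔪_p / 𝔪_p²`, characterized by `[da, db] = d{a, b}`; see `diff_lie`. -/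
instance : Bracket (σ.Linearization p hσ) (σ.Linearization p hσ) where
  bracket v w := diff hσ (maxBracket hσ (Function.surjInv (diff_surjective hσ) v)
    (Function.surjInv (diff_surjective hσ) w))

theorem bracket_mem_sq (hσ : σ.VanishesAt p) (a b : X.Stalk p)
    (hb : b ∈ maximalIdeal (X.Stalk p) ^ 2) :
    σ.stalkBracket p a b ∈ maximalIdeal (X.Stalk p) ^ 2 := by
  rw [pow_two] at hb ⊢
  refine Submodule.mul_induction_on hb (fun m hm n hn => ?_) (fun x y hx hy => ?_)
  · rw [stalkBracket_mul]
    exact add_mem (Ideal.mul_mem_mul (hσ a m) hn) (Ideal.mul_mem_mul hm (hσ a n))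
  · rw [stalkBracket_add]
    exact add_mem hx hy

theorem diff_maxBracket_congr (a a' b b' : maximalIdeal (X.Stalk p))
    (ha : diff hσ a = diff hσ a') (hb : diff hσ b = diff hσ b') :
    diff hσ (maxBracket hσ a b) = diff hσ (maxBracket hσ a' b') := by
  have right : ∀ c d d' : maximalIdeal (X.Stalk p), diff hσ d = diff hσ d' →
      diff hσ (maxBracket hσ c d) = diff hσ (maxBracket hσ c d') := by
    intro c d d' h
    rw [diff_eq_iff] at h ⊢
    have e : σ.stalkBracket p c d = σ.stalkBracket p c (d - d' : X.Stalk p) +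
        σ.stalkBracket p c d' := by
      rw [← stalkBracket_add, sub_add_cancel]
    change σ.stalkBracket p c d - σ.stalkBracket p c d' ∈ _
    rw [e, add_sub_cancel_right]
    exact bracket_mem_sq hσ _ _ h
  have skew : ∀ c d : maximalIdeal (X.Stalk p),
      diff hσ (maxBracket hσ c d) = - diff hσ (maxBracket hσ d c) := by
    intro c d
    rw [← map_neg]
    congr 1
    exact Subtype.ext (σ.stalkBracket_skew _ _)
  rw [right a b b' hb, skew, right b' a a' ha, ← skew]

theorem diff_lie (a b : maximalIdeal (X.Stalk p)) :
    ⁅diff hσ a, diff hσ b⁆ = diff hσ (maxBracket hσ a b) :=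
  diff_maxBracket_congr _ _ _ _ (Function.surjInv_eq _ _) (Function.surjInv_eq _ _)

/-- The Lie algebra `𝔥_p`. -/
instance : LieRing (σ.Linearization p hσ) where
  add_lie v w x := by
    obtain ⟨a, rfl⟩ := diff_surjective hσ v
    obtain ⟨b, rfl⟩ := diff_surjective hσ w
    obtain ⟨c, rfl⟩ := diff_surjective hσ x
    rw [← map_add, diff_lie, diff_lie, diff_lie, ← map_add]
    congr 1
    refine Subtype.ext ?_
    change σ.stalkBracket p ((a : X.Stalk p) + b) c =
      σ.stalkBracket p a c + σ.stalkBracket p b c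
    rw [σ.stalkBracket_skew, σ.stalkBracket_add, σ.stalkBracket_skew (a : X.Stalk p) c,
      σ.stalkBracket_skew (b : X.Stalk p) c, neg_add]
  lie_add v w x := by
    obtain ⟨a, rfl⟩ := diff_surjective hσ v
    obtain ⟨b, rfl⟩ := diff_surjective hσ w
    obtain ⟨c, rfl⟩ := diff_surjective hσ x
    rw [← map_add, diff_lie, diff_lie, diff_lie, ← map_add]
    congr 1
    exact Subtype.ext (σ.stalkBracket_add _ _ _)
  lie_self v := by
    obtain ⟨a, rfl⟩ := diff_surjective hσ v
    rw [diff_lie, ← map_zero (diff hσ)]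
    congr 1
    exact Subtype.ext (σ.stalkBracket_self _)
  leibniz_lie v w x := by
    obtain ⟨a, rfl⟩ := diff_surjective hσ v
    obtain ⟨b, rfl⟩ := diff_surjective hσ w
    obtain ⟨c, rfl⟩ := diff_surjective hσ x
    simp only [diff_lie, ← map_add]
    congr 1
    exact Subtype.ext (σ.stalkBracket_jacobi _ _ _)

/-- `𝔥_p` is a Lie algebra over the residue field at `p`. -/
instance : LieAlgebra (ResidueField (X.Stalk p)) (σ.Linearization p hσ) where
  lie_smul r v w := by
    obtain ⟨r, rfl⟩ := residue_surjective r
    obtain ⟨a, rfl⟩ := diff_surjective hσ v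
    obtain ⟨b, rfl⟩ := diff_surjective hσ w
    have smul_diff : ∀ c : maximalIdeal (X.Stalk p),
        residue (X.Stalk p) r • diff hσ c = diff hσ (r • c) := fun c =>
      ((maximalIdeal (X.Stalk p)).toCotangent.map_smul r c).symm
    rw [smul_diff, diff_lie, diff_lie, smul_diff, diff_eq_iff]
    change σ.stalkBracket p a (r * (b : X.Stalk p)) - r * σ.stalkBracket p a b ∈ _
    rw [stalkBracket_mul, add_sub_cancel_right, pow_two]
    exact Ideal.mul_mem_mul (hσ _ _) b.2

end Linearization

/-- In the given formal coordinates at `p`, the Poisson structure is the bivector whose bracket is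
`B`. Since a biderivation of `𝒪̂_{X,p}` is determined by its values on germs of functions, this is
the equality of bivectors on the formal neighbourhood of `p`. -/
def IsGivenBy {p : X.toLRS} {n : ℕ} (x : X.FormalCoordinates p n)
    (B : MvPowerSeries (Fin n) K → MvPowerSeries (Fin n) K → MvPowerSeries (Fin n) K) : Prop :=
  ∀ (V : Opens X.toLRS) (hp : p ∈ V) (f g : X.Fun V),
    X.toFormal V p hp (σ.bracket V f g) =
      x.iso (B (x.iso.symm (X.toFormal V p hp f)) (x.iso.symm (X.toFormal V p hp g)))

end PoissonStructure

/-- The bracket of power series defined by the bivector `a ∂ᵢ ∧ ∂ⱼ`. -/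
def bivectorBracket {K : Type u} [Field K] {n : ℕ} (a : MvPowerSeries (Fin n) K) (i j : Fin n)
    (f g : MvPowerSeries (Fin n) K) : MvPowerSeries (Fin n) K :=
  a * (MvPowerSeries.pderiv K i f * MvPowerSeries.pderiv K j g
    - MvPowerSeries.pderiv K j f * MvPowerSeries.pderiv K i g)

/-! ### Orbifolds -/

/-- A smooth separated Deligne–Mumford stack of finite type over `K`, of pure dimension `n`, given
by an étale atlas `U` and the étale groupoid scheme `R = U ×_X U ⇉ U`. The groupoid structure is
given on `T`-valued points. The stack is smooth of dimension `n` and of finite type because `U` is,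
and it is separated because the (automatically unramified) diagonal, which pulls back to
`(s, t) : R ⟶ U ×_K U`, is finite. -/
structure AlgebraicOrbifold (K : Type u) [Field K] (n : ℕ) where
  U : Scheme.{u}
  R : Scheme.{u}
  /-- the structure morphism of the atlas -/
  π : U ⟶ Spec (CommRingCat.of K)
  smooth : SmoothOfRelativeDimension n π
  quasiCompact : QuasiCompact π
  /-- source -/
  s : R ⟶ U
  /-- target -/
  t : R ⟶ U
  etale_s : Etale s
  etale_t : Etale t
  s_π : s ≫ π = t ≫ π
  finite : IsFinite (Limits.pullback.lift s t s_π)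
  /-- identities -/
  unit : U ⟶ R
  unit_s : unit ≫ s = 𝟙 U
  unit_t : unit ≫ t = 𝟙 U
  /-- inverses -/
  inv : R ⟶ R
  inv_s : inv ≫ s = t
  inv_t : inv ≫ t = s
  /-- composition of `T`-valued points -/
  comp : ∀ {T : Scheme.{u}} (a b : T ⟶ R), a ≫ t = b ≫ s → (T ⟶ R)
  comp_natural : ∀ {T T' : Scheme.{u}} (h : T' ⟶ T) (a b : T ⟶ R) (w : a ≫ t = b ≫ s)
    (w' : (h ≫ a) ≫ t = (h ≫ b) ≫ s), h ≫ comp a b w = comp (h ≫ a) (h ≫ b) w'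
  comp_s : ∀ {T : Scheme.{u}} (a b : T ⟶ R) (w : a ≫ t = b ≫ s), comp a b w ≫ s = a ≫ s
  comp_t : ∀ {T : Scheme.{u}} (a b : T ⟶ R) (w : a ≫ t = b ≫ s), comp a b w ≫ t = b ≫ t
  comp_assoc : ∀ {T : Scheme.{u}} (a b c : T ⟶ R) (w : a ≫ t = b ≫ s) (w' : b ≫ t = c ≫ s)
    (w₁ : comp a b w ≫ t = c ≫ s) (w₂ : a ≫ t = comp b c w' ≫ s),
    comp (comp a b w) c w₁ = comp a (comp b c w') w₂
  unit_comp : ∀ {T : Scheme.{u}} (a : T ⟶ R) (w : ((a ≫ s) ≫ unit) ≫ t = a ≫ s),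
    comp ((a ≫ s) ≫ unit) a w = a
  comp_unit : ∀ {T : Scheme.{u}} (a : T ⟶ R) (w : a ≫ t = ((a ≫ t) ≫ unit) ≫ s),
    comp a ((a ≫ t) ≫ unit) w = a
  comp_inv : ∀ {T : Scheme.{u}} (a : T ⟶ R) (w : a ≫ t = (a ≫ inv) ≫ s),
    comp a (a ≫ inv) w = (a ≫ s) ≫ unit
  inv_comp : ∀ {T : Scheme.{u}} (a : T ⟶ R) (w : (a ≫ inv) ≫ t = a ≫ s),
    comp (a ≫ inv) a w = (a ≫ t) ≫ unit

/-- A complex analytic orbifold of dimension `n`, given by a proper étale groupoid of complex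
manifolds `R ⇉ U` of dimension `n`. (As `s` is a local biholomorphism, continuity of the other
structure maps implies that they are holomorphic.) -/
structure AnalyticOrbifold (n : ℕ) where
  U : Type
  R : Type
  [topU : TopologicalSpace U]
  [topR : TopologicalSpace R]
  [t2U : T2Space U]
  [t2R : T2Space R]
  [chartedU : ChartedSpace (EuclideanSpace ℂ (Fin n)) U]
  [chartedR : ChartedSpace (EuclideanSpace ℂ (Fin n)) R]
  [manifoldU : IsManifold 𝓘(ℂ, EuclideanSpace ℂ (Fin n)) ω U]
  [manifoldR : IsManifold 𝓘(ℂ, EuclideanSpace ℂ (Fin n)) ω R]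
  /-- source -/
  s : R → U
  /-- target -/
  t : R → U
  etale_s : IsLocalDiffeomorph 𝓘(ℂ, EuclideanSpace ℂ (Fin n)) 𝓘(ℂ, EuclideanSpace ℂ (Fin n)) ω s
  etale_t : IsLocalDiffeomorph 𝓘(ℂ, EuclideanSpace ℂ (Fin n)) 𝓘(ℂ, EuclideanSpace ℂ (Fin n)) ω t
  proper : IsProperMap fun r => (s r, t r)
  /-- identities -/
  unit : U → R
  continuous_unit : Continuous unit
  unit_s : ∀ u, s (unit u) = u
  unit_t : ∀ u, t (unit u) = u
  /-- inverses -/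
  inv : R → R
  continuous_inv : Continuous inv
  inv_s : ∀ a, s (inv a) = t a
  inv_t : ∀ a, t (inv a) = s a
  /-- composition -/
  comp : ∀ a b : R, t a = s b → R
  continuous_comp : Continuous fun x : {x : R × R // t x.1 = s x.2} => comp x.1.1 x.1.2 x.2
  comp_s : ∀ a b (w : t a = s b), s (comp a b w) = s a
  comp_t : ∀ a b (w : t a = s b), t (comp a b w) = t b
  comp_assoc : ∀ a b c (w : t a = s b) (w' : t b = s c) (w₁ : t (comp a b w) = s c)
    (w₂ : t a = s (comp b c w')), comp (comp a b w) c w₁ = comp a (comp b c w') w₂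
  unit_comp : ∀ a (w : t (unit (s a)) = s a), comp (unit (s a)) a w = a
  comp_unit : ∀ a (w : t a = s (unit (t a))), comp a (unit (t a)) w = a
  comp_inv : ∀ a (w : t a = s (inv a)), comp a (inv a) w = unit (s a)
  inv_comp : ∀ a (w : t (inv a) = s a), comp (inv a) a w = unit (t a)

attribute [instance] AnalyticOrbifold.topU AnalyticOrbifold.topR AnalyticOrbifold.t2U
  AnalyticOrbifold.t2R AnalyticOrbifold.chartedU AnalyticOrbifold.chartedR
  AnalyticOrbifold.manifoldU AnalyticOrbifold.manifoldR

/-- The part of a groupoid presentation of an orbifold that is needed to speak about tensors and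
subspaces: the atlas, the arrows, the source and the target. -/
structure Presentation (K : Type u) [Field K] where
  U : KSpace K
  R : KSpace K
  s : R.toLRS ⟶ U.toLRS
  t : R.toLRS ⟶ U.toLRS

/-- A scheme over `K` as a space with functions over `K`. -/
def schemeSpace {K : Type u} [Field K] (X : Scheme.{u}) (π : X ⟶ Spec (CommRingCat.of K)) :
    KSpace K where
  toLRS := X.toLocallyRingedSpace
  scalars := ((Scheme.ΓSpecIso (CommRingCat.of K)).inv ≫ π.appTop).hom

/-- A complex manifold with its sheaf of holomorphic functions. -/
def manifoldSpace (n : ℕ) (M : Type) [TopologicalSpace M]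
    [ChartedSpace (EuclideanSpace ℂ (Fin n)) M] : KSpace ℂ where
  toLRS := ChartedSpace.locallyRingedSpace 𝓘(ℂ, EuclideanSpace ℂ (Fin n)) M
  scalars := algebraMap ℂ C^∞⟮𝓘(ℂ, EuclideanSpace ℂ (Fin n)), (⊤ : Opens M); 𝓘(ℂ), ℂ⟯

/-- The presentation underlying an algebraic orbifold. -/
def AlgebraicOrbifold.presentation {K : Type u} [Field K] {n : ℕ} (X : AlgebraicOrbifold K n) :
    Presentation K where
  U := schemeSpace X.U X.π
  R := schemeSpace X.R (X.s ≫ X.π)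
  s := X.s.toLRSHom
  t := X.t.toLRSHom

/-- The presentation underlying a complex analytic orbifold. -/
def AnalyticOrbifold.presentation {n : ℕ} (X : AnalyticOrbifold n) : Presentation ℂ where
  U := manifoldSpace n X.U
  R := manifoldSpace n X.R
  s := ChartedSpace.locallyRingedSpaceMap X.s (X.etale_s.contMDiff.of_le le_top)
  t := ChartedSpace.locallyRingedSpaceMap X.t (X.etale_t.contMDiff.of_le le_top)

/-! ### Poisson triples -/

/-- A Poisson structure `σ` and a closed Poisson subvariety `Y` of pure dimension `d` on an orbifold
`X = [U / R]`: a Poisson structure and a Poisson subvariety on the atlas `U`, both invariant under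
`R`, i.e. with equal pullbacks along the étale maps `s, t : R ⇉ U`. -/
structure PoissonTriple {K : Type u} [Field K] (X : Presentation K) (d : ℕ) where
  /-- the Poisson structure -/
  σ : PoissonStructure X.U
  /-- the ideal sheaf of `Y` -/
  J : CoherentIdealSheaf X.U
  σ_invariant : ∃ σR : PoissonStructure X.R, IsPoissonMap X.s σR σ ∧ IsPoissonMap X.t σR σ
  J_invariant : ∀ r : X.R.toLRS,
    (J.stalk (X.s.base r)).map (X.s.stalkMap r).hom =
      (J.stalk (X.t.base r)).map (X.t.stalkMap r).hom
  reduced : J.IsReduced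
  poisson : J.IsPoisson σ
  pureDimension : J.HasPureDimension d

namespace PoissonTriple

variable {K : Type u} [Field K] {X : Presentation K}

/-- `p` is a non-nilpotent point of a Poisson triple of dimension `(3, 1)`: a singular point of `Y`
at which the Lie algebra `𝔥_p` obtained by linearization of `σ` is not nilpotent. (On such triples
`σ` vanishes along `Y` for dimension reasons, so `𝔥_p` is defined at every point of `Y`.) -/
def IsNonNilpotentPoint (T : PoissonTriple X 1) (p : X.U.toLRS) : Prop :=
  T.J.IsSingularAt p ∧
    ∀ hσ : T.σ.VanishesAt p, ¬ LieRing.IsNilpotent (T.σ.Linearization p hσ)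

/-- The normal form at `p`: there are formal coordinates `(x, y, z)` at `p` and a power series
`f(y, z)` such that, on the formal neighbourhood of `p`, one has `σ = x ∂_x ∧ ∂_y` and the ideal of
`Y` is generated by `x` and `f(y, z)`. -/
def HasNormalFormAt {d : ℕ} (T : PoissonTriple X d) (p : X.U.toLRS) : Prop :=
  ∃ (x : X.U.FormalCoordinates p 3) (f : MvPowerSeries (Fin 2) K),
    T.σ.IsGivenBy x (bivectorBracket (MvPowerSeries.X 0) 0 1) ∧
    (T.J.stalk p).map (algebraMap (X.U.Stalk p) (X.U.FormalNbhd p)) =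
      (Ideal.span {MvPowerSeries.X 0, MvPowerSeries.rename Fin.succ f}).map x.iso

end PoissonTriple

end PoissonTriples

end

/-! The proof finds the Lie algebra 𝔥_p, lifts its structure to a formal normal form of σ with one
undetermined series G, and then uses the curve Y to show G = 0. It takes place in the local ring O
at p, with maximal ideal m, equipped with generators of m and dual derivations (`DualCoordinates`);
these identify the completion of O with K[[x,y,z]]. On a scheme they come from Kähler differentials
at a closed point. A singular point of Y is closed because a reduced curve is regular at its generic
points. On a complex manifold they come from Hadamard's lemma.

Linear part. A curve has no nonzero Poisson bracket, so every bracket lies in the ideal J of Y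
(`IsCurveIdeal.ham_mem`): modulo a minimal prime of J and a high power of a, two functions a, b
satisfy a polynomial relation, and differentiating it along {a,·} is incompatible with {a,b} being
nonzero there. Since Y is singular, J has image of dimension at most one in m/m². Hence the derived
algebra of 𝔥_p is at most a line. If 𝔥_p is not nilpotent, that line is not central, and 𝔥_p has a
basis x, y, z with [x,y] = x, z central and x coming from J (`DualCoordinates.exists_adapted`).

Formal normal form (`exists_formal_normal_form`). The vector field {·,y} has linear part x∂_x. As in
the Poincaré–Dulac theorem, x and z can be corrected to generalized eigenvectors of weights 1 and 0,
and y has weight 0 already. By the Jacobi identity the bracket respects weights, so {x,y} = xu,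
{x,z} = xv and {y,z} = g with u, v, g series in y and z. Rectifying ∂_y + (v/u)∂_z gives {x,y} = x
and {x,z} = 0, and the Jacobi identity then makes {y,z} = G depend on z alone.

The curve. The completed ideal Ĵ contains all brackets, hence x and G(z). Parameters are not zero
divisors modulo Ĵ, and an ideal of K[[y,z]] with this property is principal, so Ĵ = (x, f(y,z))
(`exists_eq_span_pair`). If G were nonzero, f would divide a power of z up to a unit, giving Ĵ = (x,
z^k). The cases k = 0, 1 contradict what is known of the linear parts of J, and k ≥ 2 contradicts
reducedness of Y (`comap_ne_span_pow`). So G = 0. -/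

namespace MvPowerSeries

/-! ### The order filtration on power series, derivations, and changes of coordinates tangent to the
identity. -/

section Filtration

variable {σ K : Type*} [Field K]

/-- The ideal of power series of order at least `k`. -/
def orderIdeal (σ K : Type*) [Field K] (k : ℕ) : Ideal (MvPowerSeries σ K) where
  carrier := {f | (k : ℕ∞) ≤ f.order}
  add_mem' ha hb := (le_min ha hb).trans min_order_le_add
  zero_mem' := by simp
  smul_mem' c f hf := le_trans (le_trans hf le_add_self) le_order_mul

theorem mem_orderIdeal_iff_le_order {k : ℕ} {f : MvPowerSeries σ K} :
    f ∈ orderIdeal σ K k ↔ (k : ℕ∞) ≤ f.order := Iff.rfl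

theorem mem_orderIdeal {k : ℕ} {f : MvPowerSeries σ K} :
    f ∈ orderIdeal σ K k ↔ ∀ n, Finsupp.degree n < k → coeff n f = 0 :=
  ⟨fun h n hn => coeff_of_lt_order (lt_of_lt_of_le (by exact_mod_cast hn) h),
    fun h => nat_le_order h⟩

theorem orderIdeal_antitone : Antitone (orderIdeal σ K) := fun _ _ h _ hf =>
  mem_orderIdeal.2 fun n hn => mem_orderIdeal.1 hf n (hn.trans_le h)

@[simp] theorem orderIdeal_zero : orderIdeal σ K 0 = ⊤ := by
  ext f; simp [mem_orderIdeal]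

theorem mul_mem_orderIdeal {a b : ℕ} {f g : MvPowerSeries σ K} (hf : f ∈ orderIdeal σ K a)
    (hg : g ∈ orderIdeal σ K b) : f * g ∈ orderIdeal σ K (a + b) := by
  rw [mem_orderIdeal_iff_le_order] at *
  push_cast
  exact (add_le_add hf hg).trans le_order_mul

theorem mem_orderIdeal_one {f : MvPowerSeries σ K} :
    f ∈ orderIdeal σ K 1 ↔ constantCoeff f = 0 := by
  rw [mem_orderIdeal]
  constructor
  · intro h; exact h 0 (by simp)
  · intro h n hn
    rw [Nat.lt_one_iff, Finsupp.degree_eq_zero_iff] at hn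
    subst hn; exact h

theorem X_mem_orderIdeal_one (i : σ) : (X i : MvPowerSeries σ K) ∈ orderIdeal σ K 1 := by
  simp [mem_orderIdeal_one]

theorem pow_mem_orderIdeal {f : MvPowerSeries σ K} (hf : f ∈ orderIdeal σ K 1) (k : ℕ) :
    f ^ k ∈ orderIdeal σ K k := by
  induction k with
  | zero => simp
  | succ k ih => rw [pow_succ]; exact mul_mem_orderIdeal ih hf

theorem eq_zero_of_forall_mem_orderIdeal {f : MvPowerSeries σ K}
    (h : ∀ k, f ∈ orderIdeal σ K k) : f = 0 := by
  ext n
  exact mem_orderIdeal.1 (h (Finsupp.degree n + 1)) n (Nat.lt_succ_self _)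

theorem coeff_eq_of_sub_mem {k : ℕ} {f g : MvPowerSeries σ K} (h : f - g ∈ orderIdeal σ K k)
    {n : σ →₀ ℕ} (hn : Finsupp.degree n < k) : coeff n f = coeff n g := by
  have := mem_orderIdeal.1 h n hn
  rwa [map_sub, sub_eq_zero] at this

/-- The ring of power series is complete for the order filtration. -/
theorem exists_limit (s : ℕ → MvPowerSeries σ K)
    (hs : ∀ k, s (k + 1) - s k ∈ orderIdeal σ K k) : ∃ f, ∀ k, f - s k ∈ orderIdeal σ K k := by
  have hs' : ∀ k l, k ≤ l → s l - s k ∈ orderIdeal σ K k := by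
    intro k l hkl
    induction l, hkl using Nat.le_induction with
    | base => simp
    | succ l hl ih =>
      have := add_mem (orderIdeal_antitone hl (hs l)) ih
      simpa using this
  let f : MvPowerSeries σ K := fun n => coeff n (s (Finsupp.degree n + 1))
  have hf : ∀ n, coeff n f = coeff n (s (Finsupp.degree n + 1)) := fun n => rfl
  refine ⟨f, fun k => mem_orderIdeal.2 fun n hn => ?_⟩
  rw [map_sub, sub_eq_zero, hf]
  exact (coeff_eq_of_sub_mem (hs' _ _ (Nat.succ_le_of_lt hn)) (Nat.lt_succ_self _)).symm

open Classical in
theorem exists_eq_sum_X_mul [Fintype σ] [Nonempty σ] {k : ℕ} {f : MvPowerSeries σ K}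
    (hf : f ∈ orderIdeal σ K (k + 1)) :
    ∃ g : σ → MvPowerSeries σ K, (∀ i, g i ∈ orderIdeal σ K k) ∧ f = ∑ i, X i * g i := by
  -- Each nonconstant monomial is assigned to one variable dividing it, so that no term of f is
  -- counted twice in the sum.
  have hc : ∀ n : σ →₀ ℕ, ∃ i, n ≠ 0 → n i ≠ 0 := by
    intro n
    by_cases h : n = 0
    · exact ⟨Classical.arbitrary σ, fun h' => absurd h h'⟩
    · obtain ⟨i, hi⟩ := Finsupp.ne_iff.1 h
      exact ⟨i, fun _ => hi⟩
  choose idx hidx using hc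
  let g : σ → MvPowerSeries σ K := fun i m =>
    if idx (m + Finsupp.single i 1) = i then coeff (m + Finsupp.single i 1) f else 0
  have hg : ∀ i m, coeff m (g i) =
    if idx (m + Finsupp.single i 1) = i then coeff (m + Finsupp.single i 1) f else 0 :=
    fun _ _ => rfl
  refine ⟨g, fun i => mem_orderIdeal.2 fun m hm => ?_, ?_⟩
  · rw [hg]
    split_ifs
    · exact mem_orderIdeal.1 hf _ (by simpa using hm)
    · rfl
  · ext n
    rw [map_sum]
    have key : ∀ i, coeff n (X i * g i) = if idx n = i then coeff n f else 0 := by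
      intro i
      rw [X_def, coeff_monomial_mul, hg]
      by_cases h0 : n = 0
      · subst h0
        have : coeff 0 f = 0 := mem_orderIdeal.1 hf 0 (by simp)
        simp [this]
      · have := hidx n h0
        by_cases hi : idx n = i
        · have hle : Finsupp.single i 1 ≤ n := by
            rw [Finsupp.single_le_iff]; subst hi; omega
          rw [if_pos hle, tsub_add_cancel_of_le hle]
          simp
        · rw [if_neg hi]
          split_ifs with h1 h2
          · rw [tsub_add_cancel_of_le h1] at h2; exact absurd h2 hi
          · simp
          · rfl
    simp [key]

theorem orderIdeal_eq_span_pow [Fintype σ] [Nonempty σ] (k : ℕ) :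
    orderIdeal σ K k = Ideal.span (Set.range X) ^ k := by
  induction k with
  | zero => simp
  | succ k ih =>
    apply le_antisymm
    · intro f hf
      obtain ⟨g, hg, rfl⟩ := exists_eq_sum_X_mul hf
      refine Ideal.sum_mem _ fun i _ => ?_
      rw [pow_succ']
      exact Ideal.mul_mem_mul (Ideal.subset_span ⟨i, rfl⟩) (ih ▸ hg i)
    · rw [pow_succ', Ideal.mul_le]
      intro a ha b hb
      rw [← ih] at hb
      rw [add_comm]
      refine mul_mem_orderIdeal ?_ hb
      refine (Ideal.span_le.2 ?_) ha
      rintro _ ⟨i, rfl⟩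
      exact X_mem_orderIdeal_one i

theorem maximalIdeal_eq_orderIdeal : maximalIdeal (MvPowerSeries σ K) = orderIdeal σ K 1 := by
  ext f
  rw [mem_maximalIdeal, mem_nonunits_iff, mem_orderIdeal_one, isUnit_iff_constantCoeff]
  simp

theorem orderIdeal_eq_pow [Fintype σ] [Nonempty σ] (k : ℕ) :
    orderIdeal σ K k = maximalIdeal (MvPowerSeries σ K) ^ k := by
  rw [maximalIdeal_eq_orderIdeal, orderIdeal_eq_span_pow, orderIdeal_eq_span_pow, pow_one]

/-- Krull's intersection theorem for the quotient by I: every ideal is closed in the order topology.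
-/
theorem mem_of_forall_mem_sup_orderIdeal [Fintype σ] [Nonempty σ] (I : Ideal (MvPowerSeries σ K))
    {f : MvPowerSeries σ K} (h : ∀ k, f ∈ I ⊔ orderIdeal σ K k) : f ∈ I := by
  by_cases hI : I = ⊤
  · simp [hI]
  have : Nontrivial (MvPowerSeries σ K ⧸ I) := Ideal.Quotient.nontrivial_iff.2 hI
  have : IsHausdorff (maximalIdeal (MvPowerSeries σ K)) (MvPowerSeries σ K ⧸ I) :=
    IsHausdorff.of_isLocalRing _ _ (maximalIdeal.isMaximal _).ne_top
  rw [← Ideal.Quotient.eq_zero_iff_mem]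
  refine this.haus _ fun n => ?_
  rw [SModEq.zero]
  obtain ⟨a, ha, b, hb, hab⟩ := Submodule.mem_sup.1 (h n)
  have e : Ideal.Quotient.mk I f = b • (1 : MvPowerSeries σ K ⧸ I) := by
    rw [← hab, map_add, Ideal.Quotient.eq_zero_iff_mem.2 ha, zero_add]
    exact Algebra.algebraMap_eq_smul_one b
  rw [e]
  exact Submodule.smul_mem_smul (orderIdeal_eq_pow (σ := σ) (K := K) n ▸ hb) trivial

theorem sub_C_mem_orderIdeal_one (f : MvPowerSeries σ K) :
    f - C (constantCoeff f) ∈ orderIdeal σ K 1 := by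
  simp [mem_orderIdeal_one]

section Derivation

theorem _root_.Derivation.finset_sum_apply {R A M ι : Type*} [CommSemiring R] [CommSemiring A]
    [Algebra R A] [AddCommMonoid M] [Module A M] [Module R M] (s : Finset ι)
    (D : ι → Derivation R A M) (a : A) : (∑ i ∈ s, D i) a = ∑ i ∈ s, D i a := by
  classical
  induction s using Finset.induction_on with
  | empty => simp
  | insert i s hi ih => rw [Finset.sum_insert hi, Finset.sum_insert hi, Derivation.add_apply, ih]

variable [Fintype σ] [Nonempty σ]

theorem derivation_apply_mem_orderIdeal
    (D : Derivation K (MvPowerSeries σ K) (MvPowerSeries σ K))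
    {j : ℕ} (hD : ∀ i, D (X i) ∈ orderIdeal σ K j) (f : MvPowerSeries σ K) :
    D f ∈ orderIdeal σ K j := by
  have key : ∀ l ≤ j, ∀ f, D f ∈ orderIdeal σ K l := by
    intro l
    induction l with
    | zero => simp
    | succ l ih =>
      intro hl f
      have e : D f = D (f - C (constantCoeff f)) := by
        rw [map_sub]
        have : D (C (constantCoeff f)) = 0 := D.map_algebraMap _
        rw [this, sub_zero]
      obtain ⟨g, hg, h⟩ := exists_eq_sum_X_mul (k := 0) (sub_C_mem_orderIdeal_one f)
      rw [e, h, map_sum]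
      refine Ideal.sum_mem _ fun i _ => ?_
      rw [Derivation.leibniz, smul_eq_mul, smul_eq_mul]
      refine add_mem ?_ (Ideal.mul_mem_left _ _ (orderIdeal_antitone hl (hD i)))
      rw [add_comm]
      exact mul_mem_orderIdeal (X_mem_orderIdeal_one i) (ih (by omega) _)
  exact key j le_rfl f

/-- Leibniz on X i * g i. The cases j = 0, 1, 2 (losing one order, preserving order, gaining one)
are all used. -/
theorem derivation_mem_orderIdeal (D : Derivation K (MvPowerSeries σ K) (MvPowerSeries σ K))
    {j : ℕ} (hD : ∀ i, D (X i) ∈ orderIdeal σ K j) {k : ℕ} {f : MvPowerSeries σ K}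
    (hf : f ∈ orderIdeal σ K (k + 1)) : D f ∈ orderIdeal σ K (k + j) := by
  induction k generalizing f with
  | zero => simpa using derivation_apply_mem_orderIdeal D hD f
  | succ k ih =>
    obtain ⟨g, hg, rfl⟩ := exists_eq_sum_X_mul hf
    rw [map_sum]
    refine Ideal.sum_mem _ fun i _ => ?_
    rw [Derivation.leibniz, smul_eq_mul, smul_eq_mul]
    refine add_mem ?_ ?_
    · have := mul_mem_orderIdeal (X_mem_orderIdeal_one (K := K) i) (ih (hg i))
      convert this using 1; ring_nf
    · exact mul_mem_orderIdeal (hg i) (hD i)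

theorem derivation_mem_orderIdeal_of_succ
    (D : Derivation K (MvPowerSeries σ K) (MvPowerSeries σ K)) {k : ℕ} {f : MvPowerSeries σ K}
    (hf : f ∈ orderIdeal σ K (k + 1)) : D f ∈ orderIdeal σ K k :=
  derivation_mem_orderIdeal D (j := 0) (by simp) hf

theorem derivation_mem_orderIdeal_of_mem
    (D : Derivation K (MvPowerSeries σ K) (MvPowerSeries σ K))
    (hD : ∀ i, D (X i) ∈ orderIdeal σ K 1) {k : ℕ} {f : MvPowerSeries σ K}
    (hf : f ∈ orderIdeal σ K k) : D f ∈ orderIdeal σ K k := by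
  cases k with
  | zero => simp
  | succ k => exact derivation_mem_orderIdeal D hD hf

theorem derivation_ext {D D' : Derivation K (MvPowerSeries σ K) (MvPowerSeries σ K)}
    (h : ∀ i, D (X i) = D' (X i)) : D = D' := by
  ext1 f
  rw [← sub_eq_zero, ← Derivation.sub_apply]
  refine eq_zero_of_forall_mem_orderIdeal fun k => ?_
  refine derivation_apply_mem_orderIdeal _ (fun i => ?_) f
  rw [Derivation.sub_apply, h, sub_self]
  exact zero_mem _

theorem derivation_eq_sum_pderiv (D : Derivation K (MvPowerSeries σ K) (MvPowerSeries σ K))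
    (f : MvPowerSeries σ K) : D f = ∑ i, D (X i) * pderiv K i f := by
  classical
  have : D = ∑ i, D (X i) • pderiv K i := by
    refine derivation_ext fun j => ?_
    rw [Derivation.finset_sum_apply]
    simp [pderiv_X, Pi.single_apply]
  conv_lhs => rw [this]
  rw [Derivation.finset_sum_apply]
  simp

end Derivation

section Unipotent

variable [Fintype σ] [Nonempty σ] (φ : MvPowerSeries σ K →ₐ[K] MvPowerSeries σ K)

theorem algHom_mem_orderIdeal (hφ : ∀ i, φ (X i) ∈ orderIdeal σ K 1) {k : ℕ}
    {f : MvPowerSeries σ K} (hf : f ∈ orderIdeal σ K k) : φ f ∈ orderIdeal σ K k := by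
  induction k generalizing f with
  | zero => simp
  | succ k ih =>
    obtain ⟨g, hg, rfl⟩ := exists_eq_sum_X_mul hf
    rw [map_sum]
    refine Ideal.sum_mem _ fun i _ => ?_
    rw [map_mul, add_comm]
    exact mul_mem_orderIdeal (hφ i) (ih (hg i))

variable {φ}

omit [Fintype σ] [Nonempty σ] in
theorem map_X_mem_of_sub_mem (hφ : ∀ i, φ (X i) - X i ∈ orderIdeal σ K 2) (i : σ) :
    φ (X i) ∈ orderIdeal σ K 1 := by
  have := add_mem (orderIdeal_antitone one_le_two (hφ i)) (X_mem_orderIdeal_one i)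
  rwa [sub_add_cancel] at this

/-- φ acts as the identity on the associated graded ring; this unipotence makes successive
approximation converge and gives bijectivity. -/
theorem algHom_sub_self_mem_orderIdeal (hφ : ∀ i, φ (X i) - X i ∈ orderIdeal σ K 2) {k : ℕ}
    {f : MvPowerSeries σ K} (hf : f ∈ orderIdeal σ K k) : φ f - f ∈ orderIdeal σ K (k + 1) := by
  have hφ1 := map_X_mem_of_sub_mem hφ
  induction k generalizing f with
  | zero =>
    have h1 := sub_C_mem_orderIdeal_one f
    have h2 := algHom_mem_orderIdeal φ hφ1 h1
    have e : φ f - f = φ (f - C (constantCoeff f)) - (f - C (constantCoeff f)) := by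
      have : φ (C (constantCoeff f)) = C (constantCoeff f) := φ.commutes _
      rw [map_sub, this]; ring
    rw [e]
    exact sub_mem h2 h1
  | succ k ih =>
    obtain ⟨g, hg, rfl⟩ := exists_eq_sum_X_mul hf
    rw [map_sum, ← Finset.sum_sub_distrib]
    refine Ideal.sum_mem _ fun i _ => ?_
    have e : φ (X i * g i) - X i * g i = (φ (X i) - X i) * φ (g i) + X i * (φ (g i) - g i) := by
      rw [map_mul]; ring
    rw [e]
    refine add_mem ?_ ?_
    · have := mul_mem_orderIdeal (hφ i) (algHom_mem_orderIdeal φ hφ1 (hg i))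
      convert this using 1; ring_nf
    · have := mul_mem_orderIdeal (X_mem_orderIdeal_one (K := K) i) (ih (hg i))
      convert this using 1; ring_nf

theorem mem_orderIdeal_of_algHom_mem (hφ : ∀ i, φ (X i) - X i ∈ orderIdeal σ K 2) {k : ℕ}
    {f : MvPowerSeries σ K} (hf : φ f ∈ orderIdeal σ K k) : f ∈ orderIdeal σ K k := by
  have key : ∀ l ≤ k, f ∈ orderIdeal σ K l := by
    intro l
    induction l with
    | zero => simp
    | succ l ih =>
      intro hl
      have := sub_mem (orderIdeal_antitone hl hf)
        (algHom_sub_self_mem_orderIdeal hφ (ih (by omega)))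
      simpa using this
  exact key k le_rfl

theorem algHom_bijective (hφ : ∀ i, φ (X i) - X i ∈ orderIdeal σ K 2) :
    Function.Bijective φ := by
  constructor
  · rw [injective_iff_map_eq_zero]
    intro f hf
    exact eq_zero_of_forall_mem_orderIdeal fun k =>
      mem_orderIdeal_of_algHom_mem hφ (by rw [hf]; exact zero_mem _)
  · intro g
    -- Correct the approximate preimage by its own error; unipotence of φ raises the order of the
    -- error by one at each step.
    let s : ℕ → MvPowerSeries σ K := fun k => Nat.rec 0 (fun _ f => f + (g - φ f)) k
    have hs : ∀ k, s (k + 1) = s k + (g - φ (s k)) := fun _ => rfl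
    have h : ∀ k, g - φ (s k) ∈ orderIdeal σ K k := by
      intro k
      induction k with
      | zero => simp
      | succ k ih =>
        have := algHom_sub_self_mem_orderIdeal hφ ih
        rw [hs, map_add]
        convert neg_mem this using 1
        ring
    obtain ⟨f, hf⟩ := exists_limit s fun k => by rw [hs, add_sub_cancel_left]; exact h k
    refine ⟨f, ?_⟩
    rw [← sub_eq_zero]
    refine eq_zero_of_forall_mem_orderIdeal fun k => ?_
    have := sub_mem (algHom_mem_orderIdeal φ (map_X_mem_of_sub_mem hφ) (hf k)) (h k)
    convert this using 1
    rw [map_sub]; ring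

/-- A change of coordinates tangent to the identity. -/
theorem exists_algEquiv (a : σ → MvPowerSeries σ K) (ha : ∀ i, a i - X i ∈ orderIdeal σ K 2) :
    ∃ φ : MvPowerSeries σ K ≃ₐ[K] MvPowerSeries σ K, ∀ i, φ (X i) = a i := by
  have ha1 : ∀ i, constantCoeff (a i) = 0 := by
    intro i
    have := add_mem (orderIdeal_antitone one_le_two (ha i)) (X_mem_orderIdeal_one i)
    rwa [sub_add_cancel, mem_orderIdeal_one] at this
  have hs : HasSubst a := hasSubst_of_constantCoeff_zero ha1
  have hX : ∀ i, (substAlgHom (R := K) hs) (X i) = a i := fun i => substAlgHom_X hs i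
  have hb := algHom_bijective (φ := substAlgHom (R := K) hs) fun i => by rw [hX]; exact ha i
  exact ⟨AlgEquiv.ofBijective _ hb, hX⟩

end Unipotent

end Filtration

end MvPowerSeries

/-! ### Formal generalized eigenvectors (weight vectors) of a derivation, and a Poincaré–Dulac
argument. -/

namespace MvPowerSeries

section Weight

variable {σ K : Type*} [Field K]

/-- The operator `D - c`. -/
noncomputable def shift (D : Derivation K (MvPowerSeries σ K) (MvPowerSeries σ K)) (c : K) :
    Module.End K (MvPowerSeries σ K) := D.toLinearMap - c • LinearMap.id

/-- `f` is a formal generalized eigenvector of `D` with eigenvalue `c`. -/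
def IsWeightVector (D : Derivation K (MvPowerSeries σ K) (MvPowerSeries σ K)) (c : K)
    (f : MvPowerSeries σ K) : Prop :=
  ∀ k, ∃ M, ((shift D c) ^ M) f ∈ orderIdeal σ K k

variable {D : Derivation K (MvPowerSeries σ K) (MvPowerSeries σ K)}

theorem shift_apply (c : K) (f : MvPowerSeries σ K) :
    (shift D c) f = D f - c • f := rfl

variable (hD1 : ∀ k, ∀ f ∈ orderIdeal σ K k, D f ∈ orderIdeal σ K k)

theorem smul_mem_orderIdeal (c : K) {k : ℕ} {f : MvPowerSeries σ K} (hf : f ∈ orderIdeal σ K k) :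
    c • f ∈ orderIdeal σ K k := Submodule.smul_of_tower_mem _ c hf

include hD1

theorem pow_apply_mem_orderIdeal (c : K) (M k : ℕ) {f : MvPowerSeries σ K}
    (hf : f ∈ orderIdeal σ K k) :
    ((shift D c) ^ M) f ∈ orderIdeal σ K k := by
  induction M with
  | zero => simpa using hf
  | succ M ih =>
    rw [pow_succ', Module.End.mul_apply, shift_apply]
    exact sub_mem (hD1 _ _ ih) (smul_mem_orderIdeal _ ih)

/-- D - (a + b) applied to op f g is the sum of op with D - a on the first argument and op with D -
b on the second. After p + q applications each term carries p factors on the left or q on the right.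
It is used for multiplication and for Poisson brackets. -/
theorem IsWeightVector.map₂ {a b : K} {f g : MvPowerSeries σ K}
    (op : MvPowerSeries σ K →ₗ[K] MvPowerSeries σ K →ₗ[K] MvPowerSeries σ K)
    (hop : ∀ f g, D (op f g) = op (D f) g + op f (D g))
    (hl : ∀ k, ∀ f ∈ orderIdeal σ K k, ∀ g, op f g ∈ orderIdeal σ K k)
    (hr : ∀ k f, ∀ g ∈ orderIdeal σ K k, op f g ∈ orderIdeal σ K k)
    (hf : IsWeightVector D a f) (hg : IsWeightVector D b g) :
    IsWeightVector D (a + b) (op f g) := by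
  intro k
  obtain ⟨p, hp⟩ := hf k
  obtain ⟨q, hq⟩ := hg k
  refine ⟨p + q, ?_⟩
  clear hf hg
  obtain ⟨N, hN⟩ : ∃ N, N = p + q := ⟨_, rfl⟩
  induction N generalizing p q f g with
  | zero =>
    obtain ⟨rfl, rfl⟩ : p = 0 ∧ q = 0 := by omega
    exact hl k f (by simpa using hp) g
  | succ N ih =>
    rcases Nat.eq_zero_or_pos p with rfl | hp0
    · exact pow_apply_mem_orderIdeal hD1 _ _ _ (hl k f (by simpa using hp) g)
    rcases Nat.eq_zero_or_pos q with rfl | hq0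
    · exact pow_apply_mem_orderIdeal hD1 _ _ _ (hr k f g (by simpa using hq))
    obtain ⟨p, rfl⟩ : ∃ p', p = p' + 1 := ⟨p - 1, by omega⟩
    obtain ⟨q, rfl⟩ : ∃ q', q = q' + 1 := ⟨q - 1, by omega⟩
    have e : (shift D (a + b)) (op f g) =
        op ((shift D a) f) g +
        op f ((shift D b) g) := by
      simp only [shift_apply, hop, map_sub, map_smul, LinearMap.sub_apply,
        LinearMap.smul_apply, add_smul]
      abel
    rw [show p + 1 + (q + 1) = (p + (q + 1)) + 1 by omega, pow_succ, Module.End.mul_apply, e,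
      map_add]
    refine add_mem (ih _ ?_ _ hq (by omega)) ?_
    · rwa [pow_succ, Module.End.mul_apply] at hp
    · rw [show p + (q + 1) = p + 1 + q by omega]
      refine ih _ hp _ ?_ (by omega)
      rwa [pow_succ, Module.End.mul_apply] at hq

theorem IsWeightVector.mul {a b : K} {f g : MvPowerSeries σ K}
    (hf : IsWeightVector D a f) (hg : IsWeightVector D b g) :
    IsWeightVector D (a + b) (f * g) :=
  IsWeightVector.map₂ hD1 (LinearMap.mul K _) (fun f g => by simp [mul_comm, add_comm])
    (fun k f hf g => Ideal.mul_mem_right _ _ hf) (fun k f g hg => Ideal.mul_mem_left _ _ hg) hf hg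

omit hD1 in
theorem isWeightVector_C (c : K) : IsWeightVector D 0 (C c) := fun k => ⟨1, by
  have : D (C c) = 0 := D.map_algebraMap c
  simp [shift_apply, this]⟩

theorem IsWeightVector.sub {a : K} {f g : MvPowerSeries σ K}
    (hf : IsWeightVector D a f) (hg : IsWeightVector D a g) : IsWeightVector D a (f - g) := by
  intro k
  obtain ⟨p, hp⟩ := hf k
  obtain ⟨q, hq⟩ := hg k
  refine ⟨p + q, ?_⟩
  rw [map_sub]
  refine sub_mem ?_ ?_
  · rw [add_comm, pow_add, Module.End.mul_apply]
    exact pow_apply_mem_orderIdeal hD1 _ _ _ hp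
  · rw [pow_add, Module.End.mul_apply]
    exact pow_apply_mem_orderIdeal hD1 _ _ _ hq

omit hD1 in
theorem IsWeightVector.zero {a : K} : IsWeightVector D a 0 := fun k => ⟨0, by simp⟩

theorem IsWeightVector.sum {ι : Type*} (s : Finset ι) {a : K} {f : ι → MvPowerSeries σ K}
    (hf : ∀ i ∈ s, IsWeightVector D a (f i)) : IsWeightVector D a (∑ i ∈ s, f i) := by
  classical
  induction s using Finset.induction_on with
  | empty => simpa using IsWeightVector.zero
  | insert i s hi ih =>
    rw [Finset.sum_insert hi, ← sub_neg_eq_add, neg_eq_zero_sub]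
    refine (hf i (Finset.mem_insert_self _ _)).sub hD1 (IsWeightVector.zero.sub hD1 (ih ?_))
    exact fun j hj => hf j (Finset.mem_insert_of_mem hj)

theorem IsWeightVector.pow {a : K} {f : MvPowerSeries σ K}
    (hf : IsWeightVector D a f) (n : ℕ) : IsWeightVector D (n * a) (f ^ n) := by
  induction n with
  | zero => simpa using isWeightVector_C (D := D) 1
  | succ n ih =>
    have := ih.mul hD1 hf
    rw [pow_succ]
    convert this using 1
    push_cast; ring

theorem isWeightVector_monomial {i : σ}
    (h1 : IsWeightVector D 1 (X i)) (h0 : ∀ j ≠ i, IsWeightVector D 0 (X j)) (n : σ →₀ ℕ) (a : K) :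
    IsWeightVector D (n i) (monomial n a) := by
  induction n using Finsupp.induction_linear generalizing a with
  | zero => simpa using isWeightVector_C a
  | add f g hf hg =>
    have := (hf a).mul hD1 (hg 1)
    rw [monomial_mul_monomial, mul_one] at this
    simpa using this
  | single j m =>
    have e : monomial (Finsupp.single j m) a = C a * X j ^ m := by
      rw [X_pow_eq, ← monomial_zero_eq_C_apply, monomial_mul_monomial]; simp
    rw [e]
    by_cases hj : j = i
    · subst hj
      have := (isWeightVector_C a).mul hD1 (h1.pow hD1 m)
      simpa using this
    · have := (isWeightVector_C a).mul hD1 ((h0 j hj).pow hD1 m)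
      simpa [Finsupp.single_apply, hj] using this

end Weight

section Euler

variable {σ K : Type*} [Field K] [Fintype σ] [Nonempty σ]
  {D : Derivation K (MvPowerSeries σ K) (MvPowerSeries σ K)} {i : σ}
  (hi : D (X i) - X i ∈ orderIdeal σ K 2) (hj : ∀ j ≠ i, D (X j) ∈ orderIdeal σ K 2)

include hi hj

omit [Fintype σ] [Nonempty σ] in
theorem apply_X_mem_orderIdeal_one (j : σ) : D (X j) ∈ orderIdeal σ K 1 := by
  by_cases h : j = i
  · subst h
    have := add_mem (orderIdeal_antitone one_le_two hi) (X_mem_orderIdeal_one j)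
    rwa [sub_add_cancel] at this
  · exact orderIdeal_antitone one_le_two (hj j h)

/-- D - X i ∂_i sends all variables to order two, hence raises order, so on lowest-degree parts D
acts as the diagonal operator X i ∂_i. -/
theorem coeff_apply_of_mem_orderIdeal {k : ℕ} {f : MvPowerSeries σ K}
    (hf : f ∈ orderIdeal σ K k) {n : σ →₀ ℕ} (hn : Finsupp.degree n = k) :
    coeff n (D f) = n i * coeff n f := by
  classical
  cases k with
  | zero =>
    rw [Finsupp.degree_eq_zero_iff] at hn
    subst hn
    have := derivation_apply_mem_orderIdeal D (apply_X_mem_orderIdeal_one hi hj) f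
    simpa [mem_orderIdeal_one] using this
  | succ k =>
    let N := D - (X i : MvPowerSeries σ K) • pderiv K i
    have hN : ∀ j, N (X j) ∈ orderIdeal σ K 2 := by
      intro j
      by_cases h : j = i
      · subst h; simpa [N] using hi
      · simpa [N, pderiv_X, h, Ne.symm h] using hj j h
    have h1 := mem_orderIdeal.1 (derivation_mem_orderIdeal N hN hf) n (by omega)
    have e : D f = N f + X i * pderiv K i f := by simp [N]
    rw [e, map_add, h1, zero_add, X_def, coeff_monomial_mul]
    split_ifs with h
    · rw [coeff_pderiv, tsub_add_cancel_of_le h, one_mul, mul_comm]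
      rw [Finsupp.single_le_iff] at h
      congr 1
      rw [Finsupp.tsub_apply, Finsupp.single_eq_same, Nat.cast_sub h]
      simp
    · rw [Finsupp.single_le_iff] at h
      have : n i = 0 := by omega
      simp [this]

theorem coeff_pow_apply_of_mem_orderIdeal (c : K) (M : ℕ) {k : ℕ} {f : MvPowerSeries σ K}
    (hf : f ∈ orderIdeal σ K k) {n : σ →₀ ℕ} (hn : Finsupp.degree n = k) :
    coeff n (((shift D c) ^ M) f) =
      (n i - c) ^ M * coeff n f := by
  have hD1 : ∀ k, ∀ f ∈ orderIdeal σ K k, D f ∈ orderIdeal σ K k := fun k f hf =>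
    derivation_mem_orderIdeal_of_mem D (apply_X_mem_orderIdeal_one hi hj) hf
  induction M with
  | zero => simp
  | succ M ih =>
    rw [pow_succ', Module.End.mul_apply, shift_apply, map_sub,
      coeff_apply_of_mem_orderIdeal hi hj (pow_apply_mem_orderIdeal hD1 c M k hf) hn, coeff_smul,
      ih]
    ring

/-- Degree by degree, the leading part splits into monomials with eigenvalue c, which one more power
of D - c annihilates, and the others, on which D - c is invertible and which can be subtracted off.
No eigenvalue denominators other than n i - c occur. -/
theorem exists_isWeightVector [DecidableEq σ] (l : σ) :
    ∃ x, x - X l ∈ orderIdeal σ K 2 ∧ IsWeightVector D (if l = i then 1 else 0) x := by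
  classical
  have hD1 : ∀ k, ∀ f ∈ orderIdeal σ K k, D f ∈ orderIdeal σ K k := fun k f hf =>
    derivation_mem_orderIdeal_of_mem D (apply_X_mem_orderIdeal_one hi hj) hf
  set c : K := if l = i then 1 else 0 with hc
  set L := shift D c with hL
  let P : ℕ → MvPowerSeries σ K → Prop := fun k x =>
    x - X l ∈ orderIdeal σ K 2 ∧ (L ^ (k + 1)) x ∈ orderIdeal σ K (k + 2)
  have h0 : P 0 (X l) := by
    refine ⟨by simp, ?_⟩
    simp only [zero_add, pow_one, hL, shift_apply, hc]
    split_ifs with h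
    · subst h; simpa using hi
    · simpa using hj l h
  have step : ∀ k x, P k x → ∃ x', P (k + 1) x' ∧ x' - x ∈ orderIdeal σ K (k + 2) := by
    rintro k x ⟨hx1, hx2⟩
    set w := (L ^ (k + 1)) x with hw
    -- v inverts (D - c)^(k+1) on the part of w of degree k + 2 with eigenvalue different from c.
    let v : MvPowerSeries σ K := fun n => if Finsupp.degree n = k + 2 ∧ (n i : K) ≠ c then
      ((n i - c) ^ (k + 1))⁻¹ * coeff n w else 0
    have hv : ∀ n, coeff n v = if Finsupp.degree n = k + 2 ∧ (n i : K) ≠ c then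
      ((n i - c) ^ (k + 1))⁻¹ * coeff n w else 0 := fun _ => rfl
    have hv2 : v ∈ orderIdeal σ K (k + 2) := mem_orderIdeal.2 fun n hn => by
      rw [hv, if_neg]; omega
    refine ⟨x - v, ⟨?_, ?_⟩, ?_⟩
    · have := sub_mem hx1 (orderIdeal_antitone (by omega) hv2)
      convert this using 1; ring
    · rw [pow_succ', Module.End.mul_apply]
      have hw' : (L ^ (k + 1)) (x - v) ∈ orderIdeal σ K (k + 2) := by
        rw [map_sub]
        exact sub_mem hx2 (pow_apply_mem_orderIdeal hD1 _ _ _ hv2)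
      refine mem_orderIdeal.2 fun n hn => ?_
      have hmem : L ((L ^ (k + 1)) (x - v)) ∈ orderIdeal σ K (k + 2) := by
        have := pow_apply_mem_orderIdeal hD1 c 1 _ hw'
        rwa [pow_one] at this
      by_cases hn2 : Finsupp.degree n < k + 2
      · exact mem_orderIdeal.1 hmem n hn2
      have hn3 : Finsupp.degree n = k + 2 := by omega
      have e := coeff_pow_apply_of_mem_orderIdeal hi hj c 1 hw' hn3
      rw [pow_one, pow_one] at e
      rw [hL, e]
      by_cases hnc : (n i : K) = c
      · rw [hnc]; ring
      · rw [map_sub, map_sub, coeff_pow_apply_of_mem_orderIdeal hi hj c _ hv2 hn3, hv,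
          if_pos ⟨hn3, hnc⟩, mul_inv_cancel_left₀ (pow_ne_zero _ (sub_ne_zero.2 hnc)), ← hw, sub_self, mul_zero]
    · convert neg_mem hv2 using 1; ring
  choose! nxt hnxt1 hnxt2 using step
  let s : ℕ → MvPowerSeries σ K := fun k => Nat.rec (X l) (fun k x => nxt k x) k
  have hs : ∀ k, P k (s k) := by
    intro k
    induction k with
    | zero => exact h0
    | succ k ih => exact hnxt1 k _ ih
  obtain ⟨x, hx⟩ := exists_limit s fun k =>
    orderIdeal_antitone (by omega) (hnxt2 k _ (hs k))
  refine ⟨x, ?_, fun k => ⟨k + 1, ?_⟩⟩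
  · have := add_mem (hx 2) (hs 2).1
    convert this using 1; ring
  · have := add_mem (pow_apply_mem_orderIdeal hD1 c (k + 1) _ (hx k))
      (orderIdeal_antitone (by omega) (hs k).2)
    rw [← map_add] at this
    simpa using this

/-- By induction on degree the truncation of f below degree d has weight m, so the remainder does
too; on its degree-d part (D - m)^M acts by (n i - m)^M, which is nonzero, while the result must
have order above d. -/
theorem IsWeightVector.coeff_eq_zero
    (h1 : IsWeightVector D 1 (X i)) (h0 : ∀ j ≠ i, IsWeightVector D 0 (X j)) {m : ℕ}
    {f : MvPowerSeries σ K} (hf : IsWeightVector D m f) {n : σ →₀ ℕ} (hn : (n i : K) ≠ m) :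
    coeff n f = 0 := by
  classical
  have hD1 : ∀ k, ∀ f ∈ orderIdeal σ K k, D f ∈ orderIdeal σ K k := fun k f hf =>
    derivation_mem_orderIdeal_of_mem D (apply_X_mem_orderIdeal_one hi hj) hf
  obtain ⟨d, hd⟩ : ∃ d, d = Finsupp.degree n := ⟨_, rfl⟩
  induction d using Nat.strong_induction_on generalizing n with
  | _ d ih =>
    let p : MvPolynomial σ K := truncTotal d f
    have hp : IsWeightVector D m (p : MvPowerSeries σ K) := by
      have e : (p : MvPowerSeries σ K) = ∑ v ∈ p.support, monomial v (MvPolynomial.coeff v p) := by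
        conv_lhs => rw [p.as_sum]
        rw [← MvPolynomial.coeToMvPowerSeries.ringHom_apply, map_sum]
        simp
      rw [e]
      refine IsWeightVector.sum hD1 _ fun v hv => ?_
      rw [MvPolynomial.mem_support_iff] at hv
      have hvd : Finsupp.degree v < d := by
        by_contra h
        exact hv (coeff_truncTotal_eq_zero _ (by omega))
      have hvc : MvPolynomial.coeff v p = coeff v f := coeff_truncTotal _ hvd
      by_cases hvm : (v i : K) = m
      · rw [← hvm]; exact isWeightVector_monomial hD1 h1 h0 _ _
      · rw [hvc, ih _ hvd hvm rfl] at hv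
        exact absurd rfl hv
    have hh : f - p ∈ orderIdeal σ K d := mem_orderIdeal.2 fun v hv => by
      rw [map_sub, MvPolynomial.coeff_coe, coeff_truncTotal _ hv, sub_self]
    obtain ⟨M, hM⟩ := hf.sub hD1 hp (d + 1)
    have e := coeff_pow_apply_of_mem_orderIdeal hi hj (m : K) M hh hd.symm
    rw [mem_orderIdeal.1 hM n (by omega)] at e
    have e2 := (mul_eq_zero.1 e.symm).resolve_left (pow_ne_zero _ (sub_ne_zero.2 hn))
    rw [map_sub, MvPolynomial.coeff_coe, coeff_truncTotal_eq_zero _ (by omega), sub_zero] at e2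
    exact e2

end Euler

end MvPowerSeries

/-! ### Poisson brackets on algebras and their transport. -/

/-- A Poisson bracket on a commutative algebra. -/
structure PoissonBracket (K A : Type*) [CommRing K] [CommRing A] [Algebra K A] where
  /-- the Hamiltonian derivation of an element -/
  ham : A → Derivation K A A
  self : ∀ a, ham a a = 0
  skew : ∀ a b, ham a b = - ham b a
  jacobi : ∀ a b c, ham a (ham b c) = ham (ham a b) c + ham b (ham a c)

/-- The derivation of `A` obtained from one of `B` by an isomorphism. -/
noncomputable def Derivation.conj {K A B : Type*} [CommRing K] [CommRing A] [CommRing B]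
    [Algebra K A] [Algebra K B] (e : A ≃ₐ[K] B) (D : Derivation K B B) : Derivation K A A :=
  Derivation.mk' (e.symm.toLinearMap ∘ₗ D.toLinearMap ∘ₗ e.toLinearMap) fun a b => by
    simp

namespace PoissonBracket

variable {K A B : Type*} [CommRing K] [CommRing A] [CommRing B] [Algebra K A] [Algebra K B]

theorem conj_apply (e : A ≃ₐ[K] B) (D : Derivation K B B) (a : A) :
    Derivation.conj e D a = e.symm (D (e a)) := rfl

/-- Transport of a Poisson bracket along an isomorphism. -/
noncomputable def comap (P : PoissonBracket K B) (e : A ≃ₐ[K] B) : PoissonBracket K A where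
  ham a := Derivation.conj e (P.ham (e a))
  self a := by simp [conj_apply, P.self]
  skew a b := by rw [conj_apply, conj_apply, P.skew, map_neg]
  jacobi a b c := by
    simp only [conj_apply, AlgEquiv.apply_symm_apply]
    rw [P.jacobi, map_add]

theorem comap_ham (P : PoissonBracket K B) (e : A ≃ₐ[K] B) (a b : A) :
    (P.comap e).ham a b = e.symm (P.ham (e a) (e b)) := rfl

variable (P : PoissonBracket K A)

theorem ham_add (a b c : A) : P.ham (a + b) c = P.ham a c + P.ham b c := by
  rw [P.skew, map_add, P.skew a, P.skew b, neg_add]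

theorem ham_smul (r : K) (a c : A) : P.ham (r • a) c = r • P.ham a c := by
  rw [P.skew, Derivation.map_smul, P.skew a, smul_neg]

/-- The bracket as a bilinear map. -/
noncomputable def bilin : A →ₗ[K] A →ₗ[K] A :=
  LinearMap.mk₂ K (fun a b => P.ham a b) P.ham_add P.ham_smul
    (fun _ _ _ => map_add _ _ _) (fun _ _ _ => Derivation.map_smul _ _ _)

theorem bilin_apply (a b : A) : P.bilin a b = P.ham a b := rfl

end PoissonBracket

/-! ### Rectifying a vector field, and the formal normal form of the bracket. -/

namespace MvPowerSeries

variable {σ K : Type*} [Field K]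

theorem pderiv_eq_zero_iff [CharZero K] {i : σ} {f : MvPowerSeries σ K} :
    pderiv K i f = 0 ↔ ∀ n : σ →₀ ℕ, n i ≠ 0 → coeff n f = 0 := by
  constructor
  · intro h n hn
    have hle : Finsupp.single i 1 ≤ n := by rw [Finsupp.single_le_iff]; omega
    have := congrArg (coeff (n - Finsupp.single i 1)) h
    rw [coeff_pderiv, tsub_add_cancel_of_le hle, map_zero] at this
    refine (mul_eq_zero.1 this).resolve_right ?_
    norm_cast
  · intro h
    ext n
    rw [coeff_pderiv, h _ (by simp)]
    simp

theorem pderiv_comm (i j : σ) (f : MvPowerSeries σ K) :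
    pderiv K i (pderiv K j f) = pderiv K j (pderiv K i f) := by
  by_cases h : i = j
  · rw [h]
  · ext n
    rw [coeff_pderiv, coeff_pderiv, coeff_pderiv, coeff_pderiv, add_right_comm]
    rw [Finsupp.add_apply, Finsupp.add_apply, Finsupp.single_eq_of_ne (Ne.symm h),
      Finsupp.single_eq_of_ne h]
    push_cast
    ring

theorem exists_eq_X_mul [CharZero K] {i : σ} {f : MvPowerSeries σ K}
    (h : ∀ n : σ →₀ ℕ, n i ≠ 1 → coeff n f = 0) : ∃ u, pderiv K i u = 0 ∧ f = X i * u := by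
  obtain ⟨u, rfl⟩ : X i ∣ f := X_dvd_iff.2 fun n hn => h n (by omega)
  refine ⟨u, pderiv_eq_zero_iff.2 fun n hn => ?_, rfl⟩
  have := h (Finsupp.single i 1 + n) (by simp [hn])
  rwa [X_def, coeff_add_monomial_mul, one_mul] at this

theorem IsWeightVector.conj [Fintype σ] [Nonempty σ]
    {D : Derivation K (MvPowerSeries σ K) (MvPowerSeries σ K)}
    {φ : MvPowerSeries σ K ≃ₐ[K] MvPowerSeries σ K} (hφ : ∀ i, φ (X i) - X i ∈ orderIdeal σ K 2)
    {c : K} {f : MvPowerSeries σ K} (hf : IsWeightVector D c (φ f)) :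
    IsWeightVector (D.conj φ) c f := by
  intro k
  obtain ⟨M, hM⟩ := hf k
  refine ⟨M, ?_⟩
  have key : ∀ M, φ ((shift (D.conj φ) c ^ M) f) = (shift D c ^ M) (φ f) := by
    intro M
    induction M with
    | zero => simp
    | succ M ih =>
      rw [pow_succ', pow_succ', Module.End.mul_apply, Module.End.mul_apply, ← ih, shift_apply,
        shift_apply, PoissonBracket.conj_apply, map_sub, AlgEquiv.apply_symm_apply, map_smul]
  rw [← key] at hM
  exact mem_orderIdeal_of_algHom_mem (φ := φ.toAlgHom) hφ hM

section Straightening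

variable [Fintype σ] [Nonempty σ] [CharZero K]
  (δ E : Derivation K (MvPowerSeries σ K) (MvPowerSeries σ K)) {y : MvPowerSeries σ K}

/-- A derivation `δ` with `δ y = 1` has antiderivatives. -/
theorem exists_antiderivative (hy : y ∈ orderIdeal σ K 1) (hδ : δ y = 1) (hEy : E y = 0)
    (hE : ∀ f, E f = 0 → E (δ f) = 0) {c : MvPowerSeries σ K} (hc : E c = 0) :
    ∃ Y, δ Y = c ∧ Y - y * c ∈ orderIdeal σ K 2 ∧ E Y = 0 := by
  -- Repeated integration by parts, using δ y = 1: the series Σ (-1)^n y^(n+1) δ^n c / (n+1)!. The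
  -- derivation E (in the application, ∂_x) kills every term.
  let s : ℕ → MvPowerSeries σ K := fun N =>
    ∑ n ∈ Finset.range N, ((-1) ^ n / (n + 1).factorial : K) • (y ^ (n + 1) * δ^[n] c)
  have hs : ∀ N, s (N + 1) = s N +
      ((-1) ^ N / (N + 1).factorial : K) • (y ^ (N + 1) * δ^[N] c) := fun N =>
    Finset.sum_range_succ _ _
  have hterm : ∀ N, ((-1) ^ N / (N + 1).factorial : K) • (y ^ (N + 1) * δ^[N] c) ∈
      orderIdeal σ K (N + 1) := fun N =>
    smul_mem_orderIdeal _ (Ideal.mul_mem_right _ _ (pow_mem_orderIdeal hy _))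
  -- Applying δ telescopes the partial sums; the remainder has order at least N.
  have hδs : ∀ N, c - δ (s N) = ((-1) ^ N / N.factorial : K) • (y ^ N * δ^[N] c) := by
    intro N
    induction N with
    | zero => simp [s]
    | succ N ih =>
      rw [hs, map_add, ← sub_sub, ih, Derivation.map_smul, Derivation.leibniz, Derivation.leibniz_pow, hδ,
        ← Function.iterate_succ_apply' δ]
      simp only [smul_eq_mul, mul_one, Nat.add_sub_cancel, nsmul_eq_mul, smul_eq_C_mul]
      have h1 : ((N + 1).factorial : K) = (N + 1) * N.factorial := by
        rw [Nat.factorial_succ]; push_cast; ring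
      have h2 : (C ((-1) ^ N / (N.factorial : K)) : MvPowerSeries σ K) =
          C ((-1) ^ N / ((N + 1).factorial : K)) * ((N + 1 : ℕ) : MvPowerSeries σ K) := by
        rw [← map_natCast (C : K →+* MvPowerSeries σ K), ← map_mul, h1]
        congr 1
        have := Nat.cast_ne_zero (R := K).2 N.factorial_ne_zero
        have h3 : (N + 1 : K) ≠ 0 := by exact_mod_cast N.succ_ne_zero
        push_cast
        field_simp
      have h3 : (C ((-1) ^ (N + 1) / ((N + 1).factorial : K)) : MvPowerSeries σ K) =
          - C ((-1) ^ N / ((N + 1).factorial : K)) := by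
        rw [← map_neg]; congr 1; ring
      rw [h2, h3]
      ring
  have hEδ : ∀ n, E (δ^[n] c) = 0 := by
    intro n
    induction n with
    | zero => exact hc
    | succ n ih => rw [Function.iterate_succ_apply']; exact hE _ ih
  have hEs : ∀ N, E (s N) = 0 := by
    intro N
    rw [map_sum]
    refine Finset.sum_eq_zero fun n _ => ?_
    simp [hEδ, hEy, Derivation.leibniz_pow]
  obtain ⟨Y, hY⟩ := exists_limit s fun k => by
    rw [hs, add_sub_cancel_left]
    exact orderIdeal_antitone (by omega) (hterm k)
  refine ⟨Y, ?_, ?_, ?_⟩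
  · rw [← sub_eq_zero]
    refine eq_zero_of_forall_mem_orderIdeal fun k => ?_
    have h1 := derivation_mem_orderIdeal_of_succ δ (hY (k + 1))
    have h2 : c - δ (s (k + 1)) ∈ orderIdeal σ K k := by
      rw [hδs]
      exact smul_mem_orderIdeal _ (Ideal.mul_mem_right _ _
        (orderIdeal_antitone (by omega) (pow_mem_orderIdeal hy _)))
    convert sub_mem h1 h2 using 1
    rw [map_sub]; ring
  · have e : s 2 = y * c + ((-1) ^ 1 / (1 + 1).factorial : K) • (y ^ (1 + 1) * δ^[1] c) := by
      rw [hs]; simp [s]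
    have := add_mem (hY 2) (hterm 1)
    convert this using 1
    rw [e]; push_cast; ring
  · refine eq_zero_of_forall_mem_orderIdeal fun k => ?_
    have h1 := derivation_mem_orderIdeal_of_succ E (hY (k + 1))
    rwa [map_sub, hEs, sub_zero] at h1

end Straightening

section NormalForm

variable {K : Type*} [Field K]

local notation "S" => MvPowerSeries (Fin 3) K

theorem ham_mem_orderIdeal_one (P : PoissonBracket K S)
    (h : ∀ i j, P.ham (X i) (X j) ∈ orderIdeal (Fin 3) K 1) (f g : S) :
    P.ham f g ∈ orderIdeal (Fin 3) K 1 := by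
  refine derivation_apply_mem_orderIdeal _ (fun j => ?_) g
  rw [P.skew]
  exact neg_mem (derivation_apply_mem_orderIdeal _ (fun i => h j i) f)

theorem ham_mem_orderIdeal_right (P : PoissonBracket K S)
    (h : ∀ i j, P.ham (X i) (X j) ∈ orderIdeal (Fin 3) K 1) {k : ℕ} (f : S) {g : S}
    (hg : g ∈ orderIdeal (Fin 3) K k) : P.ham f g ∈ orderIdeal (Fin 3) K k :=
  derivation_mem_orderIdeal_of_mem _ (fun _ => ham_mem_orderIdeal_one P h _ _) hg

theorem ham_mem_orderIdeal_left (P : PoissonBracket K S)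
    (h : ∀ i j, P.ham (X i) (X j) ∈ orderIdeal (Fin 3) K 1) {k : ℕ} {f : S} (g : S)
    (hf : f ∈ orderIdeal (Fin 3) K k) : P.ham f g ∈ orderIdeal (Fin 3) K k := by
  rw [P.skew]
  exact neg_mem (ham_mem_orderIdeal_right P h g hf)

theorem ham_sub_ham_mem (P : PoissonBracket K S)
    (h : ∀ i j, P.ham (X i) (X j) ∈ orderIdeal (Fin 3) K 1) {f f' g g' : S}
    (hf : f - f' ∈ orderIdeal (Fin 3) K 2) (hg : g - g' ∈ orderIdeal (Fin 3) K 2) :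
    P.ham f g - P.ham f' g' ∈ orderIdeal (Fin 3) K 2 := by
  have h1 := ham_mem_orderIdeal_left P h g hf
  have h2 := ham_mem_orderIdeal_right P h f' hg
  have e : P.ham f g = P.ham (f - f') g + P.ham f' g := by
    rw [← P.ham_add, sub_add_cancel]
  rw [map_sub] at h2
  convert add_mem h1 h2 using 1
  rw [e]; ring

theorem forall_ham_X_mem {P : PoissonBracket K S} {I : Ideal S} (h01 : P.ham (X 0) (X 1) ∈ I)
    (h02 : P.ham (X 0) (X 2) ∈ I) (h12 : P.ham (X 1) (X 2) ∈ I) (i j : Fin 3) :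
    P.ham (X i) (X j) ∈ I := by
  have h10 := neg_mem h01
  have h20 := neg_mem h02
  have h21 := neg_mem h12
  rw [← P.skew] at h10 h20 h21
  have hs : ∀ i, P.ham (X i) (X i) ∈ I := fun i => by rw [P.self]; exact zero_mem _
  fin_cases i <;> fin_cases j <;> first | assumption | exact hs _

variable [CharZero K]

/-- Coordinates in which the bracket is homogeneous for the weights `(1, 0, 0)`. -/
theorem exists_weighted_coordinates (P : PoissonBracket K S)
    (h01 : P.ham (X 0) (X 1) - X 0 ∈ orderIdeal (Fin 3) K 2)
    (h02 : P.ham (X 0) (X 2) ∈ orderIdeal (Fin 3) K 2)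
    (h12 : P.ham (X 1) (X 2) ∈ orderIdeal (Fin 3) K 2) :
    ∃ φ : S ≃ₐ[K] S, (∀ i, φ (X i) - X i ∈ orderIdeal (Fin 3) K 2) ∧
      ∃ u v g : S, pderiv K 0 u = 0 ∧ pderiv K 0 v = 0 ∧ pderiv K 0 g = 0 ∧
        constantCoeff u = 1 ∧ constantCoeff v = 0 ∧
        (P.comap φ).ham (X 0) (X 1) = X 0 * u ∧ (P.comap φ).ham (X 0) (X 2) = X 0 * v ∧
        (P.comap φ).ham (X 1) (X 2) = g := by
  have h01' : P.ham (X 0) (X 1) ∈ orderIdeal (Fin 3) K 1 := by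
    have := add_mem (orderIdeal_antitone one_le_two h01) (X_mem_orderIdeal_one (K := K) 0)
    rwa [sub_add_cancel] at this
  have hP := forall_ham_X_mem h01' (orderIdeal_antitone one_le_two h02)
    (orderIdeal_antitone one_le_two h12)
  -- The derivation -{X 1, ·} = {·, X 1} has linear part X 0 ∂_0. This is stated for any bracket Q
  -- because it is needed again after the change of coordinates.
  have hsplit : ∀ Q : PoissonBracket K S, Q.ham (X 0) (X 1) - X 0 ∈ orderIdeal (Fin 3) K 2 →
      Q.ham (X 1) (X 2) ∈ orderIdeal (Fin 3) K 2 →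
      (-Q.ham (X 1)) (X 0) - X 0 ∈ orderIdeal (Fin 3) K 2 ∧
      ∀ j ≠ (0 : Fin 3), (-Q.ham (X 1)) (X j) ∈ orderIdeal (Fin 3) K 2 := by
    intro Q hQ1 hQ2
    refine ⟨by rwa [Derivation.neg_apply, ← Q.skew], fun j hj => ?_⟩
    rw [Derivation.neg_apply]
    fin_cases j
    · exact absurd rfl hj
    · rw [show Q.ham (X 1) (X ((fun i => i) ⟨1, by decide⟩)) = 0 from Q.self _]; simp
    · exact neg_mem hQ2
  obtain ⟨hi, hj⟩ := hsplit P h01 h12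
  obtain ⟨x, hx, hxw⟩ := exists_isWeightVector hi hj 0
  obtain ⟨z, hz, hzw⟩ := exists_isWeightVector hi hj 2
  rw [if_pos rfl] at hxw
  rw [if_neg (by decide)] at hzw
  -- X 1 is kept: {·, X 1} kills it, so it has weight 0 already, and fixing it makes the transported
  -- derivation again {·, X 1} for the new bracket.
  obtain ⟨φ, hφ⟩ := exists_algEquiv ![x, X 1, z] (by
    intro i; fin_cases i
    · exact hx
    · simp
    · exact hz)
  have hφ0 : φ (X 0) = x := hφ 0
  have hφ1 : φ (X 1) = X 1 := hφ 1
  have hφ2 : φ (X 2) = z := hφ 2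
  have hφX : ∀ i, φ (X i) - X i ∈ orderIdeal (Fin 3) K 2 := by
    intro i; fin_cases i
    · simpa [hφ0] using hx
    · simp [hφ1]
    · simpa [hφ2] using hz
  have hsymm : ∀ {k : ℕ} {f : S}, f ∈ orderIdeal (Fin 3) K k →
      φ.symm f ∈ orderIdeal (Fin 3) K k := fun {k f} hf =>
    mem_orderIdeal_of_algHom_mem (φ := φ.toAlgHom) hφX (by simpa using hf)
  set Q := P.comap φ with hQ
  -- A change of coordinates tangent to the identity does not alter the linear part of the bracket.
  have hQX : ∀ i j, Q.ham (X i) (X j) - P.ham (X i) (X j) ∈ orderIdeal (Fin 3) K 2 := by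
    intro i j
    have h1 := ham_sub_ham_mem P hP (hφX i) (hφX j)
    have h2 := hsymm h1
    have h3 := algHom_sub_self_mem_orderIdeal (φ := φ.symm.toAlgHom) (fun i => by
      have := hsymm (hφX i)
      rw [map_sub, AlgEquiv.symm_apply_apply] at this
      simpa using neg_mem this) (hP i j)
    have h3' : φ.symm (P.ham (X i) (X j)) - P.ham (X i) (X j) ∈ orderIdeal (Fin 3) K 2 := h3
    have := add_mem h2 h3'
    rw [map_sub] at this
    simpa [hQ, PoissonBracket.comap_ham] using this
  have hQ01 : Q.ham (X 0) (X 1) - X 0 ∈ orderIdeal (Fin 3) K 2 := by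
    simpa using add_mem (hQX 0 1) h01
  have hQ02 : Q.ham (X 0) (X 2) ∈ orderIdeal (Fin 3) K 2 := by
    simpa using add_mem (hQX 0 2) h02
  have hQ12 : Q.ham (X 1) (X 2) ∈ orderIdeal (Fin 3) K 2 := by
    simpa using add_mem (hQX 1 2) h12
  have hQ1 : ∀ i j, Q.ham (X i) (X j) ∈ orderIdeal (Fin 3) K 1 := fun i j => by
    simpa using add_mem (orderIdeal_antitone one_le_two (hQX i j)) (hP i j)
  obtain ⟨hQi, hQj⟩ := hsplit Q hQ01 hQ12
  have hconj : (-P.ham (X 1)).conj φ = -Q.ham (X 1) := by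
    refine Derivation.ext fun f => ?_
    rw [PoissonBracket.conj_apply, Derivation.neg_apply, Derivation.neg_apply, hQ,
      PoissonBracket.comap_ham, hφ1, map_neg]
  have hw0 : IsWeightVector (-Q.ham (X 1)) 1 (X 0) := by
    rw [← hconj]; exact IsWeightVector.conj hφX (hφ0 ▸ hxw)
  have hw2 : IsWeightVector (-Q.ham (X 1)) 0 (X 2) := by
    rw [← hconj]; exact IsWeightVector.conj hφX (hφ2 ▸ hzw)
  have hw1 : IsWeightVector (-Q.ham (X 1)) 0 (X 1) := fun k => ⟨1, by
    simp [shift_apply, Q.self]⟩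
  have hwj : ∀ j ≠ (0 : Fin 3), IsWeightVector (-Q.ham (X 1)) 0 (X j) := by
    intro j hj
    fin_cases j
    · exact absurd rfl hj
    · exact hw1
    · exact hw2
  -- By the Jacobi identity {·, X 1} is a derivation of the bracket, so weights add under brackets.
  have hbr : ∀ {a b : K} {f g : S}, IsWeightVector (-Q.ham (X 1)) a f →
      IsWeightVector (-Q.ham (X 1)) b g → IsWeightVector (-Q.ham (X 1)) (a + b) (Q.ham f g) := by
    intro a b f g hf hg
    refine IsWeightVector.map₂ (fun k f hf => derivation_mem_orderIdeal_of_mem _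
      (apply_X_mem_orderIdeal_one hQi hQj) hf) Q.bilin (fun f g => ?_) (fun k f hf g => ?_)
      (fun k f g hg => ?_) hf hg
    · simp only [PoissonBracket.bilin_apply, Derivation.neg_apply]
      rw [Q.jacobi, map_neg, Q.skew (-_) g, map_neg, neg_neg, Q.skew g]
      ring
    · exact ham_mem_orderIdeal_left Q hQ1 g hf
    · exact ham_mem_orderIdeal_right Q hQ1 f hg
  have e1 : ∀ {f : S}, IsWeightVector (-Q.ham (X 1)) 1 f → ∃ u, pderiv K 0 u = 0 ∧
      f = X 0 * u := fun {f} hf => exists_eq_X_mul fun n hn =>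
    IsWeightVector.coeff_eq_zero hQi hQj hw0 hwj (m := 1) (by simpa using hf)
      (by exact_mod_cast hn)
  obtain ⟨u, hu, hu'⟩ := e1 (f := Q.ham (X 0) (X 1)) (by simpa using hbr hw0 hw1)
  obtain ⟨v, hv, hv'⟩ := e1 (f := Q.ham (X 0) (X 2)) (by simpa using hbr hw0 hw2)
  have hcoeff : ∀ f : S, coeff (Finsupp.single 0 1) (X 0 * f) = constantCoeff f := by
    intro f
    have := coeff_add_monomial_mul (Finsupp.single (0 : Fin 3) 1) 0 f (1 : K)
    rw [add_zero, one_mul] at this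
    exact this
  refine ⟨φ, hφX, u, v, _, hu, hv, ?_, ?_, ?_, hu', hv', rfl⟩
  · rw [pderiv_eq_zero_iff]
    intro n hn
    exact IsWeightVector.coeff_eq_zero hQi hQj hw0 hwj (m := 0)
      (by simpa using hbr hw1 hw2) (by exact_mod_cast hn)
  · have := mem_orderIdeal.1 hQ01 (Finsupp.single 0 1) (by simp)
    rw [hu', map_sub, hcoeff, coeff_X, if_pos rfl, sub_eq_zero] at this
    exact this
  · have := mem_orderIdeal.1 hQ02 (Finsupp.single 0 1) (by simp)
    rwa [hv', hcoeff] at this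

end NormalForm

end MvPowerSeries

namespace MvPowerSeries

theorem X_ne_zero {σ K : Type*} [Field K] (i : σ) : (X i : MvPowerSeries σ K) ≠ 0 := fun h => by
  simpa using congrArg (coeff (Finsupp.single i 1)) h

section NormalForm

variable {K : Type*} [Field K] [CharZero K]

local notation "S" => MvPowerSeries (Fin 3) K

/-- Coordinates in which the bivector is `x ∂_x ∧ ∂_y + G(z) ∂_y ∧ ∂_z`. -/
theorem exists_straight_coordinates (Q : PoissonBracket K S) {u v g : S}
    (hu : pderiv K 0 u = 0) (hv : pderiv K 0 v = 0) (hg : pderiv K 0 g = 0)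
    (hu1 : constantCoeff u = 1) (hv0 : constantCoeff v = 0)
    (h01 : Q.ham (X 0) (X 1) = X 0 * u) (h02 : Q.ham (X 0) (X 2) = X 0 * v)
    (h12 : Q.ham (X 1) (X 2) = g) :
    ∃ ψ : S ≃ₐ[K] S, (∀ i, ψ (X i) - X i ∈ orderIdeal (Fin 3) K 2) ∧
      ∃ G : S, pderiv K 0 G = 0 ∧ pderiv K 1 G = 0 ∧
        (Q.comap ψ).ham (X 0) (X 1) = X 0 ∧ (Q.comap ψ).ham (X 0) (X 2) = 0 ∧
        (Q.comap ψ).ham (X 1) (X 2) = G := by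
  have huu : u * u⁻¹ = 1 := MvPowerSeries.mul_inv_cancel _ (by rw [hu1]; exact one_ne_zero)
  have hinv : pderiv K 0 (u⁻¹ : S) = 0 := by
    have := congrArg (pderiv K 0) huu
    rw [Derivation.leibniz, hu, smul_zero, add_zero, pderiv_one, smul_eq_mul] at this
    have h2 := congrArg (· * u⁻¹) this
    simpa [mul_right_comm, huu] using h2
  -- Chosen so that {X 0, ·} = X 0 u δ. Solving δ Y = 1/u and δ Z' = 0 then gives {X 0, Y} = X 0 and
  -- {X 0, Z'} = 0.
  set δ : Derivation K S S := pderiv K 1 + (v * u⁻¹) • pderiv K 2 with hδ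
  have hδ1 : δ (X 1) = 1 := by simp [hδ]
  have hδ2 : δ (X 2) = v * u⁻¹ := by simp [hδ]
  have hEδ : ∀ f, pderiv K 0 f = 0 → pderiv K 0 (δ f) = 0 := by
    intro f hf
    simp [hδ, Derivation.leibniz, pderiv_comm (0 : Fin 3), hf, hv, hinv]
  have hE2 : pderiv K 0 (v * u⁻¹ : S) = 0 := by simp [Derivation.leibniz, hv, hinv]
  obtain ⟨Y, hY, hYl, hYE⟩ := exists_antiderivative δ (pderiv K 0) (X_mem_orderIdeal_one 1) hδ1
    (by simp) hEδ hinv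
  obtain ⟨Z, hZ, hZl, hZE⟩ := exists_antiderivative δ (pderiv K 0) (X_mem_orderIdeal_one 1) hδ1
    (by simp) hEδ hE2
  have hY2 : Y - X 1 ∈ orderIdeal (Fin 3) K 2 := by
    have h1 : (u⁻¹ : S) - 1 ∈ orderIdeal (Fin 3) K 1 := by
      rw [mem_orderIdeal_one, map_sub, constantCoeff_inv, hu1]; simp
    have h2 := mul_mem_orderIdeal (X_mem_orderIdeal_one (K := K) (1 : Fin 3)) h1
    convert add_mem hYl h2 using 1
    ring
  have hZ2 : Z ∈ orderIdeal (Fin 3) K 2 := by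
    have h1 : v * (u⁻¹ : S) ∈ orderIdeal (Fin 3) K 1 := by
      rw [mem_orderIdeal_one, map_mul, hv0, zero_mul]
    have h2 := mul_mem_orderIdeal (X_mem_orderIdeal_one (K := K) (1 : Fin 3)) h1
    simpa using add_mem hZl h2
  have hham0 : ∀ f, Q.ham (X 0) f = X 0 * (u * δ f) := by
    intro f
    rw [derivation_eq_sum_pderiv, Fin.sum_univ_three, Q.self, h01, h02]
    simp only [hδ, Derivation.add_apply, Derivation.smul_apply, smul_eq_mul]
    linear_combination (-(X 0 * v * pderiv K 2 f)) * huu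
  set Z' := X 2 - Z with hZ'
  have hδZ' : δ Z' = 0 := by rw [hZ', map_sub, hδ2, hZ, sub_self]
  have hZ'E : pderiv K 0 Z' = 0 := by rw [hZ', map_sub, hZE]; simp
  obtain ⟨ψ, hψ⟩ := exists_algEquiv (σ := Fin 3) ![X 0, Y, Z'] (by
    intro i; fin_cases i
    · simp
    · exact hY2
    · simpa [hZ'] using hZ2)
  have hψ0 : ψ (X 0) = X 0 := hψ 0
  have hψ1 : ψ (X 1) = Y := hψ 1
  have hψ2 : ψ (X 2) = Z' := hψ 2
  have hψX : ∀ i, ψ (X i) - X i ∈ orderIdeal (Fin 3) K 2 := by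
    intro i; fin_cases i
    · simp [hψ0]
    · simpa [hψ1] using hY2
    · simpa [hψ2, hZ'] using hZ2
  set R := Q.comap ψ with hR
  have r01 : R.ham (X 0) (X 1) = X 0 := by
    rw [hR, PoissonBracket.comap_ham, hψ0, hψ1, hham0, hY, huu, mul_one, AlgEquiv.symm_apply_eq, hψ0]
  have r02 : R.ham (X 0) (X 2) = 0 := by
    rw [hR, PoissonBracket.comap_ham, hψ0, hψ2, hham0, hδZ', mul_zero, mul_zero, map_zero]
  refine ⟨ψ, hψX, _, ?_, ?_, r01, r02, rfl⟩
  -- Since Y and Z' do not involve X 0, the change of coordinates commutes with ∂_0, and it suffices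
  -- that {Y, Z'} is independent of X 0 in the old coordinates.
  · have hcomm : (pderiv K 0 : Derivation K S S).conj ψ = pderiv K 0 := by
      refine derivation_ext fun i => ?_
      rw [PoissonBracket.conj_apply]
      fin_cases i
      · simp [hψ0]
      · simpa [hψ1, pderiv_X] using hYE
      · simpa [hψ2, pderiv_X] using hZ'E
    rw [← hcomm, PoissonBracket.conj_apply, PoissonBracket.comap_ham,
      AlgEquiv.apply_symm_apply, hψ1, hψ2]
    have e1 : ∀ f, pderiv K 0 f = 0 → Q.ham Y f =
        g * (pderiv K 1 Y * pderiv K 2 f - pderiv K 2 Y * pderiv K 1 f) := by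
      intro f hf
      have hY1 : Q.ham Y (X 1) = - (g * pderiv K 2 Y) := by
        rw [Q.skew, derivation_eq_sum_pderiv, Fin.sum_univ_three, hYE, Q.self, h12]; ring
      have hY2 : Q.ham Y (X 2) = g * pderiv K 1 Y := by
        rw [Q.skew, derivation_eq_sum_pderiv, Fin.sum_univ_three, hYE, Q.self, Q.skew (X 2) (X 1), h12]
        ring
      rw [derivation_eq_sum_pderiv, Fin.sum_univ_three, hf, hY1, hY2]
      ring
    rw [e1 _ hZ'E]
    have : pderiv K 0 (g * (pderiv K 1 Y * pderiv K 2 Z' - pderiv K 2 Y * pderiv K 1 Z')) = 0 := by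
      simp [Derivation.leibniz, pderiv_comm (0 : Fin 3), hYE, hZ'E, hg]
    rw [this, map_zero]
  -- The Jacobi identity reads {x, G} = {x, z} + {y, 0} = 0, and {x, ·} = x ∂_y, so ∂_y G = 0.
  · have j := R.jacobi (X 0) (X 1) (X 2)
    rw [r01, r02, map_zero, add_zero, derivation_eq_sum_pderiv, Fin.sum_univ_three, R.self, r01,
      r02, zero_mul, zero_mul, add_zero, zero_add] at j
    exact (mul_eq_zero.1 j).resolve_left (X_ne_zero _)

/-- The formal normal form of a Poisson bracket in three variables whose linear part is that of
`x ∂_x ∧ ∂_y`. -/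
theorem exists_formal_normal_form (P : PoissonBracket K S)
    (h01 : P.ham (X 0) (X 1) - X 0 ∈ orderIdeal (Fin 3) K 2)
    (h02 : P.ham (X 0) (X 2) ∈ orderIdeal (Fin 3) K 2)
    (h12 : P.ham (X 1) (X 2) ∈ orderIdeal (Fin 3) K 2) :
    ∃ φ : S ≃ₐ[K] S, (∀ i, φ (X i) - X i ∈ orderIdeal (Fin 3) K 2) ∧
      ∃ G : S, pderiv K 0 G = 0 ∧ pderiv K 1 G = 0 ∧
        (P.comap φ).ham (X 0) (X 1) = X 0 ∧ (P.comap φ).ham (X 0) (X 2) = 0 ∧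
        (P.comap φ).ham (X 1) (X 2) = G := by
  obtain ⟨φ, hφ, u, v, g, hu, hv, hg, hu1, hv0, q01, q02, q12⟩ :=
    exists_weighted_coordinates P h01 h02 h12
  obtain ⟨ψ, hψ, G, hG0, hG1, r01, r02, r12⟩ :=
    exists_straight_coordinates (P.comap φ) hu hv hg hu1 hv0 q01 q02 q12
  refine ⟨ψ.trans φ, fun i => ?_, G, hG0, hG1, r01, r02, r12⟩
  have h1 := algHom_mem_orderIdeal φ.toAlgHom (map_X_mem_of_sub_mem (φ := φ.toAlgHom) hφ) (hψ i)
  have h2 : φ (ψ (X i) - X i) ∈ orderIdeal (Fin 3) K 2 := h1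
  rw [map_sub] at h2
  simpa using add_mem h2 (hφ i)

end NormalForm

end MvPowerSeries

/-! ### Local rings with coordinates: Taylor expansion and completion. -/

/-- Generators `t i` of the maximal ideal of a local `K`-algebra with residue field `K`, together
with dual derivations. -/
structure DualCoordinates (σ K O : Type*) [DecidableEq σ] [Field K] [CommRing O] [IsLocalRing O]
    [Algebra K O] where
  /-- the coordinates -/
  t : σ → O
  /-- the partial derivatives -/
  d : σ → Derivation K O O
  span_t : maximalIdeal O = Ideal.span (Set.range t)
  d_t : ∀ i j, d i (t j) = if i = j then 1 else 0
  exists_const : ∀ a : O, ∃ c : K, a - algebraMap K O c ∈ maximalIdeal O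

theorem Derivation.mem_pow_of_mem_pow_succ {K A : Type*} [CommRing K] [CommRing A] [Algebra K A]
    (D : Derivation K A A) (I : Ideal A) {n : ℕ} {a : A} (ha : a ∈ I ^ (n + 1)) : D a ∈ I ^ n := by
  induction n generalizing a with
  | zero => simp
  | succ n ih =>
    rw [pow_succ] at ha
    refine Submodule.mul_induction_on ha (fun x hx y hy => ?_) (fun x y hx hy => ?_)
    · rw [Derivation.leibniz, smul_eq_mul, smul_eq_mul]
      refine add_mem (Ideal.mul_mem_right _ _ hx) ?_
      rw [pow_succ']
      exact Ideal.mul_mem_mul hy (ih hx)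
    · rw [map_add]; exact add_mem hx hy

namespace DualCoordinates

variable {σ K O : Type*} [DecidableEq σ] [Fintype σ] [Nonempty σ] [Field K] [CommRing O]
  [IsLocalRing O] [Algebra K O] (x : DualCoordinates σ K O)

omit [Fintype σ] [Nonempty σ] in
theorem t_mem (i : σ) : x.t i ∈ maximalIdeal O := by
  rw [x.span_t]; exact Ideal.subset_span ⟨i, rfl⟩

omit [Fintype σ] [Nonempty σ] in
theorem aeval_mem_pow {p : MvPolynomial σ K} {n : ℕ}
    (hp : p ∈ MvPolynomial.idealOfVars σ K ^ n) :
    MvPolynomial.aeval x.t p ∈ maximalIdeal O ^ n := by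
  have h : (MvPolynomial.idealOfVars σ K).map (MvPolynomial.aeval x.t : _ →ₐ[K] O).toRingHom ≤
      maximalIdeal O := by
    rw [MvPolynomial.idealOfVars, Ideal.map_span, Ideal.span_le]
    rintro _ ⟨_, ⟨i, rfl⟩, rfl⟩
    simpa using x.t_mem i
  have h2 := Ideal.mem_map_of_mem (MvPolynomial.aeval x.t : _ →ₐ[K] O).toRingHom hp
  rw [Ideal.map_pow] at h2
  exact Ideal.pow_right_mono h n h2

omit [Fintype σ] [Nonempty σ] in
theorem d_aeval (i : σ) (p : MvPolynomial σ K) :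
    x.d i (MvPolynomial.aeval x.t p) = MvPolynomial.aeval x.t (MvPolynomial.pderiv i p) := by
  induction p using MvPolynomial.induction_on with
  | C a => simp
  | add p q hp hq => simp [hp, hq]
  | mul_X p j hp =>
    rw [map_mul, Derivation.leibniz, hp, MvPolynomial.aeval_X, x.d_t, Derivation.leibniz,
      MvPolynomial.pderiv_X]
    simp only [smul_eq_mul, map_add, map_mul, MvPolynomial.aeval_X, Pi.single_apply, eq_comm]
    split_ifs <;> simp

omit [Fintype σ] [Nonempty σ] in
-- Each d i lowers the m-adic order by at most one, so differentiating reduces to constant terms,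
-- which are zero or units. The existence of dual derivations in characteristic zero thus replaces
-- any regularity theory.
theorem coeff_eq_zero_of_aeval_mem [CharZero K] {n : ℕ} {p : MvPolynomial σ K}
    (hp : MvPolynomial.aeval x.t p ∈ maximalIdeal O ^ n) {v : σ →₀ ℕ} (hv : Finsupp.degree v < n) :
    MvPolynomial.coeff v p = 0 := by
  induction n generalizing p v with
  | zero => omega
  | succ n ih =>
    by_cases h0 : v = 0
    · subst h0
      by_contra hc
      have h1 : MvPolynomial.aeval x.t (p - MvPolynomial.C (MvPolynomial.coeff 0 p)) ∈
          maximalIdeal O ^ 1 := by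
        refine x.aeval_mem_pow ?_
        rw [MvPolynomial.mem_pow_idealOfVars_iff']
        intro w hw
        rw [Nat.lt_one_iff, Finsupp.degree_eq_zero_iff] at hw
        subst hw; simp
      rw [pow_one, map_sub] at h1
      have h2 := sub_mem (Ideal.pow_le_self n.succ_ne_zero hp) h1
      rw [sub_sub_cancel, MvPolynomial.aeval_C] at h2
      exact (mem_nonunits_iff.1 h2) ((IsUnit.mk0 _ hc).map (algebraMap K O))
    · obtain ⟨i, hi⟩ := Finsupp.ne_iff.1 h0
      have hle : Finsupp.single i 1 ≤ v := by
        rw [Finsupp.single_le_iff]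
        exact Nat.one_le_iff_ne_zero.2 hi
      have h1 := (x.d i).mem_pow_of_mem_pow_succ _ hp
      rw [x.d_aeval] at h1
      have hdeg : Finsupp.degree v = Finsupp.degree (v - Finsupp.single i 1) + 1 := by
        conv_lhs => rw [← tsub_add_cancel_of_le hle, map_add]
        simp
      have h2 := ih h1 (v := v - Finsupp.single i 1) (by omega)
      rw [← MvPolynomial.coeff_coe, ← MvPowerSeries.pderiv_coe, MvPowerSeries.coeff_pderiv,
        tsub_add_cancel_of_le hle, MvPolynomial.coeff_coe] at h2
      refine (mul_eq_zero.1 h2).resolve_right ?_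
      norm_cast

omit [Fintype σ] [Nonempty σ] in
-- The residue field is K and the t i generate m, so monomials in t span each m^n / m^(n+1).
theorem exists_aeval_sub_mem (a : O) (n : ℕ) :
    ∃ p : MvPolynomial σ K, a - MvPolynomial.aeval x.t p ∈ maximalIdeal O ^ n := by
  have key : ∀ n, ∀ r ∈ maximalIdeal O ^ n, ∃ q : MvPolynomial σ K,
      r - MvPolynomial.aeval x.t q ∈ maximalIdeal O ^ (n + 1) := by
    intro n
    induction n with
    | zero =>
      intro r _
      obtain ⟨c, hc⟩ := x.exists_const r
      exact ⟨MvPolynomial.C c, by simpa using hc⟩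
    | succ n ih =>
      intro r hr
      rw [pow_succ'] at hr
      refine Submodule.mul_induction_on hr (fun a ha b hb => ?_) ?_
      · rw [x.span_t] at ha
        induction ha using Submodule.span_induction generalizing b with
        | mem a ha =>
          obtain ⟨i, rfl⟩ := ha
          obtain ⟨q, hq⟩ := ih b hb
          refine ⟨MvPolynomial.X i * q, ?_⟩
          rw [map_mul, MvPolynomial.aeval_X, ← mul_sub, pow_succ']
          exact Ideal.mul_mem_mul (x.t_mem i) hq
        | zero => exact ⟨0, by simp⟩
        | add a a' _ _ h h' =>
          obtain ⟨q, hq⟩ := h b hb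
          obtain ⟨q', hq'⟩ := h' b hb
          refine ⟨q + q', ?_⟩
          convert add_mem hq hq' using 1
          rw [map_add]; ring
        | smul c a _ h =>
          obtain ⟨q, hq⟩ := h (c * b) (Ideal.mul_mem_left _ _ hb)
          refine ⟨q, ?_⟩
          convert hq using 2
          rw [smul_eq_mul]; ring
      · rintro a b ⟨q, hq⟩ ⟨q', hq'⟩
        refine ⟨q + q', ?_⟩
        convert add_mem hq hq' using 1
        rw [map_add]; ring
  induction n with
  | zero => exact ⟨0, by simp⟩
  | succ n ih =>
    obtain ⟨p, hp⟩ := ih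
    obtain ⟨q, hq⟩ := key n _ hp
    exact ⟨p + q, by rwa [map_add, ← sub_sub]⟩

/-- The `n`-th truncation of the evaluation of power series at the coordinates. -/
noncomputable def evalModPow (n : ℕ) : MvPowerSeries σ K →+* O ⧸ maximalIdeal O ^ n :=
  (Ideal.quotientMap (I := MvPolynomial.idealOfVars σ K ^ n) (maximalIdeal O ^ n)
    (MvPolynomial.aeval x.t : _ →ₐ[K] O).toRingHom fun _ hp => x.aeval_mem_pow hp).comp
    (MvPowerSeries.truncTotalAlgHom σ K n).toRingHom

omit [Nonempty σ] in
theorem evalModPow_apply (n : ℕ) (f : MvPowerSeries σ K) :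
    x.evalModPow n f = Ideal.Quotient.mk _ (MvPolynomial.aeval x.t (f.truncTotal n)) := rfl

omit [Nonempty σ] [DecidableEq σ] in
theorem truncTotal_sub_mem {n : ℕ} {f : MvPowerSeries σ K} {p : MvPolynomial σ K}
    (h : f - p ∈ MvPowerSeries.orderIdeal σ K n) :
    f.truncTotal n - p ∈ MvPolynomial.idealOfVars σ K ^ n := by
  rw [MvPolynomial.mem_pow_idealOfVars_iff']
  intro v hv
  rw [MvPolynomial.coeff_sub, MvPowerSeries.coeff_truncTotal _ hv,
    MvPowerSeries.coeff_eq_of_sub_mem h hv, MvPolynomial.coeff_coe, sub_self]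

omit [Nonempty σ] in
theorem evalModPow_eq {n : ℕ} {f : MvPowerSeries σ K} {p : MvPolynomial σ K}
    (h : f - p ∈ MvPowerSeries.orderIdeal σ K n) :
    x.evalModPow n f = Ideal.Quotient.mk _ (MvPolynomial.aeval x.t p) := by
  rw [evalModPow_apply, Ideal.Quotient.eq, ← map_sub]
  exact x.aeval_mem_pow (truncTotal_sub_mem h)

omit [Nonempty σ] in
theorem factorPow_comp_evalModPow {m n : ℕ} (h : m ≤ n) :
    (Ideal.Quotient.factorPow (maximalIdeal O) h).comp (x.evalModPow n) = x.evalModPow m := by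
  ext f
  rw [RingHom.comp_apply, evalModPow_apply, evalModPow_eq x (p := f.truncTotal n)]
  · rfl
  · refine MvPowerSeries.mem_orderIdeal.2 fun v hv => ?_
    rw [map_sub, MvPolynomial.coeff_coe, MvPowerSeries.coeff_truncTotal _ (by omega), sub_self]

/-- Evaluation of power series at the coordinates. -/
noncomputable def eval : MvPowerSeries σ K →+* AdicCompletion (maximalIdeal O) O :=
  AdicCompletion.liftRingHom (maximalIdeal O) x.evalModPow fun h =>
    x.factorPow_comp_evalModPow h

omit [Nonempty σ] in
theorem evalₐ_eval (n : ℕ) (f : MvPowerSeries σ K) :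
    AdicCompletion.evalₐ (maximalIdeal O) n (x.eval f) = x.evalModPow n f :=
  AdicCompletion.evalₐ_liftRingHom _ _ (fun h => x.factorPow_comp_evalModPow h) _ _

omit [Nonempty σ] in
-- Injectivity is the independence of monomials modulo powers of m; for surjectivity, polynomial
-- approximations of a Cauchy sequence have stabilizing coefficients and so converge to a power
-- series.
theorem eval_bijective [CharZero K] : Function.Bijective x.eval := by
  constructor
  · rw [injective_iff_map_eq_zero]
    intro f hf
    refine MvPowerSeries.eq_zero_of_forall_mem_orderIdeal fun k => ?_
    have h := x.evalₐ_eval k f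
    rw [hf, map_zero, evalModPow_apply, eq_comm, Ideal.Quotient.eq_zero_iff_mem] at h
    refine MvPowerSeries.mem_orderIdeal.2 fun v hv => ?_
    rw [← MvPowerSeries.coeff_truncTotal _ hv]
    exact x.coeff_eq_zero_of_aeval_mem h hv
  · intro y
    obtain ⟨a, rfl⟩ := AdicCompletion.mk_surjective (maximalIdeal O) O y
    choose p hp using fun n => x.exists_aeval_sub_mem (a n) n
    obtain ⟨f, hf⟩ := MvPowerSeries.exists_limit (fun n => (p n : MvPowerSeries σ K)) fun k => by
      refine MvPowerSeries.mem_orderIdeal.2 fun v hv => ?_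
      rw [map_sub, MvPolynomial.coeff_coe, MvPolynomial.coeff_coe, ← MvPolynomial.coeff_sub]
      refine x.coeff_eq_zero_of_aeval_mem (n := k) ?_ hv
      have h1 := Ideal.Quotient.eq.1 (AdicCompletion.Ideal.mk_eq_mk (maximalIdeal O) k.le_succ a)
      have h2 := Ideal.pow_le_pow_right k.le_succ (hp (k + 1))
      convert sub_mem (add_mem (hp k) h1) h2 using 1
      rw [map_sub]; ring
    refine ⟨f, AdicCompletion.ext_evalₐ ?_⟩
    intro n
    rw [x.evalₐ_eval, x.evalModPow_eq (hf n), AdicCompletion.evalₐ_mk, eq_comm, Ideal.Quotient.eq]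
    exact hp n

omit [Nonempty σ] in
theorem eval_coe (p : MvPolynomial σ K) :
    x.eval p = algebraMap O _ (MvPolynomial.aeval x.t p) := by
  refine AdicCompletion.ext_evalₐ ?_
  intro n
  rw [x.evalₐ_eval, x.evalModPow_eq (p := p) (by simp)]
  exact (AdicCompletion.evalₐ_of _ _ _).symm

variable [CharZero K]

/-- The completion of the local ring is the ring of power series in the coordinates. -/
noncomputable def equiv : MvPowerSeries σ K ≃+* AdicCompletion (maximalIdeal O) O :=
  RingEquiv.ofBijective x.eval x.eval_bijective

/-- Taylor expansion in the given coordinates. -/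
noncomputable def taylor : O →ₐ[K] MvPowerSeries σ K where
  toRingHom := x.equiv.symm.toRingHom.comp (algebraMap O _)
  commutes' c := by
    have h := x.eval_coe (MvPolynomial.C c)
    rw [MvPolynomial.aeval_C] at h
    change x.equiv.symm (algebraMap O _ (algebraMap K O c)) = _
    rw [← h, RingEquiv.symm_apply_eq]
    simp [equiv]
    rfl

omit [Nonempty σ] in
theorem equiv_taylor (a : O) : x.equiv (x.taylor a) = algebraMap O _ a :=
  x.equiv.apply_symm_apply _

omit [Nonempty σ] in
theorem taylor_aeval (p : MvPolynomial σ K) :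
    x.taylor (MvPolynomial.aeval x.t p) = p := by
  change x.equiv.symm _ = _
  rw [RingEquiv.symm_apply_eq]
  exact (x.eval_coe p).symm

omit [Nonempty σ] in
theorem taylor_t (i : σ) : x.taylor (x.t i) = MvPowerSeries.X i := by
  have := x.taylor_aeval (MvPolynomial.X i)
  simpa using this

omit [Nonempty σ] in
theorem taylor_mem_iff {a : O} {n : ℕ} :
    x.taylor a ∈ MvPowerSeries.orderIdeal σ K n ↔ a ∈ maximalIdeal O ^ n := by
  have h : Ideal.Quotient.mk (maximalIdeal O ^ n)
      (MvPolynomial.aeval x.t ((x.taylor a).truncTotal n)) = Ideal.Quotient.mk _ a := by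
    rw [← evalModPow_apply, ← evalₐ_eval]
    change AdicCompletion.evalₐ _ _ (x.equiv (x.taylor a)) = _
    rw [equiv_taylor]
    exact AdicCompletion.evalₐ_of _ _ _
  constructor
  · intro ha
    rw [← Ideal.Quotient.eq_zero_iff_mem, ← h, Ideal.Quotient.eq_zero_iff_mem]
    have := x.aeval_mem_pow (truncTotal_sub_mem (p := 0) (by simpa using ha))
    simpa using this
  · intro ha
    rw [← Ideal.Quotient.eq_zero_iff_mem, ← h, Ideal.Quotient.eq_zero_iff_mem] at ha
    refine MvPowerSeries.mem_orderIdeal.2 fun v hv => ?_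
    rw [← MvPowerSeries.coeff_truncTotal _ hv]
    exact x.coeff_eq_zero_of_aeval_mem ha hv

omit [Nonempty σ] in
theorem exists_sub_taylor_mem (f : MvPowerSeries σ K) (n : ℕ) :
    ∃ a, f - x.taylor a ∈ MvPowerSeries.orderIdeal σ K n := by
  refine ⟨MvPolynomial.aeval x.t (f.truncTotal n), MvPowerSeries.mem_orderIdeal.2 fun v hv => ?_⟩
  rw [taylor_aeval, map_sub, MvPolynomial.coeff_coe, MvPowerSeries.coeff_truncTotal _ hv, sub_self]

/-- The two sides agree on polynomials in t, and both lose at most one order on the remainder. -/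
theorem taylor_d (i : σ) (a : O) :
    x.taylor (x.d i a) = MvPowerSeries.pderiv K i (x.taylor a) := by
  rw [← sub_eq_zero]
  refine MvPowerSeries.eq_zero_of_forall_mem_orderIdeal fun k => ?_
  obtain ⟨p, hp⟩ := x.exists_aeval_sub_mem a (k + 1)
  have h1 := x.taylor_mem_iff.2 ((x.d i).mem_pow_of_mem_pow_succ _ hp)
  have h2 := MvPowerSeries.derivation_mem_orderIdeal_of_succ (MvPowerSeries.pderiv K i)
    (x.taylor_mem_iff.2 hp)
  rw [map_sub, map_sub, x.d_aeval, taylor_aeval] at h1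
  rw [map_sub, map_sub, taylor_aeval, MvPowerSeries.pderiv_coe] at h2
  convert sub_mem h1 h2 using 1
  ring

/-- A derivation of the local ring is determined, up to Taylor expansion, by its values on
coordinates. -/
theorem taylor_derivation (D : Derivation K O O) (a : O) :
    x.taylor (D a) = ∑ i, x.taylor (D (x.t i)) * MvPowerSeries.pderiv K i (x.taylor a) := by
  have key : ∀ D : Derivation K O O, (∀ i, D (x.t i) = 0) → x.taylor (D a) = 0 := by
    intro D hD
    refine MvPowerSeries.eq_zero_of_forall_mem_orderIdeal fun k => ?_
    obtain ⟨p, hp⟩ := x.exists_aeval_sub_mem a (k + 1)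
    have h1 := x.taylor_mem_iff.2 (D.mem_pow_of_mem_pow_succ _ hp)
    have h2 : D (MvPolynomial.aeval x.t p) = 0 := by
      clear hp h1
      induction p using MvPolynomial.induction_on with
      | C a => simp
      | add p q hp hq => simp [hp, hq]
      | mul_X p j hp => simp [Derivation.leibniz, hp, hD]
    rwa [map_sub, h2, sub_zero] at h1
  have h := key (D - ∑ i, D (x.t i) • x.d i) fun j => by
    rw [Derivation.sub_apply, Derivation.finset_sum_apply]
    simp [x.d_t]
  rw [Derivation.sub_apply, Derivation.finset_sum_apply, map_sub, sub_eq_zero, map_sum] at h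
  rw [h]
  simp [taylor_d]

end DualCoordinates

/-! ### Ideals stable under a derivation. -/

section Derivations

variable {K A : Type*} [Field K] [CharZero K] [CommRing A] [Algebra K A]

/-- An element with invertible derivative has no power in a proper stable ideal. -/
theorem Derivation.pow_notMem (D : Derivation K A A) {I : Ideal A} (hI : ∀ a ∈ I, D a ∈ I)
    (h1 : I ≠ ⊤) {b : A} (hb : IsUnit (D b)) (n : ℕ) : b ^ n ∉ I := by
  induction n with
  | zero => rw [pow_zero]; exact fun h => h1 ((Ideal.eq_top_iff_one _).2 h)
  | succ n ih =>
    intro h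
    have h2 := hI _ h
    rw [Derivation.leibniz_pow, Nat.add_sub_cancel, smul_eq_mul, nsmul_eq_mul] at h2
    have hn : IsUnit ((n + 1 : ℕ) : A) := by
      rw [← _root_.map_natCast (algebraMap K A)]
      exact (IsUnit.mk0 _ (Nat.cast_ne_zero.2 n.succ_ne_zero)).map _
    refine ih ?_
    rw [mul_comm (b ^ n), ← mul_assoc, Ideal.unit_mul_mem_iff_mem I (hn.mul hb)] at h2
    exact h2

omit [CharZero K] in
/-- Minimal primes over a stable radical ideal are stable. -/
theorem Derivation.mem_of_mem_minimalPrimes (D : Derivation K A A) {J P : Ideal A}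
    (hJ : ∀ a ∈ J, D a ∈ J) (hr : J.IsRadical) (hP : P ∈ J.minimalPrimes) {x : A} (hx : x ∈ P) :
    D x ∈ P := by
  have hPp : P.IsPrime := hP.1.1
  -- Otherwise the multiplicative set of all s x^n with s ∉ P misses J, and a prime over J avoiding
  -- it lies strictly inside P, against minimality. With J radical this gives s x ∈ J, and
  -- differentiating yields s D x ∈ P.
  obtain ⟨s, hs, n, hsn⟩ : ∃ s ∉ P, ∃ n : ℕ, s * x ^ n ∈ J := by
    by_contra! hcon
    let T : Submonoid A :=
      { carrier := {y | ∃ s ∉ P, ∃ n : ℕ, y = s * x ^ n}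
        one_mem' := ⟨1, (Ideal.ne_top_iff_one _).1 hPp.ne_top, 0, by simp⟩
        mul_mem' := by
          rintro _ _ ⟨s, hs, n, rfl⟩ ⟨s', hs', n', rfl⟩
          refine ⟨s * s', fun h => (hPp.mem_or_mem h).elim hs hs', n + n', by ring⟩ }
    have hd : Disjoint (J : Set A) (T : Set A) := by
      rw [Set.disjoint_left]
      rintro _ hy ⟨s, hs, n, rfl⟩
      exact hcon s hs n hy
    obtain ⟨Q, hQ, hJQ, hQT⟩ := Ideal.exists_le_prime_disjoint J T hd
    have hQP : Q ≤ P := by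
      intro y hy
      by_contra h
      exact Set.disjoint_left.1 hQT hy ⟨y, h, 0, by simp⟩
    have := hP.2 ⟨hQ, hJQ⟩ hQP hx
    exact Set.disjoint_left.1 hQT this
      ⟨1, (Ideal.ne_top_iff_one _).1 hPp.ne_top, 1, by simp⟩
  have hsx : s * x ∈ J := by
    refine hr ⟨n + 1, ?_⟩
    rw [mul_pow, show s ^ (n + 1) * x ^ (n + 1) = (s ^ n * x) * (s * x ^ n) by ring]
    exact Ideal.mul_mem_left _ _ hsn
  have h := hP.1.2 (hJ _ hsx)
  rw [Derivation.leibniz, smul_eq_mul, smul_eq_mul] at h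
  have h2 := (Ideal.add_mem_iff_left _ (Ideal.mul_mem_right (D s) P hx)).1 h
  exact (hPp.mem_or_mem h2).resolve_left hs

end Derivations

/-! ### Germs of reduced curves. -/

theorem Ideal.isMaximal_of_lt_of_ringKrullDim_le_one {A : Type*} [CommRing A] {P Q : Ideal A}
    [P.IsPrime] (hQ : Q.IsPrime) (h : P < Q) (hd : ringKrullDim (A ⧸ P) ≤ 1) : Q.IsMaximal := by
  have hd : Ring.KrullDimLE 1 (A ⧸ P) := by
    rw [Ring.KrullDimLE, Order.krullDimLE_iff]
    exact hd
  have hmap : (Q.map (Ideal.Quotient.mk P)).IsPrime :=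
    Ideal.map_isPrime_of_surjective Ideal.Quotient.mk_surjective (by simpa using h.le)
  have hcm : (Q.map (Ideal.Quotient.mk P)).comap (Ideal.Quotient.mk P) = Q := by
    rw [Ideal.comap_map_of_surjective _ Ideal.Quotient.mk_surjective, ← RingHom.ker_eq_comap_bot,
      Ideal.mk_ker, sup_eq_left]
    exact h.le
  have hmax := Ring.krullDimLE_one_iff_of_noZeroDivisors.1 hd (Q.map (Ideal.Quotient.mk P))
    (fun h0 => h.not_ge (by
      rw [← hcm, h0, ← RingHom.ker_eq_comap_bot, Ideal.mk_ker])) hmap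
  rw [← hcm]
  exact Ideal.comap_isMaximal_of_surjective _ Ideal.Quotient.mk_surjective

/-- The ideal of the germ of a reduced curve. -/
structure IsCurveIdeal {O : Type*} [CommRing O] (J : Ideal O) : Prop where
  isRadical : J.IsRadical
  ne_top : J ≠ ⊤
  dim : ∀ P ∈ J.minimalPrimes, ringKrullDim (O ⧸ P) = 1

namespace IsCurveIdeal

variable {O : Type*} [CommRing O] [IsLocalRing O] {J : Ideal O} (hJ : IsCurveIdeal J)
  (hfg : (maximalIdeal O).FG)

include hJ

omit [IsLocalRing O] in
theorem mem_of_forall_mem {f : O} (h : ∀ P ∈ J.minimalPrimes, f ∈ P) : f ∈ J := by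
  rw [← hJ.isRadical.radical, Ideal.radical_eq_sInf, Submodule.mem_sInf]
  intro Q hQ
  have := hQ.2
  obtain ⟨P, hP, hPQ⟩ := Ideal.exists_minimalPrimes_le hQ.1
  exact hPQ (h P hP)

theorem le_maximalIdeal : J ≤ maximalIdeal O := IsLocalRing.le_maximalIdeal hJ.ne_top

theorem maximalIdeal_ne {P : Ideal O} (hP : P ∈ J.minimalPrimes) : P ≠ maximalIdeal O := by
  rintro rfl
  have h := hJ.dim _ hP
  let _ := Ideal.Quotient.field (maximalIdeal O)
  rw [ringKrullDim_eq_zero_of_field] at h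
  exact zero_ne_one h

/-- In dimension one, m is the only possible prime strictly above P, so m lies in the radical of P +
(a). -/
theorem exists_pow_le {P : Ideal O} (hfg : (maximalIdeal O).FG) (hP : P ∈ J.minimalPrimes) {a : O}
    (ha : a ∉ P) :
    ∃ N, maximalIdeal O ^ N ≤ P ⊔ Ideal.span {a} := by
  have hPp : P.IsPrime := hP.1.1
  refine Ideal.exists_pow_le_of_le_radical_of_fg ?_ hfg
  rw [Ideal.radical_eq_sInf]
  refine le_sInf fun Q hQ => ?_
  have hQp := hQ.2
  have hPQ : P ≤ Q := le_sup_left.trans hQ.1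
  have haQ : a ∈ Q := hQ.1 (Ideal.mem_sup_right (Ideal.mem_span_singleton_self a))
  have hQm := Ideal.isMaximal_of_lt_of_ringKrullDim_le_one hQp
    (lt_of_le_of_ne hPQ fun h => ha (h ▸ haQ)) (hJ.dim P hP).le
  rw [IsLocalRing.eq_maximalIdeal hQm]

include hfg in
-- A Krull intersection argument that only needs m finitely generated: if b ∉ P then m^N ⊆ P + (b),
-- so b ∈ P + m b, and 1 - μ is a unit for μ ∈ m.
theorem mem_of_forall_mem_sup_pow {b : O} (h : ∀ k, b ∈ J ⊔ maximalIdeal O ^ k) : b ∈ J := by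
  refine hJ.mem_of_forall_mem fun P hP => ?_
  by_contra hb
  have hPp : P.IsPrime := hP.1.1
  have hJP : J ≤ P := hP.1.2
  obtain ⟨N, hN⟩ := hJ.exists_pow_le hfg hP hb
  have h1 : b ∈ P ⊔ maximalIdeal O * (P ⊔ Ideal.span {b}) :=
    (sup_le_sup hJP (by rw [pow_succ']; exact Ideal.mul_mono_right hN)) (h (N + 1))
  rw [Ideal.mul_sup, ← sup_assoc, sup_eq_left.2 (Ideal.mul_le_right : maximalIdeal O * P ≤ P)] at h1
  obtain ⟨p, hp, q, hq, hpq⟩ := Submodule.mem_sup.1 h1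
  obtain ⟨μ, hμ, rfl⟩ := Ideal.mem_mul_span_singleton.1 hq
  have hu : IsUnit (1 - μ) := by
    by_contra hc
    have := add_mem ((mem_maximalIdeal _).2 hc) hμ
    rw [sub_add_cancel] at this
    exact (maximalIdeal.isMaximal O).ne_top ((Ideal.eq_top_iff_one _).2 this)
  have h3 : (1 - μ) * b ∈ P := by
    convert hp using 1
    rw [sub_mul, one_mul, sub_eq_iff_eq_add, hpq]
  exact hb ((Ideal.unit_mul_mem_iff_mem P hu).1 h3)

/-- A parameter t lies in no minimal prime P of J, since otherwise m^N ⊆ P and P = m, against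
dimension one. -/
theorem mem_of_mul_mem {t f : O} {N : ℕ} (hN : maximalIdeal O ^ N ≤ J ⊔ Ideal.span {t})
    (h : t * f ∈ J) : f ∈ J := by
  refine hJ.mem_of_forall_mem fun P hP => ?_
  have hPp : P.IsPrime := hP.1.1
  have hJP : J ≤ P := hP.1.2
  refine (hPp.mem_or_mem (hJP h)).resolve_left fun ht => ?_
  have h2 : maximalIdeal O ≤ P := hPp.le_of_pow_le (hN.trans (sup_le hJP (by simpa using ht)))
  exact hJ.maximalIdeal_ne hP (le_antisymm (IsLocalRing.le_maximalIdeal hPp.ne_top) h2)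

include hfg in
/-- A curve germ that is cut out in some smooth germ with principal maximal ideal is regular. -/
theorem isRegularLocalRing {s : O} (hs : s ∈ maximalIdeal O)
    (h : maximalIdeal O ≤ Ideal.span {s} ⊔ J) : IsRegularLocalRing (O ⧸ J) := by
  -- Every element outside J is, modulo J, a unit times a power of s. So O/J behaves like a discrete
  -- valuation ring: it is a domain with principal ideals, which is regular.
  have hfac : ∀ x ∉ J, ∃ n : ℕ, ∃ u, IsUnit u ∧ x - s ^ n * u ∈ J := by
    intro x hx
    have hex : ∃ k, x ∉ Ideal.span {s ^ k} ⊔ J := by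
      by_contra! hcon
      refine hx (hJ.mem_of_forall_mem_sup_pow hfg fun k => ?_)
      rw [sup_comm]
      refine sup_le_sup_right ?_ J (hcon k)
      rw [Ideal.span_le, Set.singleton_subset_iff]
      exact Ideal.pow_mem_pow hs k
    classical
    obtain ⟨k, hk⟩ : ∃ k, Nat.find hex = k + 1 := by
      refine Nat.exists_eq_succ_of_ne_zero fun h0 => ?_
      have := Nat.find_spec hex
      rw [h0] at this
      simp at this
    have h1 : x ∈ Ideal.span {s ^ k} ⊔ J := by
      by_contra hc
      have := Nat.find_min' hex hc
      omega
    have h2 := Nat.find_spec hex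
    rw [hk] at h2
    obtain ⟨y, hy, j, hj, rfl⟩ := Submodule.mem_sup.1 h1
    obtain ⟨u, rfl⟩ := Ideal.mem_span_singleton'.1 hy
    refine ⟨k, u, ?_, ?_⟩
    · by_contra hu
      obtain ⟨v, hv, j', hj', rfl⟩ := Submodule.mem_sup.1 (h ((mem_maximalIdeal _).2 hu))
      obtain ⟨v, rfl⟩ := Ideal.mem_span_singleton'.1 hv
      refine h2 (Submodule.mem_sup.2 ⟨v * s ^ (k + 1), Ideal.mem_span_singleton'.2 ⟨v, rfl⟩,
        j' * s ^ k + j, add_mem (Ideal.mul_mem_right _ _ hj') hj, by ring⟩)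
    · convert hj using 1; ring
  have hfac' : ∀ x : O ⧸ J, x ≠ 0 → ∃ n : ℕ, ∃ u, IsUnit u ∧
      x = (Ideal.Quotient.mk J s) ^ n * u := by
    intro x hx
    obtain ⟨x, rfl⟩ := Ideal.Quotient.mk_surjective x
    obtain ⟨n, u, hu, h3⟩ := hfac x (fun hx' => hx (Ideal.Quotient.eq_zero_iff_mem.2 hx'))
    refine ⟨n, Ideal.Quotient.mk J u, hu.map _, ?_⟩
    rw [← map_pow, ← map_mul]
    exact Ideal.Quotient.eq.2 h3
  have hnt : Nontrivial (O ⧸ J) := Ideal.Quotient.nontrivial_iff.2 hJ.ne_top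
  have hloc : IsLocalRing (O ⧸ J) :=
    IsLocalRing.of_surjective' (Ideal.Quotient.mk J) Ideal.Quotient.mk_surjective
  have hred : IsReduced (O ⧸ J) := (Ideal.isRadical_iff_quotient_reduced J).1 hJ.isRadical
  have hdom : IsDomain (O ⧸ J) := by
    have : NoZeroDivisors (O ⧸ J) := by
      refine ⟨fun {x y} hxy => ?_⟩
      by_contra! hcon
      obtain ⟨n, u, hu, hx⟩ := hfac' x hcon.1
      obtain ⟨k, v, hv, hy⟩ := hfac' y hcon.2
      have hz : (Ideal.Quotient.mk J s) ^ (n + k) = 0 := by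
        rw [← (hu.mul hv).mul_left_eq_zero, ← hxy, hx, hy]
        ring
      have hs0 : Ideal.Quotient.mk J s = 0 := by
        exact (IsNilpotent.mk _ _ hz).eq_zero
      rw [hs0] at hx hy
      rcases Nat.eq_zero_or_pos n with rfl | hn
      · rcases Nat.eq_zero_or_pos k with rfl | hk
        · simp at hz
        · exact hcon.2 (by rw [hy, zero_pow hk.ne', zero_mul])
      · exact hcon.1 (by rw [hx, zero_pow hn.ne', zero_mul])
    exact NoZeroDivisors.to_isDomain _
  have hpid : IsPrincipalIdealRing (O ⧸ J) := by
    refine ⟨fun I => ?_⟩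
    by_cases hI : I = ⊥
    · exact ⟨0, by simp [hI]⟩
    obtain ⟨x, hx, hx0⟩ := Submodule.exists_mem_ne_zero_of_ne_bot hI
    have key : ∀ x ∈ I, x ≠ 0 → ∃ n, (Ideal.Quotient.mk J s) ^ n ∈ I ∧
        x ∈ Ideal.span {(Ideal.Quotient.mk J s) ^ n} := by
      intro x hx hx0
      obtain ⟨n, u, hu, rfl⟩ := hfac' x hx0
      exact ⟨n, (Ideal.mul_unit_mem_iff_mem I hu).1 hx, Ideal.mem_span_singleton.2 ⟨u, rfl⟩⟩
    have hex : ∃ n, (Ideal.Quotient.mk J s) ^ n ∈ I := (key x hx hx0).imp fun _ h => h.1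
    classical
    refine ⟨(Ideal.Quotient.mk J s) ^ Nat.find hex, le_antisymm (fun y hy => ?_) ?_⟩
    · by_cases hy0 : y = 0
      · rw [hy0]; exact zero_mem _
      obtain ⟨n, hn, hyn⟩ := key y hy hy0
      obtain ⟨c, rfl⟩ := Ideal.mem_span_singleton.1 hyn
      exact Ideal.mem_span_singleton.2
        (Dvd.dvd.mul_right (pow_dvd_pow _ (Nat.find_min' hex hn)) _)
    · exact (Submodule.span_singleton_le_iff_mem _ _).2 (Nat.find_spec hex)
  infer_instance

end IsCurveIdeal

/-! ### Polynomial relations obtained by counting dimensions. -/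

section Relations

variable {K O : Type*} [Field K] [CommRing O] [Algebra K O]

theorem exists_finset_sub_mem_pow [IsLocalRing O]
    (hc : ∀ a : O, ∃ c : K, a - algebraMap K O c ∈ maximalIdeal O)
    (hfg : (maximalIdeal O).FG) (N : ℕ) :
    ∃ F : Finset O, ∀ a, ∃ v ∈ Submodule.span K (F : Set O), a - v ∈ maximalIdeal O ^ N := by
  classical
  obtain ⟨T, hT⟩ := hfg
  induction N with
  | zero => exact ⟨∅, fun a => ⟨0, zero_mem _, by simp⟩⟩
  | succ N ih =>
    obtain ⟨F, hF⟩ := ih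
    refine ⟨{1} ∪ Finset.image₂ (· * ·) T F, fun a => ?_⟩
    obtain ⟨c, hc⟩ := hc a
    have key : ∀ y ∈ Ideal.span (T : Set O), ∀ r : O, ∃ v ∈ Submodule.span K
        (({1} ∪ Finset.image₂ (· * ·) T F : Finset O) : Set O),
        r * y - v ∈ maximalIdeal O ^ (N + 1) := by
      intro y hy
      induction hy using Submodule.span_induction with
      | mem t ht =>
        intro r
        obtain ⟨v, hv, hv'⟩ := hF r
        refine ⟨t * v, ?_, ?_⟩
        · have := Submodule.mem_map_of_mem (f := LinearMap.mulLeft K t) hv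
          rw [Submodule.map_span] at this
          refine Submodule.span_mono ?_ this
          rintro _ ⟨f, hf, rfl⟩
          simp only [Finset.coe_union, Finset.coe_image₂]
          exact Or.inr ⟨t, ht, f, hf, rfl⟩
        · have := Ideal.mul_mem_mul (show t ∈ maximalIdeal O from hT ▸ Ideal.subset_span ht) hv'
          rw [← pow_succ'] at this
          convert this using 1; ring
      | zero => exact fun r => ⟨0, zero_mem _, by simp⟩
      | add y y' _ _ h h' =>
        intro r
        obtain ⟨v, hv, h⟩ := h r
        obtain ⟨v', hv', h'⟩ := h' r
        exact ⟨v + v', add_mem hv hv', by convert add_mem h h' using 1; ring⟩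
      | smul c y _ h =>
        intro r
        obtain ⟨v, hv, h⟩ := h (r * c)
        exact ⟨v, hv, by convert h using 1; rw [smul_eq_mul]; ring⟩
    obtain ⟨v, hv, h⟩ := key _ (hT.symm ▸ hc) 1
    refine ⟨algebraMap K O c + v, add_mem ?_ hv, by rwa [← sub_sub, ← one_mul (a - _)]⟩
    rw [Algebra.algebraMap_eq_smul_one]
    exact Submodule.smul_mem _ _ (Submodule.subset_span (by simp))

/-- Filtering by powers of a, each step contributes at most |F| dimensions, so the dimension of O/(P
+ (a^k)) grows at most linearly in k. -/
theorem exists_finset_sub_mem_sup_pow {P : Ideal O} {a : O} {F : Finset O}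
    (hF : ∀ y, ∃ v ∈ Submodule.span K (F : Set O), y - v ∈ P ⊔ Ideal.span {a}) (k : ℕ) :
    ∃ G : Finset O, G.card ≤ k * F.card ∧
      ∀ y, ∃ v ∈ Submodule.span K (G : Set O), y - v ∈ P ⊔ Ideal.span {a ^ k} := by
  classical
  induction k with
  | zero => exact ⟨∅, by simp, fun y => ⟨0, zero_mem _, by simp⟩⟩
  | succ k ih =>
    obtain ⟨G, hG, h⟩ := ih
    refine ⟨G ∪ F.image (a ^ k * ·), ?_, fun y => ?_⟩
    · refine (Finset.card_union_le _ _).trans ?_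
      have := Finset.card_image_le (s := F) (f := (a ^ k * ·))
      nlinarith
    · obtain ⟨v, hv, h⟩ := h y
      obtain ⟨p, hp, q, hq, hpq⟩ := Submodule.mem_sup.1 h
      obtain ⟨c, rfl⟩ := Ideal.mem_span_singleton'.1 hq
      obtain ⟨v', hv', h'⟩ := hF c
      obtain ⟨p', hp', q', hq', hpq'⟩ := Submodule.mem_sup.1 h'
      obtain ⟨c', rfl⟩ := Ideal.mem_span_singleton'.1 hq'
      refine ⟨v + a ^ k * v', add_mem (Submodule.span_mono (by simp) hv) ?_, ?_⟩
      · have := Submodule.mem_map_of_mem (f := LinearMap.mulLeft K (a ^ k)) hv'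
        rw [Submodule.map_span] at this
        refine Submodule.span_mono ?_ this
        rintro _ ⟨f, hf, rfl⟩
        simp only [Finset.coe_union, Finset.coe_image]
        exact Or.inr ⟨f, hf, rfl⟩
      · refine Submodule.mem_sup.2 ⟨p + p' * a ^ k, add_mem hp (Ideal.mul_mem_right _ _ hp'),
          c' * a ^ (k + 1), Ideal.mem_span_singleton'.2 ⟨c', rfl⟩, ?_⟩
        linear_combination hpq + a ^ k * hpq'

/-- If few elements span modulo `I`, two elements satisfy a polynomial relation modulo `I`. -/
theorem exists_polynomial_relation {I : Ideal O} {G : Finset O}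
    (hG : ∀ y, ∃ v ∈ Submodule.span K (G : Set O), y - v ∈ I) {M : ℕ} (hM : G.card < M * M)
    (a b : O) :
    ∃ p : ℕ → Polynomial K, (∀ j, (p j).natDegree < M) ∧ ∃ d < M, p d ≠ 0 ∧
      ∑ j ∈ Finset.range (d + 1), Polynomial.aeval a (p j) * b ^ j ∈ I := by
  classical
  have hMpos : 0 < M := Nat.pos_of_ne_zero (by rintro rfl; simp at hM)
  let φ : O →ₗ[K] (O ⧸ I) := (Ideal.Quotient.mkₐ K I).toLinearMap
  have hspan : Submodule.span K ((G.image φ : Finset (O ⧸ I)) : Set (O ⧸ I)) = ⊤ := by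
    rw [Finset.coe_image, ← Submodule.map_span, eq_top_iff]
    rintro y -
    obtain ⟨y, rfl⟩ := Ideal.Quotient.mk_surjective y
    obtain ⟨v, hv, h⟩ := hG y
    exact ⟨v, hv, (Ideal.Quotient.eq.2 h).symm⟩
  -- There are M² monomials a^i b^j with i, j < M, more than the dimension of O/I.
  have hdep : ¬ LinearIndependent K fun ij : Fin M × Fin M => φ (a ^ (ij.1 : ℕ) * b ^ (ij.2 : ℕ)) := by
    intro hli
    have h1 := linearIndependent_le_span_finset _ hli _ hspan
    have h2 := Finset.card_image_le (s := G) (f := φ)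
    simp only [Cardinal.mk_fintype, Fintype.card_prod, Fintype.card_fin, Nat.cast_le] at h1
    omega
  obtain ⟨g, hg, ⟨i₀, j₀⟩, hne⟩ := Fintype.not_linearIndependent_iff.1 hdep
  let p : ℕ → Polynomial K := fun j =>
    if hj : j < M then ∑ i : Fin M, Polynomial.monomial (i : ℕ) (g (i, ⟨j, hj⟩)) else 0
  have hp0 : p j₀ ≠ 0 := by
    intro h
    have := congrArg (Polynomial.coeff · (i₀ : ℕ)) h
    simp only [p, j₀.2, dif_pos, Polynomial.finsetSum_coeff, Polynomial.coeff_monomial,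
      Polynomial.coeff_zero, Fin.val_inj] at this
    rw [Finset.sum_ite_eq' Finset.univ i₀] at this
    simp at this
    exact hne this
  have hsum : ∑ j ∈ Finset.range M, Polynomial.aeval a (p j) * b ^ j ∈ I := by
    rw [← Ideal.Quotient.eq_zero_iff_mem]
    change φ _ = 0
    rw [← hg, Fintype.sum_prod_type_right, Finset.sum_range, map_sum]
    refine Finset.sum_congr rfl fun j _ => ?_
    simp only [p, j.2, dif_pos, map_sum, Finset.sum_mul]
    refine Finset.sum_congr rfl fun i _ => ?_
    rw [← map_smul, Polynomial.aeval_monomial, Algebra.smul_def, mul_assoc]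
  refine ⟨p, fun j => ?_, ?_⟩
  · simp only [p]
    split_ifs with hj
    · refine (Polynomial.natDegree_sum_le_of_forall_le (n := M - 1) _ _ fun i _ => ?_).trans_lt
        (by omega)
      exact (Polynomial.natDegree_monomial_le _).trans (by omega)
    · simpa using hMpos
  -- Drop the vanishing top coefficients, so that d is the actual degree of the relation in b.
  · have key : ∀ n, (∃ j < n, p j ≠ 0) →
        (∑ j ∈ Finset.range n, Polynomial.aeval a (p j) * b ^ j ∈ I) → ∃ d < n, p d ≠ 0 ∧
          ∑ j ∈ Finset.range (d + 1), Polynomial.aeval a (p j) * b ^ j ∈ I := by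
      intro n
      induction n with
      | zero => rintro ⟨j, hj, -⟩; omega
      | succ n ih =>
        rintro ⟨j, hj, hj0⟩ hs
        by_cases hn : p n = 0
        · rw [Finset.sum_range_succ, hn, map_zero, zero_mul, add_zero] at hs
          obtain ⟨d, hd, h⟩ := ih ⟨j, lt_of_le_of_ne (by omega) (by rintro rfl; exact hj0 hn), hj0⟩ hs
          exact ⟨d, by omega, h⟩
        · exact ⟨n, by omega, hn, hs⟩
    exact key M ⟨j₀, j₀.2, hp0⟩ hsum

/-- Differentiating a polynomial relation. -/
theorem Derivation.pow_mul_aeval_mem [CharZero K] (D : Derivation K O O) {I : Ideal O}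
    (hI : ∀ y ∈ I, D y ∈ I) {a b : O} (ha : D a = 0) (d : ℕ) (e : ℕ) (p : ℕ → Polynomial K)
    (h : D b ^ e * ∑ j ∈ Finset.range (d + 1), Polynomial.aeval a (p j) * b ^ j ∈ I) :
    D b ^ (e + 2 * d) * Polynomial.aeval a (p d) ∈ I := by
  have hDp : ∀ q : Polynomial K, D (Polynomial.aeval a q) = 0 := by
    intro q
    rw [Derivation.map_aeval, ha, smul_zero]
  induction d generalizing e p with
  | zero => simpa using h
  | succ d ih =>
    set q := ∑ j ∈ Finset.range (d + 1 + 1), Polynomial.aeval a (p j) * b ^ j with hq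
    have hDq : D q = D b * ∑ j ∈ Finset.range (d + 1),
        Polynomial.aeval a (((j : K) + 1) • p (j + 1)) * b ^ j := by
      rw [hq, Finset.sum_range_succ', map_add, map_sum, pow_zero, mul_one, hDp, add_zero,
        Finset.mul_sum]
      refine Finset.sum_congr rfl fun j _ => ?_
      rw [Derivation.leibniz, hDp, Derivation.leibniz_pow, _root_.map_smul, Algebra.smul_def ((j : K) + 1)]
      simp only [smul_eq_mul, nsmul_eq_mul, Nat.add_sub_cancel, mul_zero, add_zero, _root_.map_add,
        _root_.map_natCast, _root_.map_one, Nat.cast_add, Nat.cast_one]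
      ring
    -- One extra factor D b absorbs the term from differentiating D b ^ e, and D q itself contains a
    -- factor D b. So lowering the degree in b by one costs two powers of D b.
    have h1 : D b ^ (e + 1) * D q ∈ I := by
      have h2 := Ideal.mul_mem_left _ (D b) (hI _ h)
      rw [Derivation.leibniz, smul_eq_mul, smul_eq_mul, Derivation.leibniz_pow, smul_eq_mul,
        nsmul_eq_mul, mul_add] at h2
      have h3 : D b * (q * (e * (D b ^ (e - 1) * D (D b)))) ∈ I := by
        rcases e with _ | e
        · simp
        · convert Ideal.mul_mem_left _ ((e + 1) * D (D b)) h using 1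
          simp only [Nat.add_sub_cancel, Nat.cast_add, Nat.cast_one]
          ring
      have := (Ideal.add_mem_iff_left _ h3).1 h2
      convert this using 1; ring
    rw [hDq, ← mul_assoc, ← pow_succ] at h1
    have h4 := ih (e + 1 + 1) (fun j => ((j : K) + 1) • p (j + 1)) h1
    have hd : ((d : K) + 1) ≠ 0 := by exact_mod_cast Nat.succ_ne_zero d
    rw [_root_.map_smul, mul_smul_comm, Algebra.smul_def,
      Ideal.unit_mul_mem_iff_mem I ((IsUnit.mk0 _ hd).map (algebraMap K O))] at h4
    convert h4 using 2
    ring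

end Relations

/-! ### Vanishing of Poisson brackets on a curve. -/

namespace IsCurveIdeal

variable {K O : Type*} [Field K] [CharZero K] [CommRing O] [Algebra K O] [IsLocalRing O]
  {J : Ideal O} (hJ : IsCurveIdeal J)
  (hc : ∀ a : O, ∃ c : K, a - algebraMap K O c ∈ maximalIdeal O)
  (hfg : (maximalIdeal O).FG) (B : PoissonBracket K O) (hB : ∀ a, ∀ b ∈ J, B.ham a b ∈ J)

include hJ hc hfg hB

omit [CharZero K] hJ hfg hB in
theorem exists_ham_eq (a b : O) :
    ∃ a' ∈ maximalIdeal O, ∃ b' ∈ maximalIdeal O, B.ham a' b' = B.ham a b := by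
  obtain ⟨c, hc1⟩ := hc a
  obtain ⟨d, hd1⟩ := hc b
  refine ⟨_, hc1, _, hd1, ?_⟩
  rw [map_sub, Derivation.map_algebraMap, sub_zero, B.skew, map_sub, Derivation.map_algebraMap,
    sub_zero, ← B.skew]

omit [CharZero K] hc hfg [IsLocalRing O] in
theorem ham_mem_of_mem {P : Ideal O} (hP : P ∈ J.minimalPrimes) (a : O) {b : O} (hb : b ∈ P) :
    B.ham a b ∈ P :=
  (B.ham a).mem_of_mem_minimalPrimes (hB a) hJ.isRadical hP hb

omit [CharZero K] hc hfg [IsLocalRing O] in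
theorem ham_mem_sup {P : Ideal O} (hP : P ∈ J.minimalPrimes) (a : O) (k : ℕ) :
    ∀ y ∈ P ⊔ Ideal.span {a ^ k}, B.ham a y ∈ P ⊔ Ideal.span {a ^ k} := by
  intro y hy
  obtain ⟨p, hp, q, hq, rfl⟩ := Submodule.mem_sup.1 hy
  obtain ⟨c, rfl⟩ := Ideal.mem_span_singleton'.1 hq
  rw [map_add, Derivation.leibniz, Derivation.leibniz_pow, B.self, smul_zero, smul_zero, smul_zero,
    zero_add, smul_eq_mul, mul_comm]
  exact Submodule.add_mem_sup (hJ.ham_mem_of_mem B hB hP a hp)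
    (Ideal.mem_span_singleton'.2 ⟨_, rfl⟩)

/-- If {a,b} were a unit with a, b ∈ m, then P + (a) would be a proper ideal stable under {a,·} and
containing a power of b; differentiating that power repeatedly would put 1 in the ideal. -/
theorem ham_mem_maximalIdeal (a b : O) : B.ham a b ∈ maximalIdeal O := by
  obtain ⟨a, ha, b, hb, h⟩ := exists_ham_eq hc B a b
  rw [← h]
  by_contra hu
  obtain ⟨P, hP⟩ := Ideal.nonempty_minimalPrimes hJ.ne_top
  have hPp : P.IsPrime := hP.1.1
  have hPm := IsLocalRing.le_maximalIdeal hPp.ne_top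
  have haP : a ∉ P := by
    intro haP
    refine hu ?_
    rw [B.skew]
    exact neg_mem (hPm (hJ.ham_mem_of_mem B hB hP b haP))
  obtain ⟨N, hN⟩ := hJ.exists_pow_le hfg hP haP
  have hst := hJ.ham_mem_sup B hB hP a 1
  rw [pow_one] at hst
  have hne : P ⊔ Ideal.span {a} ≠ ⊤ := by
    intro h
    refine (maximalIdeal.isMaximal O).ne_top (top_le_iff.1 (h ▸ sup_le hPm ?_))
    simpa using ha
  refine (B.ham a).pow_notMem hst hne (b := b) ?_ N (hN (Ideal.pow_mem_pow hb N))
  by_contra hc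
  exact hu ((mem_maximalIdeal _).2 hc)

/-- On a Poisson curve all brackets vanish. -/
theorem ham_mem (a b : O) : B.ham a b ∈ J := by
  refine hJ.mem_of_forall_mem fun P hP => ?_
  have hPp : P.IsPrime := hP.1.1
  obtain ⟨a, ha, b, hb, h⟩ := exists_ham_eq hc B a b
  rw [← h]
  by_contra hw
  have haP : a ∉ P := by
    intro haP
    refine hw ?_
    rw [B.skew]
    exact neg_mem (hJ.ham_mem_of_mem B hB hP b haP)
  obtain ⟨N, hN⟩ := hJ.exists_pow_le hfg hP haP
  obtain ⟨s, hs⟩ := hJ.exists_pow_le hfg hP hw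
  obtain ⟨F, hF⟩ := exists_finset_sub_mem_pow hc hfg N
  -- The exponent k = M(2s+1) + 1 must exceed s·2d + i for all d, i < M, while the dimension bound
  -- k|F| stays below M². The first grows linearly in M, so a large M works.
  obtain ⟨M, hM⟩ : ∃ M, M = F.card * (2 * s + 1) + F.card + 1 := ⟨_, rfl⟩
  have hMM : (M * (2 * s + 1) + 1) * F.card < M * M := by
    have h1 : M * M = M * (F.card * (2 * s + 1) + F.card + 1) := congrArg (M * ·) hM
    have h2 : F.card < M := by rw [hM]; nlinarith
    nlinarith
  obtain ⟨G, hG, hG'⟩ := exists_finset_sub_mem_sup_pow (P := P) (a := a) (F := F)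
    (fun y => (hF y).imp fun v h => ⟨h.1, hN h.2⟩) (M * (2 * s + 1) + 1)
  obtain ⟨p, hp, d, hd, hpd, hrel⟩ := exists_polynomial_relation hG' (M := M)
    (hG.trans_lt hMM) a b
  have h1 := (B.ham a).pow_mul_aeval_mem (I := P ⊔ Ideal.span {a ^ (M * (2 * s + 1) + 1)}) (b := b)
    (hJ.ham_mem_sup B hB hP a _) (B.self a) d 0 p
    (by rw [pow_zero, one_mul]; exact hrel)
  -- Write p d = X^i q with q(0) ≠ 0; as a ∈ m, q(a) is a unit, and the relation becomes {a,b}^(2d)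
  -- a^i ∈ P + (a^k).
  obtain ⟨q, hq, hq'⟩ := Polynomial.exists_eq_pow_rootMultiplicity_mul_and_not_dvd (p d) hpd 0
  rw [map_zero, sub_zero] at hq hq'
  set i := Polynomial.rootMultiplicity 0 (p d) with hi
  have hiM : i < M := by
    refine lt_of_le_of_lt ?_ (hp d)
    have := Polynomial.natDegree_le_of_dvd (Dvd.intro _ hq.symm) hpd
    simpa using this
  have hqu : IsUnit (Polynomial.aeval a q) := by
    obtain ⟨r, hr⟩ := Polynomial.X_dvd_sub_C (p := q)
    have h0 : q.coeff 0 ≠ 0 := fun h => hq' (Polynomial.X_dvd_iff.2 h)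
    by_contra hcon
    have h2 : Polynomial.aeval a (q - Polynomial.C (q.coeff 0)) ∈ maximalIdeal O := by
      rw [hr, map_mul, Polynomial.aeval_X]
      exact Ideal.mul_mem_right _ _ ha
    have h3 := sub_mem ((mem_maximalIdeal _).2 hcon) h2
    rw [map_sub, sub_sub_cancel, Polynomial.aeval_C] at h3
    exact (mem_nonunits_iff.1 h3) ((IsUnit.mk0 _ h0).map _)
  rw [hq, map_mul, map_pow, Polynomial.aeval_X, ← mul_assoc,
    Ideal.mul_unit_mem_iff_mem _ hqu, zero_add] at h1
  set k := M * (2 * s + 1) + 1 with hk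
  -- Because a^s ∈ P + ({a,b}), the powers of {a,b} can be traded for powers of a. This puts a power
  -- of a with exponent less than k in P + (a^k), and hence in P.
  have h2 : a ^ (s * (2 * d) + i) ∈ P ⊔ Ideal.span {a ^ k} := by
    obtain ⟨p₁, hp₁, z, hz, hpz⟩ := Submodule.mem_sup.1 (hs (Ideal.pow_mem_pow ha s))
    obtain ⟨c, rfl⟩ := Ideal.mem_span_singleton'.1 hz
    have h3 : a ^ (s * (2 * d)) - (c * B.ham a b) ^ (2 * d) ∈ P := by
      rw [pow_mul]
      obtain ⟨y, hy⟩ := sub_dvd_pow_sub_pow (a ^ s) (c * B.ham a b) (2 * d)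
      rw [hy, ← hpz, add_sub_cancel_right]
      exact Ideal.mul_mem_right _ _ hp₁
    have h4 := Submodule.add_mem_sup (Ideal.mul_mem_right (a ^ i) _ h3) (zero_mem (Ideal.span {a ^ k}))
    have h5 := add_mem h4 (Ideal.mul_mem_left _ (c ^ (2 * d)) h1)
    convert h5 using 1
    ring
  obtain ⟨p₁, hp₁, z, hz, hpz⟩ := Submodule.mem_sup.1 h2
  obtain ⟨c, rfl⟩ := Ideal.mem_span_singleton'.1 hz
  have hlt : s * (2 * d) + i < k := by
    simp only [hk]
    nlinarith
  obtain ⟨l, hl⟩ := Nat.exists_eq_add_of_lt hlt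
  rw [hl] at hpz
  have hu : IsUnit (1 - c * a ^ (l + 1)) := by
    by_contra hcon
    have := add_mem ((mem_maximalIdeal _).2 hcon) (Ideal.mul_mem_left _ c
      (Ideal.pow_mem_of_mem _ ha (l + 1) l.succ_pos))
    rw [sub_add_cancel] at this
    exact (maximalIdeal.isMaximal O).ne_top ((Ideal.eq_top_iff_one _).2 this)
  have h6 : a ^ (s * (2 * d) + i) * (1 - c * a ^ (l + 1)) ∈ P := by
    convert hp₁ using 1
    linear_combination -hpz
  rw [Ideal.mul_unit_mem_iff_mem _ hu] at h6
  exact haP (hPp.mem_of_pow_mem _ h6)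

end IsCurveIdeal

/-! ### Linear parts, and coordinates adapted to the linearized bracket. -/

namespace DualCoordinates

section LinearPart

variable {σ K O : Type*} [DecidableEq σ] [Fintype σ] [Nonempty σ] [Field K] [CharZero K]
  [CommRing O] [IsLocalRing O] [Algebra K O] (x : DualCoordinates σ K O)

/-- The linear part of the Taylor expansion. -/
noncomputable def lin : O →ₗ[K] (σ → K) :=
  LinearMap.pi fun i => (MvPowerSeries.coeff (Finsupp.single i 1)).comp x.taylor.toLinearMap

omit [Nonempty σ] in
theorem lin_apply (a : O) (i : σ) :
    x.lin a i = MvPowerSeries.coeff (Finsupp.single i 1) (x.taylor a) := rfl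

omit [Nonempty σ] in
theorem lin_eq_zero_iff {a : O} (ha : a ∈ maximalIdeal O) :
    x.lin a = 0 ↔ a ∈ maximalIdeal O ^ 2 := by
  rw [← pow_one (maximalIdeal O), ← x.taylor_mem_iff] at ha
  rw [← x.taylor_mem_iff, MvPowerSeries.mem_orderIdeal]
  rw [MvPowerSeries.mem_orderIdeal_one, ← MvPowerSeries.coeff_zero_eq_constantCoeff_apply] at ha
  constructor
  · intro h v hv
    rcases Nat.lt_succ_iff_lt_or_eq.1 hv with hv | hv
    · rw [Nat.lt_one_iff, Finsupp.degree_eq_zero_iff] at hv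
      rw [hv, ha]
    · obtain ⟨i, rfl⟩ : ∃ i, Finsupp.single i 1 = v := by
        rw [← Set.mem_range, Finsupp.range_single_one]
        exact hv
      exact congrFun h i
  · intro h
    ext i
    exact h _ (by simp)

omit [Nonempty σ] in
theorem lin_t (i : σ) : x.lin (x.t i) = Pi.single i 1 := by
  ext j
  rw [lin_apply, taylor_t, MvPowerSeries.coeff_X, Pi.single_apply]
  congr 1
  rw [Finsupp.single_left_inj one_ne_zero]

omit [Nonempty σ] in
theorem exists_lin_eq (v : σ → K) : ∃ a ∈ maximalIdeal O, x.lin a = v := by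
  refine ⟨∑ i, v i • x.t i, sum_mem fun i _ => ?_, ?_⟩
  · rw [Algebra.smul_def]
    exact Ideal.mul_mem_left _ _ (x.t_mem i)
  · ext j
    simp [x.lin_t, Pi.single_apply]

theorem constantCoeff_taylor_d (i : σ) (a : O) :
    MvPowerSeries.constantCoeff (x.taylor (x.d i a)) = x.lin a i := by
  rw [taylor_d, ← MvPowerSeries.coeff_zero_eq_constantCoeff_apply, MvPowerSeries.coeff_pderiv,
    lin_apply]
  simp

include x in
omit [Fintype σ] [Nonempty σ] [CharZero K] in
theorem maximalIdeal_fg [Finite σ] : (maximalIdeal O).FG := by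
  rw [x.span_t]
  exact Submodule.fg_span (Set.finite_range _)

omit [Nonempty σ] in
theorem sub_mem_of_lin_eq {a b : O} (ha : a ∈ maximalIdeal O) (hb : b ∈ maximalIdeal O)
    (h : x.lin a = x.lin b) : a - b ∈ maximalIdeal O ^ 2 := by
  rw [← x.lin_eq_zero_iff (sub_mem ha hb), map_sub, h, sub_self]

omit [Nonempty σ] in
-- Nakayama: N surjects onto m/m².
theorem maximalIdeal_le_of_forall_exists {N : Ideal O} (hN : N ≤ maximalIdeal O)
    (h : ∀ v, ∃ a ∈ N, x.lin a = v) : maximalIdeal O ≤ N := by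
  refine Submodule.le_of_le_smul_of_le_jacobson_bot (I := maximalIdeal O) x.maximalIdeal_fg
    (IsLocalRing.maximalIdeal_le_jacobson _) fun a ha => ?_
  obtain ⟨b, hb, h⟩ := h (x.lin a)
  have h2 := x.sub_mem_of_lin_eq ha (hN hb) h.symm
  rw [pow_two] at h2
  exact Submodule.mem_sup.2 ⟨b, hb, _, h2, by ring⟩

omit [Nonempty σ] in
theorem maximalIdeal_le_span {t : σ → O} (ht : ∀ i, t i ∈ maximalIdeal O)
    (h : LinearIndependent K fun i => x.lin (t i)) :
    maximalIdeal O ≤ Ideal.span (Set.range t) := by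
  refine x.maximalIdeal_le_of_forall_exists (Ideal.span_le.2 ?_) fun v => ?_
  · rintro _ ⟨i, rfl⟩; exact ht i
  · have hv : v ∈ Submodule.span K (Set.range fun i => x.lin (t i)) := by
      rw [h.span_eq_top_of_card_eq_finrank' (by simp)]
      trivial
    obtain ⟨c, hc⟩ := (Submodule.mem_span_range_iff_exists_fun K).1 hv
    refine ⟨∑ i, c i • t i, sum_mem fun i _ => ?_, ?_⟩
    · rw [Algebra.smul_def]
      exact Ideal.mul_mem_left _ _ (Ideal.subset_span ⟨i, rfl⟩)
    · rw [map_sum, ← hc]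
      simp

/-- Functions with independent linear parts are coordinates. -/
theorem exists_of_linearIndependent {t : σ → O} (ht : ∀ i, t i ∈ maximalIdeal O)
    (h : LinearIndependent K fun i => x.lin (t i)) :
    ∃ x' : DualCoordinates σ K O, x'.t = t := by
  -- The Jacobian matrix of t. Its value at the point has the linear parts as columns, so its
  -- determinant is a unit, and its inverse gives the dual derivations.
  let A : Matrix σ σ O := Matrix.of fun i j => x.d i (t j)
  have hA : IsUnit A.det := by
    by_contra hu
    have h1 : A.det ∈ maximalIdeal O := (mem_maximalIdeal _).2 hu
    rw [← pow_one (maximalIdeal O), ← x.taylor_mem_iff, MvPowerSeries.mem_orderIdeal_one] at h1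
    let φ : O →+* K := MvPowerSeries.constantCoeff.comp x.taylor.toRingHom
    have h2 : (φ.mapMatrix A).det = 0 := by
      rw [← RingHom.map_det]; exact h1
    have h3 : φ.mapMatrix A = (Matrix.of fun i => x.lin (t i)).transpose := by
      ext i j
      exact x.constantCoeff_taylor_d i (t j)
    rw [h3, Matrix.det_transpose] at h2
    have h4 := Matrix.linearIndependent_rows_iff_isUnit.1
      (show LinearIndependent K (Matrix.of fun i => x.lin (t i)).row from h)
    rw [Matrix.isUnit_iff_isUnit_det, h2] at h4
    exact not_isUnit_zero h4
  refine ⟨{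
    t := t
    d := fun i => ∑ k, A⁻¹ i k • x.d k
    span_t := le_antisymm (x.maximalIdeal_le_span ht h)
      (Ideal.span_le.2 (by rintro _ ⟨i, rfl⟩; exact ht i))
    d_t := fun i j => ?_
    exists_const := x.exists_const }, rfl⟩
  have h5 := congrFun (congrFun (Matrix.nonsing_inv_mul A hA) i) j
  rw [Matrix.mul_apply, Matrix.one_apply] at h5
  rw [Derivation.finset_sum_apply, ← h5]
  rfl

end LinearPart

section Adapted

variable {K O : Type*} [Field K] [CharZero K] [CommRing O] [IsLocalRing O] [Algebra K O]
  (x : DualCoordinates (Fin 3) K O)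

omit [CharZero K] in
theorem exists_notMem_span_pair (u v : Fin 3 → K) :
    ∃ w, w ∉ Submodule.span K (Set.range ![u, v]) := by
  by_contra! h
  have h1 : Submodule.span K (Set.range ![u, v]) = ⊤ := eq_top_iff.2 fun w _ => h w
  have h2 := finrank_range_le_card (R := K) ![u, v]
  rw [Set.finrank, h1, finrank_top] at h2
  simp at h2

theorem exists_third {u v : O} (h : LinearIndependent K ![x.lin u, x.lin v]) :
    ∃ w ∈ maximalIdeal O, x.lin w ∉ Submodule.span K (Set.range ![x.lin u, x.lin v]) ∧
    ∀ z, x.lin z ∉ Submodule.span K (Set.range ![x.lin u, x.lin v]) →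
      LinearIndependent K fun i => x.lin (![u, v, z] i) := by
  obtain ⟨y, hy⟩ := exists_notMem_span_pair (x.lin u) (x.lin v)
  obtain ⟨w, hw, rfl⟩ := x.exists_lin_eq y
  refine ⟨w, hw, hy, fun z hz => ?_⟩
  have e : (fun i => x.lin (![u, v, z] i)) =
      Fin.snoc (α := fun _ => Fin 3 → K) ![x.lin u, x.lin v] (x.lin z) := by
    funext i
    fin_cases i <;> rfl
  rw [e]
  exact linearIndependent_finSnoc.2 ⟨h, hz⟩

variable {J : Ideal O} (hJ : IsCurveIdeal J) (B : PoissonBracket K O)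
  (hB : ∀ a, ∀ b ∈ J, B.ham a b ∈ J)
  (hsing : ¬ IsRegularLocalRing (O ⧸ J))

include x hJ hB hsing

omit hsing in
theorem ham_mem_sq (a : O) {b : O} (hb : b ∈ maximalIdeal O ^ 2) :
    B.ham a b ∈ maximalIdeal O ^ 2 := by
  have hm := hJ.ham_mem_maximalIdeal x.exists_const x.maximalIdeal_fg B hB a
  rw [pow_two] at hb ⊢
  refine Submodule.mul_induction_on hb (fun c hc d hd => ?_) (fun c d hc hd => ?_)
  · rw [Derivation.leibniz, smul_eq_mul, smul_eq_mul]
    exact add_mem (Ideal.mul_mem_mul hc (hm _)) (Ideal.mul_mem_mul hd (hm _))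
  · rw [map_add]; exact add_mem hc hd

omit hB in
-- If J contained two elements with independent linear parts, a third function w would complete them
-- to generators of m, so that m ⊆ (w) + J and O/J would be regular. This is how singularity of the
-- curve enters the normal form.
theorem exists_smul_sub_mem {u v : O} (hu : u ∈ J) (hu2 : u ∉ maximalIdeal O ^ 2) (hv : v ∈ J) :
    ∃ c : K, v - c • u ∈ maximalIdeal O ^ 2 := by
  have hJm := hJ.le_maximalIdeal
  have hsm : ∀ c : K, c • u ∈ maximalIdeal O := fun c => by
    rw [Algebra.smul_def]; exact Ideal.mul_mem_left _ _ (hJm hu)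
  by_contra! hcon
  have hli : LinearIndependent K ![x.lin u, x.lin v] := by
    rw [LinearIndependent.pair_iff' fun h => hu2 ((x.lin_eq_zero_iff (hJm hu)).1 h)]
    intro c h
    refine hcon c (x.sub_mem_of_lin_eq (hJm hv) (hsm c) ?_)
    rw [map_smul, h]
  obtain ⟨w, hw, hw', h⟩ := x.exists_third hli
  refine hsing (hJ.isRegularLocalRing x.maximalIdeal_fg hw
    ((x.maximalIdeal_le_span ?_ (h w hw')).trans (Ideal.span_le.2 ?_)))
  · intro i
    fin_cases i
    exacts [hJm hu, hJm hv, hw]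
  · rintro _ ⟨i, rfl⟩
    fin_cases i
    exacts [Ideal.mem_sup_right hu, Ideal.mem_sup_right hv,
      Ideal.mem_sup_left (Ideal.mem_span_singleton_self w)]

/-- At a singular point of a Poisson curve whose linearization is not two-step nilpotent there are
coordinates in which the linearized bracket is in normal form. -/
theorem exists_adapted {a b c : O} (h : B.ham c (B.ham a b) ∉ maximalIdeal O ^ 2) :
    ∃ x' : DualCoordinates (Fin 3) K O, x'.t 0 ∈ J ∧
      (∀ f ∈ J, ∃ r : K, f - r • x'.t 0 ∈ maximalIdeal O ^ 2) ∧
      B.ham (x'.t 0) (x'.t 1) - x'.t 0 ∈ maximalIdeal O ^ 2 ∧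
      B.ham (x'.t 0) (x'.t 2) ∈ maximalIdeal O ^ 2 ∧
      B.ham (x'.t 1) (x'.t 2) ∈ maximalIdeal O ^ 2 := by
  have hJm := hJ.le_maximalIdeal
  have hmem := hJ.ham_mem x.exists_const x.maximalIdeal_fg B hB
  have hsq := x.ham_mem_sq hJ B hB
  have hsmul : ∀ (r : K) {I : Ideal O} {f : O}, f ∈ I → r • f ∈ I := fun r I f hf => by
    rw [Algebra.smul_def]; exact Ideal.mul_mem_left _ _ hf
  set u := B.ham a b with hu
  have huJ : u ∈ J := hmem a b
  have hu2 : u ∉ maximalIdeal O ^ 2 := fun h2 => h (hsq c h2)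
  have hline : ∀ f ∈ J, ∃ r : K, f - r • u ∈ maximalIdeal O ^ 2 := fun f hf =>
    x.exists_smul_sub_mem hJ hsing huJ hu2 hf
  obtain ⟨γ, hγ⟩ := hline _ (hmem c u)
  have hγ0 : γ ≠ 0 := by
    rintro rfl
    exact h (by simpa using hγ)
  obtain ⟨c₀, hc₀⟩ := x.exists_const c
  -- Since {c,u} ≡ γu, subtracting the constant and dividing by -γ gives w ∈ m with {u,w} ≡ u modulo
  -- m².
  let w := (-γ⁻¹) • (c - algebraMap K O c₀)
  have hwm : w ∈ maximalIdeal O := hsmul _ hc₀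
  have huw : B.ham u w - u ∈ maximalIdeal O ^ 2 := by
    have e : B.ham u w - u = γ⁻¹ • (B.ham c u - γ • u) := by
      simp only [w]
      rw [Derivation.map_smul, map_sub, Derivation.map_algebraMap, sub_zero, B.skew u c, smul_sub,
        smul_smul, inv_mul_cancel₀ hγ0, one_smul, smul_neg, neg_smul, neg_neg]
    rw [e]
    exact hsmul _ hγ
  clear_value w
  -- If w ≡ r u, then {u,w} ≡ 0, contradicting {u,w} ≡ u ∉ m².
  have hli : LinearIndependent K ![x.lin u, x.lin w] := by
    rw [LinearIndependent.pair_iff' fun h => hu2 ((x.lin_eq_zero_iff (hJm huJ)).1 h)]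
    intro r hr
    rw [← map_smul] at hr
    have h1 := hsq u (x.sub_mem_of_lin_eq (hsmul r (hJm huJ)) hwm hr)
    rw [map_sub, Derivation.map_smul, B.self, smul_zero, zero_sub] at h1
    refine hu2 ?_
    convert sub_mem (neg_mem h1) huw using 1
    ring
  obtain ⟨z₀, hz₀, hz₀', hcoord⟩ := x.exists_third hli
  obtain ⟨α, hα⟩ := hline _ (hmem u z₀)
  obtain ⟨β, hβ⟩ := hline _ (hmem w z₀)
  -- Given {u,z₀} ≡ αu and {w,z₀} ≡ βu, these corrections cancel both brackets, since {u,w} ≡ u.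
  let z := z₀ - α • w + β • u
  have hzm : z ∈ maximalIdeal O := add_mem (sub_mem hz₀ (hsmul _ hwm)) (hsmul _ (hJm huJ))
  have hz' : x.lin z ∉ Submodule.span K (Set.range ![x.lin u, x.lin w]) := by
    have hs1 : x.lin u ∈ Submodule.span K (Set.range ![x.lin u, x.lin w]) :=
      Submodule.subset_span ⟨0, rfl⟩
    have hs2 : x.lin w ∈ Submodule.span K (Set.range ![x.lin u, x.lin w]) :=
      Submodule.subset_span ⟨1, rfl⟩
    intro hz
    refine hz₀' ?_
    have e : x.lin z₀ = x.lin z + α • x.lin w - β • x.lin u := by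
      simp only [z, map_add, map_sub, map_smul]; abel
    rw [e]
    exact sub_mem (add_mem hz (Submodule.smul_mem _ _ hs2)) (Submodule.smul_mem _ _ hs1)
  obtain ⟨x', hx'⟩ := x.exists_of_linearIndependent (t := ![u, w, z]) (by
    intro i
    fin_cases i
    exacts [hJm huJ, hwm, hzm]) (hcoord z hz')
  refine ⟨x', ?_⟩
  have e0 : x'.t 0 = u := by rw [hx']; rfl
  have e1 : x'.t 1 = w := by rw [hx']; rfl
  have e2 : x'.t 2 = z := by rw [hx']; rfl
  rw [e0, e1, e2]
  refine ⟨huJ, hline, huw, ?_, ?_⟩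
  · simp only [z]
    rw [map_add, map_sub, Derivation.map_smul, Derivation.map_smul, B.self, smul_zero, add_zero]
    convert sub_mem hα (hsmul α huw) using 1
    rw [smul_sub]; ring
  · simp only [z]
    rw [map_add, map_sub, Derivation.map_smul, Derivation.map_smul, B.self, smul_zero, sub_zero,
      B.skew w u]
    convert sub_mem hβ (hsmul β huw) using 1
    rw [smul_sub, smul_neg]; ring

end Adapted

end DualCoordinates

/-! ### Extension of the bracket and of the curve to the completion. -/

namespace DualCoordinates

variable {σ K O : Type*} [DecidableEq σ] [Fintype σ] [Nonempty σ] [Field K] [CharZero K]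
  [CommRing O] [IsLocalRing O] [Algebra K O] (x : DualCoordinates σ K O) (B : PoissonBracket K O)

/-- The extension of the Hamiltonian derivations of a Poisson bracket to power series. -/
noncomputable def taylorHam (f : MvPowerSeries σ K) :
    Derivation K (MvPowerSeries σ K) (MvPowerSeries σ K) :=
  ∑ j, (∑ i, x.taylor (B.ham (x.t i) (x.t j)) * MvPowerSeries.pderiv K i f) •
    MvPowerSeries.pderiv K j

omit [Nonempty σ] in
theorem taylorHam_apply (f g : MvPowerSeries σ K) :
    x.taylorHam B f g = ∑ j, (∑ i, x.taylor (B.ham (x.t i) (x.t j)) * MvPowerSeries.pderiv K i f) *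
      MvPowerSeries.pderiv K j g := by
  rw [taylorHam, Derivation.finset_sum_apply]
  rfl

theorem taylorHam_taylor (a b : O) :
    x.taylorHam B (x.taylor a) (x.taylor b) = x.taylor (B.ham a b) := by
  rw [taylorHam_apply, x.taylor_derivation (B.ham a) b]
  refine Finset.sum_congr rfl fun j _ => ?_
  rw [B.skew a, map_neg, x.taylor_derivation (B.ham _) a, ← Finset.sum_neg_distrib]
  congr 1
  refine Finset.sum_congr rfl fun i _ => ?_
  rw [B.skew (x.t i), map_neg, neg_mul]

theorem taylorHam_sub_mem {f f' g g' : MvPowerSeries σ K} {k : ℕ}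
    (hf : f - f' ∈ MvPowerSeries.orderIdeal σ K (k + 1))
    (hg : g - g' ∈ MvPowerSeries.orderIdeal σ K (k + 1)) :
    x.taylorHam B f g - x.taylorHam B f' g' ∈ MvPowerSeries.orderIdeal σ K k := by
  have h1 : x.taylorHam B (f - f') g ∈ MvPowerSeries.orderIdeal σ K k := by
    rw [taylorHam_apply]
    refine sum_mem fun j _ => Ideal.mul_mem_right _ _ (sum_mem fun i _ => Ideal.mul_mem_left _ _ ?_)
    exact MvPowerSeries.derivation_mem_orderIdeal_of_succ _ hf
  have h2 := MvPowerSeries.derivation_mem_orderIdeal_of_succ (x.taylorHam B f') hg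
  convert add_mem h1 h2 using 1
  have e : x.taylorHam B (f - f') g = x.taylorHam B f g - x.taylorHam B f' g := by
    simp only [taylorHam_apply, map_sub, mul_sub, Finset.sum_sub_distrib, sub_mul]
  rw [e, map_sub]
  ring

/-- The extension of a Poisson bracket to power series. -/
noncomputable def taylorBracket : PoissonBracket K (MvPowerSeries σ K) where
  ham := x.taylorHam B
  self f := by
    refine MvPowerSeries.eq_zero_of_forall_mem_orderIdeal fun k => ?_
    obtain ⟨a, ha⟩ := x.exists_sub_taylor_mem f (k + 1)
    have := x.taylorHam_sub_mem B ha ha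
    rwa [taylorHam_taylor, B.self, map_zero, sub_zero] at this
  skew f g := by
    rw [← sub_eq_zero]
    refine MvPowerSeries.eq_zero_of_forall_mem_orderIdeal fun k => ?_
    obtain ⟨a, ha⟩ := x.exists_sub_taylor_mem f (k + 1)
    obtain ⟨b, hb⟩ := x.exists_sub_taylor_mem g (k + 1)
    have h := add_mem (x.taylorHam_sub_mem B ha hb) (x.taylorHam_sub_mem B hb ha)
    rw [taylorHam_taylor, taylorHam_taylor, B.skew b, map_neg] at h
    convert h using 1
    ring
  jacobi f g h := by
    rw [← sub_eq_zero]
    refine MvPowerSeries.eq_zero_of_forall_mem_orderIdeal fun k => ?_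
    -- Each bracket costs one order of approximation, and the Jacobi identity nests two.
    obtain ⟨a, ha⟩ := x.exists_sub_taylor_mem f (k + 2)
    obtain ⟨b, hb⟩ := x.exists_sub_taylor_mem g (k + 2)
    obtain ⟨c, hc⟩ := x.exists_sub_taylor_mem h (k + 2)
    have mono : ∀ {y : MvPowerSeries σ K}, y ∈ MvPowerSeries.orderIdeal σ K (k + 2) →
        y ∈ MvPowerSeries.orderIdeal σ K (k + 1) := fun hy =>
      MvPowerSeries.orderIdeal_antitone (by omega) hy
    have h1 := x.taylorHam_sub_mem B (mono ha) (x.taylorHam_sub_mem B hb hc)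
    have h2 := x.taylorHam_sub_mem B (x.taylorHam_sub_mem B ha hb) (mono hc)
    have h3 := x.taylorHam_sub_mem B (mono hb) (x.taylorHam_sub_mem B ha hc)
    simp only [taylorHam_taylor] at h1 h2 h3
    convert sub_mem (sub_mem h1 h2) h3 using 1
    rw [B.jacobi, map_add]
    ring

theorem taylorBracket_taylor (a b : O) :
    (x.taylorBracket B).ham (x.taylor a) (x.taylor b) = x.taylor (B.ham a b) :=
  x.taylorHam_taylor B a b

/-! ### The formal completion of the ideal of a curve -/

variable {J : Ideal O}

omit [Nonempty σ] in
/-- Elements of the completed ideal are approximated by elements of the ideal. -/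
theorem exists_mem_sub_taylor_mem {f : MvPowerSeries σ K} (hf : f ∈ J.map x.taylor) (k : ℕ) :
    ∃ a ∈ J, f - x.taylor a ∈ MvPowerSeries.orderIdeal σ K k := by
  induction hf using Submodule.span_induction with
  | mem f hf =>
    obtain ⟨a, ha, rfl⟩ := hf
    exact ⟨a, ha, by simp⟩
  | zero => exact ⟨0, zero_mem _, by simp⟩
  | add f g _ _ hf hg =>
    obtain ⟨a, ha, h⟩ := hf
    obtain ⟨b, hb, h'⟩ := hg
    refine ⟨a + b, add_mem ha hb, ?_⟩
    convert add_mem h h' using 1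
    rw [map_add]; ring
  | smul c f _ hf =>
    obtain ⟨a, ha, h⟩ := hf
    obtain ⟨b, hb⟩ := x.exists_sub_taylor_mem c k
    refine ⟨b * a, Ideal.mul_mem_left _ _ ha, ?_⟩
    convert add_mem (Ideal.mul_mem_left _ c h) (Ideal.mul_mem_right (x.taylor a) _ hb) using 1
    rw [map_mul, smul_eq_mul]; ring

/-- Ideals of the power series ring are closed, so approximation by J to every order suffices. -/
theorem mem_map_taylor_of_forall {f : MvPowerSeries σ K}
    (hf : ∀ k, ∃ a ∈ J, f - x.taylor a ∈ MvPowerSeries.orderIdeal σ K k) :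
    f ∈ J.map x.taylor := by
  refine MvPowerSeries.mem_of_forall_mem_sup_orderIdeal _ fun k => ?_
  obtain ⟨a, ha, h⟩ := hf k
  exact Submodule.mem_sup.2 ⟨_, Ideal.mem_map_of_mem _ ha, _, h, by ring⟩

omit [Nonempty σ] in
-- Ĵ ∩ O = J, because J is closed in the m-adic topology of O.
theorem taylor_mem_map_iff (hJ : IsCurveIdeal J) {a : O} :
    x.taylor a ∈ J.map x.taylor ↔ a ∈ J := by
  refine ⟨fun h => ?_, fun h => Ideal.mem_map_of_mem _ h⟩
  refine hJ.mem_of_forall_mem_sup_pow x.maximalIdeal_fg fun k => ?_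
  obtain ⟨b, hb, h⟩ := x.exists_mem_sub_taylor_mem h k
  rw [← map_sub, taylor_mem_iff] at h
  exact Submodule.mem_sup.2 ⟨b, hb, _, h, by ring⟩

/-- A parameter of the completed ideal is not a zero divisor modulo it. -/
theorem mem_map_taylor_of_mul_mem (hJ : IsCurveIdeal J) {τ f : MvPowerSeries σ K} {N : ℕ}
    (hτ : MvPowerSeries.orderIdeal σ K N ≤ J.map x.taylor ⊔ Ideal.span {τ})
    (h : τ * f ∈ J.map x.taylor) : f ∈ J.map x.taylor := by
  by_cases hτ1 : τ ∈ MvPowerSeries.orderIdeal σ K 1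
  swap
  · have hu : IsUnit τ := by
      by_contra hc
      exact hτ1 (MvPowerSeries.maximalIdeal_eq_orderIdeal (σ := σ) (K := K) ▸
        (mem_maximalIdeal _).2 hc)
    exact (Ideal.unit_mul_mem_iff_mem _ hu).1 h
  refine x.mem_map_taylor_of_forall fun k => ?_
  -- Enough precision to transfer both the parameter condition (order N + 1, for Nakayama) and the
  -- product relation (order N + k) from the completion to O.
  let n := N + k + 1
  obtain ⟨t, ht⟩ := x.exists_sub_taylor_mem τ n
  obtain ⟨a, ha⟩ := x.exists_sub_taylor_mem f n
  have htm : t ∈ maximalIdeal O := by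
    rw [← pow_one (maximalIdeal O), ← x.taylor_mem_iff]
    have := sub_mem hτ1 (MvPowerSeries.orderIdeal_antitone (by omega : 1 ≤ n) ht)
    rwa [sub_sub_cancel] at this
  -- The approximation t is still a parameter: m^N ⊆ J + (t) + m·m^N, and Nakayama removes the last
  -- term.
  have hN : maximalIdeal O ^ N ≤ J ⊔ Ideal.span {t} := by
    refine Submodule.le_of_le_smul_of_le_jacobson_bot (I := maximalIdeal O)
      (Submodule.FG.pow x.maximalIdeal_fg N)
      (IsLocalRing.maximalIdeal_le_jacobson _) fun c hc => ?_
    obtain ⟨g, hg, q, hq, hgq⟩ := Submodule.mem_sup.1 (hτ (x.taylor_mem_iff.2 hc))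
    obtain ⟨r, rfl⟩ := Ideal.mem_span_singleton'.1 hq
    obtain ⟨b, hb, hb'⟩ := x.exists_mem_sub_taylor_mem hg n
    obtain ⟨r', hr'⟩ := x.exists_sub_taylor_mem r n
    have h1 : x.taylor (c - (b + r' * t)) ∈ MvPowerSeries.orderIdeal σ K n := by
      rw [map_sub, map_add, map_mul, ← hgq]
      convert add_mem hb' (add_mem (Ideal.mul_mem_left _ r ht)
        (Ideal.mul_mem_right (x.taylor t) _ hr')) using 1
      ring
    rw [taylor_mem_iff] at h1
    refine Submodule.mem_sup.2 ⟨b + r' * t, Submodule.add_mem_sup hb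
      (Ideal.mem_span_singleton'.2 ⟨r', rfl⟩), c - (b + r' * t), ?_, by ring⟩
    rw [smul_eq_mul, ← pow_succ']
    exact Ideal.pow_le_pow_right (by omega) h1
  have h2 : t * a ∈ J ⊔ maximalIdeal O ^ (N + k) := by
    obtain ⟨b, hb, hb'⟩ := x.exists_mem_sub_taylor_mem h n
    have h3 : x.taylor (t * a - b) ∈ MvPowerSeries.orderIdeal σ K n := by
      rw [map_sub, map_mul]
      convert sub_mem hb' (add_mem (Ideal.mul_mem_right f _ ht)
        (Ideal.mul_mem_left _ (x.taylor t) ha)) using 1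
      ring
    rw [taylor_mem_iff] at h3
    exact Submodule.mem_sup.2 ⟨b, hb, _, Ideal.pow_le_pow_right (by omega) h3, by ring⟩
  -- Hence t a ∈ J + t m^k, say t(a - c) ∈ J with c ∈ m^k. As t is a nonzerodivisor modulo J, a - c
  -- ∈ J approximates f to order k.
  have h4 : maximalIdeal O ^ (N + k) ≤ J ⊔ Ideal.span {t} * maximalIdeal O ^ k := by
    rw [pow_add]
    refine (Ideal.mul_mono_left hN).trans ?_
    rw [Ideal.sup_mul]
    exact sup_le_sup_right Ideal.mul_le_left _
  obtain ⟨b, hb, q, hq, hbq⟩ := Submodule.mem_sup.1 ((sup_le le_sup_left h4 : _ ≤ _) h2)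
  obtain ⟨c, hc, rfl⟩ := Ideal.mem_span_singleton_mul.1 hq
  have h5 : a - c ∈ J := hJ.mem_of_mul_mem hN (by
    rw [mul_sub, ← hbq]; convert hb using 1; ring)
  refine ⟨a - c, h5, ?_⟩
  rw [map_sub]
  convert add_mem (MvPowerSeries.orderIdeal_antitone (by omega : k ≤ n) ha)
    (x.taylor_mem_iff.2 hc) using 1
  ring

end DualCoordinates

/-! ### Ideals without embedded components in two variables are principal. -/

section Saturated

variable {R : Type*} [CommRing R] [IsLocalRing R] [IsNoetherianRing R] {y z : R}

/-- Coordinates of a two-dimensional regular local ring such that every element outside `(y)` is,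
up to a unit, a power of `z` modulo `y`. -/
structure IsPlaneCoordinates (y z : R) : Prop where
  mem : y ∈ maximalIdeal R
  le : maximalIdeal R ≤ Ideal.span {y} ⊔ Ideal.span {z}
  mem_right : z ∈ maximalIdeal R
  exists_eq : ∀ f ∉ Ideal.span {y}, ∃ (j : ℕ) (u q : R), IsUnit u ∧ f = z ^ j * u + y * q

omit [IsLocalRing R] [IsNoetherianRing R] in
theorem Ideal.pow_le_sup_span_pow {I J : Ideal R} {w : R} (h : J ≤ I ⊔ Ideal.span {w}) (k : ℕ) :
    J ^ k ≤ I ⊔ Ideal.span {w ^ k} := by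
  induction k with
  | zero => simp
  | succ k ih =>
    rw [pow_succ]
    refine (Ideal.mul_mono ih h).trans ?_
    rw [Ideal.sup_mul]
    refine sup_le (Ideal.mul_le_left.trans le_sup_left) ?_
    rw [Ideal.mul_sup]
    refine sup_le (Ideal.mul_le_right.trans le_sup_left) ?_
    rw [Ideal.span_singleton_mul_span_singleton, ← pow_succ]
    exact le_sup_right

namespace IsPlaneCoordinates

variable (h : IsPlaneCoordinates y z)

include h

/-- The powers of (y) intersect in zero by Krull, so dividing out y must stop. -/
theorem exists_eq_pow_mul_notMem {f : R} (hf : f ≠ 0) :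
    ∃ (i : ℕ) (g : R), g ∉ Ideal.span {y} ∧ f = y ^ i * g := by
  have hex : ∃ k, f ∉ Ideal.span {y ^ k} := by
    by_contra! hcon
    have h1 := Ideal.iInf_pow_eq_bot_of_isLocalRing (Ideal.span {y}) (by
      rw [Ne, Ideal.span_singleton_eq_top]; exact (mem_maximalIdeal _).1 h.mem)
    refine hf ?_
    rw [← Ideal.mem_bot, ← h1, Submodule.mem_iInf]
    intro k
    rw [Ideal.span_singleton_pow]
    exact hcon k
  classical
  obtain ⟨k, hk⟩ : ∃ k, Nat.find hex = k + 1 := by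
    refine Nat.exists_eq_succ_of_ne_zero fun h0 => ?_
    have := Nat.find_spec hex
    rw [h0] at this
    simp at this
  have h2 := Nat.find_spec hex
  rw [hk] at h2
  have h3 : f ∈ Ideal.span {y ^ k} := by
    by_contra hc
    have := Nat.find_min' hex hc
    omega
  obtain ⟨g, rfl⟩ := Ideal.mem_span_singleton.1 h3
  refine ⟨k, g, fun hg => ?_, rfl⟩
  obtain ⟨c, rfl⟩ := Ideal.mem_span_singleton.1 hg
  exact h2 (Ideal.mem_span_singleton.2 ⟨c, by ring⟩)

/-- A nonzero ideal has a parameter of the form `y - z ^ e`. -/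
theorem exists_parameter {I : Ideal R} (hI : I ≠ ⊥) :
    ∃ τ ∈ maximalIdeal R, ∃ N, maximalIdeal R ^ N ≤ I ⊔ Ideal.span {τ} := by
  obtain ⟨f, hfI, hf⟩ := Submodule.exists_mem_ne_zero_of_ne_bot hI
  obtain ⟨i, g, hg, rfl⟩ := h.exists_eq_pow_mul_notMem hf
  obtain ⟨j, u, q, hu, rfl⟩ := h.exists_eq g hg
  -- Modulo τ = y - z^e, the element y^i (z^j u + y q) of I becomes z^(ei+j) (u + z^(e-j) q). The
  -- choice e = j + 1 makes the last factor a unit, so I + (τ) contains a power of z.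
  let e := j + 1
  let τ := y - z ^ e
  have hτ : τ ∈ maximalIdeal R :=
    sub_mem h.mem (Ideal.pow_mem_of_mem _ h.mem_right _ j.succ_pos)
  have hm : maximalIdeal R ≤ Ideal.span {τ} ⊔ Ideal.span {z} := by
    refine h.le.trans (sup_le ?_ le_sup_right)
    rw [Ideal.span_le, Set.singleton_subset_iff]
    exact Submodule.mem_sup.2 ⟨τ, Ideal.mem_span_singleton_self _, z ^ e,
      Ideal.mem_span_singleton.2 (dvd_pow_self _ j.succ_ne_zero), by ring⟩
  refine ⟨τ, hτ, e * i + j, (Ideal.pow_le_sup_span_pow hm _).trans (sup_le le_sup_right ?_)⟩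
  rw [Ideal.span_le, Set.singleton_subset_iff]
  have hu' : IsUnit (u + z * q) := by
    by_contra hc
    have := sub_mem ((mem_maximalIdeal _).2 hc) (Ideal.mul_mem_right q _ h.mem_right)
    rw [add_sub_cancel_right] at this
    exact (mem_nonunits_iff.1 this) hu
  have hmem : z ^ (e * i + j) * (u + z * q) ∈ I ⊔ Ideal.span {τ} := by
    obtain ⟨c, hc⟩ := sub_dvd_pow_sub_pow y (z ^ e) i
    refine Submodule.mem_sup.2 ⟨_, hfI, τ * (-(c * (z ^ j * u + y * q) + z ^ (e * i) * q)),
      Ideal.mul_mem_right _ _ (Ideal.mem_span_singleton_self _), ?_⟩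
    have hc' : y ^ i = z ^ (e * i) + τ * c := by
      rw [← hc, pow_mul]; ring
    rw [hc']
    simp only [τ, e]
    ring
  exact (Ideal.mul_unit_mem_iff_mem _ hu').1 hmem

/-- An ideal of a regular local ring of dimension two that has no embedded components is
principal. -/
theorem isPrincipal {I : Ideal R} {τ : R} (hτ : τ ∈ maximalIdeal R)
    (hI : ∀ f, τ * f ∈ I → f ∈ I) : ∃ f, I = Ideal.span {f} := by
  by_cases hI0 : I = ⊥
  · exact ⟨0, by simp [hI0]⟩
  obtain ⟨f₀, hf₀I, hf₀⟩ := Submodule.exists_mem_ne_zero_of_ne_bot hI0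
  have hex : ∃ k, ∃ f, f ∉ Ideal.span {y} ∧ y ^ k * f ∈ I := by
    obtain ⟨i, g, hg, rfl⟩ := h.exists_eq_pow_mul_notMem hf₀
    exact ⟨i, g, hg, hf₀I⟩
  classical
  obtain ⟨i, hi⟩ : ∃ i, i = Nat.find hex := ⟨_, rfl⟩
  -- y^i, with i minimal, is the common power of y in I, so I = y^i I', and I' contains an element
  -- not divisible by y.
  let I' : Ideal R := Submodule.comap (LinearMap.mulLeft R (y ^ i)) I
  have hI' : ∀ g, g ∈ I' ↔ y ^ i * g ∈ I := fun g => Iff.rfl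
  have hII' : ∀ f ∈ I, ∃ g ∈ I', f = y ^ i * g := by
    intro f hf
    by_cases hf0 : f = 0
    · exact ⟨0, zero_mem _, by simp [hf0]⟩
    obtain ⟨k, g, hg, rfl⟩ := h.exists_eq_pow_mul_notMem hf0
    have hik : i ≤ k := hi ▸ Nat.find_min' hex ⟨g, hg, hf⟩
    obtain ⟨l, rfl⟩ := Nat.exists_eq_add_of_le hik
    refine ⟨y ^ l * g, (hI' _).2 ?_, ?_⟩ <;> rw [← mul_assoc, ← pow_add]
    exact hf
  have hex' : ∃ j, ∃ u q : R, IsUnit u ∧ z ^ j * u + y * q ∈ I' := by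
    obtain ⟨g, hg, hgI⟩ := Nat.find_spec hex
    obtain ⟨j, u, q, hu, rfl⟩ := h.exists_eq g hg
    rw [← hi] at hgI
    exact ⟨j, u, q, hu, hgI⟩
  obtain ⟨j, hj⟩ : ∃ j, j = Nat.find hex' := ⟨_, rfl⟩
  obtain ⟨u, q, hu, hf⟩ := Nat.find_spec hex'
  rw [← hj] at hf
  set f := z ^ j * u + y * q with hfdef
  have hτI' : ∀ k g, τ ^ k * g ∈ I' → g ∈ I' := by
    intro k
    induction k with
    | zero => intro g hg; simpa using hg
    | succ k ih =>
      intro g hg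
      have h2 := (hI' _).1 hg
      refine ih g ((hI' _).2 (hI _ ?_))
      convert h2 using 1
      ring
  -- y is a nonzerodivisor modulo I': if y g ∈ I', then z^j g ∈ I' as f g ∈ I', and τ^j ∈ (y) +
  -- (z^j) gives τ^j g ∈ I', so saturation applies.
  have hy : ∀ g, y * g ∈ I' → g ∈ I' := by
    intro g hg
    have hz : z ^ j * g ∈ I' := by
      have h1 := sub_mem (Ideal.mul_mem_right g _ hf) (Ideal.mul_mem_left _ q hg)
      refine (Ideal.unit_mul_mem_iff_mem _ hu).1 ?_
      convert h1 using 1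
      rw [hfdef]; ring
    refine hτI' j g ?_
    obtain ⟨a, ha, b, hb, hab⟩ := Submodule.mem_sup.1
      (Ideal.pow_le_sup_span_pow h.le j (Ideal.pow_mem_pow hτ j))
    obtain ⟨a, rfl⟩ := Ideal.mem_span_singleton'.1 ha
    obtain ⟨b, rfl⟩ := Ideal.mem_span_singleton'.1 hb
    rw [← hab, add_mul, mul_assoc, mul_assoc]
    exact add_mem (Ideal.mul_mem_left _ _ hg) (Ideal.mul_mem_left _ _ hz)
  -- f has least z-order j in I' modulo y, so any g ∈ I' is a multiple of f plus y d; then d ∈ I',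
  -- whence I' ⊆ (f) + m I' and Nakayama finishes.
  have hle : I' ≤ Ideal.span {f} := by
    refine Submodule.le_of_le_smul_of_le_jacobson_bot (I := maximalIdeal R)
      (IsNoetherian.noetherian I') (IsLocalRing.maximalIdeal_le_jacobson _) fun g hg => ?_
    have key : ∃ c, g - c * f ∈ Ideal.span {y} := by
      by_cases hgy : g ∈ Ideal.span {y}
      · exact ⟨0, by simpa using hgy⟩
      obtain ⟨k, v, p, hv, rfl⟩ := h.exists_eq g hgy
      have hjk : j ≤ k := hj ▸ Nat.find_min' hex' ⟨v, p, hv, hg⟩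
      obtain ⟨l, rfl⟩ := Nat.exists_eq_add_of_le hjk
      obtain ⟨u', hu'⟩ := hu.exists_right_inv
      refine ⟨z ^ l * v * u', Ideal.mem_span_singleton.2 ⟨p - z ^ l * v * u' * q, ?_⟩⟩
      rw [hfdef]
      linear_combination -(z ^ (j + l) * v) * hu'
    obtain ⟨c, hc⟩ := key
    obtain ⟨d, hd⟩ := Ideal.mem_span_singleton.1 hc
    have hdI : d ∈ I' := by
      refine hy d ?_
      rw [← hd]
      exact sub_mem hg (Ideal.mul_mem_left _ _ hf)
    refine Submodule.mem_sup.2 ⟨c * f, Ideal.mul_mem_left _ _ (Ideal.mem_span_singleton_self f),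
      y * d, Ideal.mul_mem_mul h.mem hdI, ?_⟩
    rw [← hd]; ring
  refine ⟨y ^ i * f, le_antisymm (fun g hg => ?_) ?_⟩
  · obtain ⟨g, hg', rfl⟩ := hII' g hg
    exact Ideal.mem_span_singleton.2 (mul_dvd_mul_left _ (Ideal.mem_span_singleton.1 (hle hg')))
  · rw [Ideal.span_le, Set.singleton_subset_iff]
    exact hf

end IsPlaneCoordinates

end Saturated

/-! ### Power series in the plane, and restriction to x = 0. -/

namespace MvPowerSeries

variable {K : Type*} [Field K]

local notation "S₂" => MvPowerSeries (Fin 2) K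

theorem isUnit_iff_notMem_orderIdeal {σ : Type*} {f : MvPowerSeries σ K} :
    IsUnit f ↔ f ∉ orderIdeal σ K 1 := by
  rw [← maximalIdeal_eq_orderIdeal, mem_maximalIdeal, mem_nonunits_iff, not_not]

/-- A nonzero power series in one of the variables is a unit times a power of that variable. -/
theorem exists_eq_X_pow_mul_of_coeff_eq_zero {σ : Type*} {i : σ} {f : MvPowerSeries σ K}
    (hf : f ≠ 0) (h : ∀ n : σ →₀ ℕ, coeff n f ≠ 0 → n = Finsupp.single i (n i)) :
    ∃ (j : ℕ) (u : MvPowerSeries σ K), IsUnit u ∧ f = X i ^ j * u := by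
  classical
  have hex : ∃ j, coeff (Finsupp.single i j) f ≠ 0 := by
    by_contra! hcon
    refine hf (MvPowerSeries.ext fun n => ?_)
    by_contra hn
    exact hn (by rw [h n hn, hcon]; rfl)
  obtain ⟨u, hu⟩ : X i ^ Nat.find hex ∣ f := by
    rw [X_pow_dvd_iff]
    intro n hn
    by_contra hc
    have e := h n hc
    rw [e] at hc
    exact Nat.find_min hex hn hc
  refine ⟨Nat.find hex, u, ?_, hu⟩
  rw [isUnit_iff_notMem_orderIdeal, mem_orderIdeal_one,
    ← coeff_zero_eq_constantCoeff_apply]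
  have h1 := Nat.find_spec hex
  have h2 := congrArg (coeff (Finsupp.single i (Nat.find hex))) hu
  have h3 := coeff_add_monomial_mul (Finsupp.single i (Nat.find hex)) 0 u (1 : K)
  rw [add_zero, one_mul] at h3
  rw [X_pow_eq, h3] at h2
  rwa [h2] at h1

theorem isPlaneCoordinates : IsPlaneCoordinates (X 0 : S₂) (X 1) where
  mem := by rw [maximalIdeal_eq_orderIdeal]; exact X_mem_orderIdeal_one _
  mem_right := by rw [maximalIdeal_eq_orderIdeal]; exact X_mem_orderIdeal_one _
  le := by
    rw [maximalIdeal_eq_orderIdeal]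
    intro f hf
    obtain ⟨a, -, rfl⟩ := exists_eq_sum_X_mul (k := 0) hf
    rw [Fin.sum_univ_two]
    exact Submodule.add_mem_sup (Ideal.mem_span_singleton.2 ⟨_, rfl⟩)
      (Ideal.mem_span_singleton.2 ⟨_, rfl⟩)
  exists_eq f hf := by
    -- g is f at X 0 = 0, a nonzero series in X 1 alone.
    let g : S₂ := fun n => if n 0 = 0 then coeff n f else 0
    have hg : ∀ n, coeff n g = if n 0 = 0 then coeff n f else 0 := fun n => rfl
    obtain ⟨q, hq⟩ : X 0 ∣ f - g := by
      rw [X_dvd_iff]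
      intro n hn
      rw [map_sub, hg, if_pos hn, sub_self]
    have hg0 : g ≠ 0 := by
      rintro h0
      refine hf (Ideal.mem_span_singleton.2 ⟨q, ?_⟩)
      rw [← hq, h0, sub_zero]
    obtain ⟨j, u, hu, hgu⟩ := exists_eq_X_pow_mul_of_coeff_eq_zero (i := 1) hg0 fun n hn => by
      rw [hg] at hn
      have hn0 : n 0 = 0 := by
        by_contra hc
        rw [if_neg hc] at hn
        exact hn rfl
      ext i
      fin_cases i
      · simp [hn0]
      · simp
    exact ⟨j, u, q, hu, by rw [← hgu, ← hq]; ring⟩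

theorem X_dvd_iff_killCompl_eq_zero {σ τ : Type*} {e : τ ↪ σ} {s : σ}
    (he : ∀ i, i ∈ Set.range e ↔ i ≠ s) {f : MvPowerSeries σ K} :
    X s ∣ f ↔ killCompl e f = 0 := by
  rw [X_dvd_iff]
  constructor
  · intro h
    ext x
    rw [coeff_killCompl, h _ (Finsupp.embDomain_of_notMem_range _ _ _ fun hs => (he s).1 hs rfl),
      map_zero]
  · intro h m hm
    have hs : (m.support : Set σ) ⊆ Set.range e := by
      intro i hi
      rw [he]
      rintro rfl
      exact (Finsupp.mem_support_iff.1 hi) hm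
    rw [← Finsupp.embDomain_comapDomain hs, ← coeff_killCompl, h, map_zero]

/-- X 1 generates the kernel of setting X 1 = 0, whose target is a domain. -/
theorem X_one_prime : Prime (X 1 : S₂) := by
  let e : Fin 1 ↪ Fin 2 := ⟨fun _ => 0, fun _ _ _ => Subsingleton.elim _ _⟩
  have he : ∀ f : S₂, X 1 ∣ f ↔ killCompl e f = 0 := fun f =>
    X_dvd_iff_killCompl_eq_zero fun i => by
      constructor
      · rintro ⟨j, rfl⟩
        change (0 : Fin 2) ≠ 1
        decide
      · intro hi
        refine ⟨0, ?_⟩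
        change 0 = i
        omega
  refine ⟨fun h => ?_, fun hu => ?_, fun f g hfg => ?_⟩
  · have := congrArg (coeff (Finsupp.single 1 1)) h
    rw [coeff_index_single_self_X] at this
    simp at this
  · exact isUnit_iff_notMem_orderIdeal.1 hu (X_mem_orderIdeal_one _)
  · rw [he, map_mul] at hfg
    rw [he, he]
    exact mul_eq_zero.1 hfg

end MvPowerSeries

namespace MvPowerSeries

variable {K : Type*} [Field K]

local notation "S₂" => MvPowerSeries (Fin 2) K
local notation "S" => MvPowerSeries (Fin 3) K

/-- Restriction of power series to the plane `x = 0`. -/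
noncomputable def restrictPlane : S →ₐ[K] S₂ := killCompl (Fin.succEmb 2)

theorem restrictPlane_rename (f : S₂) : restrictPlane (rename Fin.succ f) = f :=
  killCompl_rename_app (e := Fin.succEmb 2) f

theorem restrictPlane_eq_zero_iff (f : S) : restrictPlane f = 0 ↔ X 0 ∣ f := by
  refine (X_dvd_iff_killCompl_eq_zero (e := Fin.succEmb 2) fun i => ?_).symm
  constructor
  · rintro ⟨j, rfl⟩
    exact Fin.succ_ne_zero j
  · intro hi
    exact ⟨i.pred hi, Fin.succ_pred i hi⟩

theorem X_dvd_sub_rename (f : S) : X 0 ∣ f - rename Fin.succ (restrictPlane f) := by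
  rw [← restrictPlane_eq_zero_iff, map_sub, restrictPlane_rename, sub_self]

theorem restrictPlane_mem {f : S} {k : ℕ} (hf : f ∈ orderIdeal (Fin 3) K k) :
    restrictPlane f ∈ orderIdeal (Fin 2) K k := by
  rw [mem_orderIdeal] at hf ⊢
  intro v hv
  rw [restrictPlane, coeff_killCompl]
  refine hf _ ?_
  rwa [Finsupp.embDomain_eq_mapDomain, Finsupp.degree_mapDomain]

theorem restrictPlane_X_two : restrictPlane (X 2 : S) = X 1 :=
  killCompl_X (e := Fin.succEmb 2) 1

theorem mem_iff_rename_mem {I : Ideal S} (h0 : X 0 ∈ I) (f : S) :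
    rename Fin.succ (restrictPlane f) ∈ I ↔ f ∈ I := by
  obtain ⟨c, hc⟩ := X_dvd_sub_rename f
  have h : f - rename Fin.succ (restrictPlane f) ∈ I := hc ▸ Ideal.mul_mem_right _ _ h0
  exact ⟨fun h' => by simpa using add_mem h h', fun h' => by simpa using sub_mem h' h⟩

/-- An ideal containing `x`, modulo which all parameters are nonzerodivisors, is generated by `x`
and one further series in the other variables. -/
theorem exists_eq_span_pair {I : Ideal S} (h0 : X 0 ∈ I)
    (h : ∀ (τ f : S) (N : ℕ), orderIdeal (Fin 3) K N ≤ I ⊔ Ideal.span {τ} → τ * f ∈ I → f ∈ I) :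
    ∃ f : S₂, I = Ideal.span {X 0, rename Fin.succ f} := by
  let J₀ : Ideal S₂ := I.comap (rename Fin.succ : S₂ →ₐ[K] S)
  obtain ⟨f, hf⟩ : ∃ f, J₀ = Ideal.span {f} := by
    by_cases hJ₀ : J₀ = ⊥
    · exact ⟨0, by simp [hJ₀]⟩
    obtain ⟨τ, hτ, N, hN⟩ := isPlaneCoordinates.exists_parameter hJ₀
    -- A parameter of J₀ in the plane is a parameter of I in space, because x ∈ I; so saturation of
    -- I passes to J₀.
    refine isPlaneCoordinates.isPrincipal hτ fun g hg => ?_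
    rw [Ideal.mem_comap, map_mul] at hg
    refine h (rename Fin.succ τ) _ N (fun f hf => ?_) hg
    have h1 := restrictPlane_mem hf
    rw [orderIdeal_eq_pow] at h1
    obtain ⟨a, ha, b, hb, hab⟩ := Submodule.mem_sup.1 (hN h1)
    obtain ⟨b, rfl⟩ := Ideal.mem_span_singleton'.1 hb
    rw [← mem_iff_rename_mem (Ideal.mem_sup_left h0), ← hab, map_add, map_mul]
    exact Submodule.add_mem_sup ha (Ideal.mem_span_singleton'.2 ⟨_, rfl⟩)
  refine ⟨f, le_antisymm (fun g hg => ?_) ?_⟩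
  · rw [← mem_iff_rename_mem h0] at hg
    have h1 : restrictPlane g ∈ J₀ := hg
    rw [hf] at h1
    obtain ⟨c, hc⟩ := Ideal.mem_span_singleton.1 h1
    obtain ⟨d, hd⟩ := X_dvd_sub_rename g
    refine Ideal.mem_span_pair.2 ⟨d, rename Fin.succ c, ?_⟩
    rw [sub_eq_iff_eq_add] at hd
    rw [hd, hc, map_mul]
    ring
  · rw [Ideal.span_le]
    rintro _ (rfl | rfl)
    · exact h0
    · have : f ∈ J₀ := hf ▸ Ideal.mem_span_singleton_self f
      exact this

end MvPowerSeries

/-! ### Reducedness excludes the completed ideal (x, z^k). -/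

namespace DualCoordinates

variable {K O : Type*} [Field K] [CharZero K] [CommRing O] [IsLocalRing O] [Algebra K O]
  (x : DualCoordinates (Fin 3) K O) {J : Ideal O} (hJ : IsCurveIdeal J)

open MvPowerSeries

section

variable {φ : MvPowerSeries (Fin 3) K ≃ₐ[K] MvPowerSeries (Fin 3) K} (hφ : ∀ i, φ (X i) - X i ∈ orderIdeal (Fin 3) K 2)
  (h0 : x.t 0 ∈ J) (hline : ∀ f ∈ J, ∃ r : K, f - r • x.t 0 ∈ maximalIdeal O ^ 2)

include hφ hline in
-- Completion and a change of coordinates tangent to the identity affect linear parts of elements of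
-- J only by order two, so these still lie on one line.
theorem exists_smul_sub_mem_of_mem {f : MvPowerSeries (Fin 3) K} (hf : φ f ∈ J.map x.taylor) :
    ∃ r : K, f - r • X 0 ∈ orderIdeal (Fin 3) K 2 := by
  obtain ⟨a, ha, h⟩ := x.exists_mem_sub_taylor_mem hf 2
  obtain ⟨r, hr⟩ := hline a ha
  refine ⟨r, mem_orderIdeal_of_algHom_mem (φ := (φ : MvPowerSeries (Fin 3) K →ₐ[K] MvPowerSeries (Fin 3) K)) hφ ?_⟩
  rw [← x.taylor_mem_iff, map_sub, map_smul, x.taylor_t] at hr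
  have h2 := smul_mem_orderIdeal r (hφ 0)
  have e : φ (f - r • X 0) =
      (φ f - x.taylor a) + (x.taylor a - r • X 0) - r • (φ (X 0) - X 0) := by
    rw [map_sub, map_smul, smul_sub]; ring
  change φ (f - r • X 0) ∈ _
  rw [e]
  exact sub_mem (add_mem h hr) h2

theorem X_notMem_orderIdeal_two (i : Fin 3) : (X i : MvPowerSeries (Fin 3) K) ∉ orderIdeal (Fin 3) K 2 := by
  intro h
  have := mem_orderIdeal.1 h (Finsupp.single i 1) (by simp)
  rw [coeff_index_single_self_X] at this
  exact one_ne_zero this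

theorem X_zero_sub_X_two_notMem (r : K) : (X 2 - r • X 0 : MvPowerSeries (Fin 3) K) ∉ orderIdeal (Fin 3) K 2 := by
  intro h
  have := mem_orderIdeal.1 h (Finsupp.single 2 1) (by simp)
  rw [map_sub, coeff_index_single_self_X, LinearMap.map_smul, coeff_index_single_X] at this
  simp at this

include hJ hφ h0 hline in
/-- The completed ideal of a reduced curve is not of the form `(x, z ^ k)` with `k ≥ 2`. -/
theorem comap_ne_span_pow {k : ℕ} :
    (J.map x.taylor).comap (φ : MvPowerSeries (Fin 3) K →ₐ[K] MvPowerSeries (Fin 3) K) ≠ Ideal.span {X 0, X 2 ^ k} := by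
  intro hI
  have hsm := fun f => x.exists_smul_sub_mem_of_mem (f := f) hφ hline
  have hX2 : φ (X 2 ^ k) ∈ J.map x.taylor := by
    have : (X 2 ^ k : MvPowerSeries (Fin 3) K) ∈ (J.map x.taylor).comap (φ : MvPowerSeries (Fin 3) K →ₐ[K] MvPowerSeries (Fin 3) K) := by
      rw [hI]; exact Ideal.subset_span (by simp)
    exact this
  have hX0 : (X 0 : MvPowerSeries (Fin 3) K) ∈ J.map x.taylor := by
    rw [← x.taylor_t]; exact Ideal.mem_map_of_mem _ h0
  -- For k = 0 or 1 the linear-part condition would fail on 1 or on X 2.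
  have hk : 2 ≤ k := by
    obtain ⟨r, hr⟩ := hsm _ hX2
    by_contra hlt
    obtain rfl | rfl : k = 0 ∨ k = 1 := by omega
    · have := mem_orderIdeal.1 hr 0 (by simp)
      rw [map_sub, LinearMap.map_smul, coeff_zero_X, pow_zero, coeff_zero_one] at this
      simp at this
    · rw [pow_one] at hr
      exact X_zero_sub_X_two_notMem r hr
  have hφ1 : ∀ i, φ (X i) ∈ orderIdeal (Fin 3) K 1 :=
    map_X_mem_of_sub_mem (φ := (φ : MvPowerSeries (Fin 3) K →ₐ[K] MvPowerSeries (Fin 3) K)) hφ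
  obtain ⟨w, hw⟩ : ∃ w, w = φ (X 2) := ⟨_, rfl⟩
  rw [map_pow, ← hw] at hX2
  have hw2 : ∀ c : MvPowerSeries (Fin 3) K, c * w ^ k ∈ orderIdeal (Fin 3) K 2 := fun c =>
    Ideal.mul_mem_left _ _ (orderIdeal_antitone hk (pow_mem_orderIdeal (hw ▸ hφ1 2) k))
  have hpair : ∀ g ∈ J.map x.taylor, ∃ c d, g = c * φ (X 0) + d * w ^ k := by
    intro g hg
    have : φ.symm g ∈ (J.map x.taylor).comap (φ : MvPowerSeries (Fin 3) K →ₐ[K] MvPowerSeries (Fin 3) K) := by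
      rw [Ideal.mem_comap]
      change φ (φ.symm g) ∈ _
      rwa [AlgEquiv.apply_symm_apply]
    rw [hI] at this
    obtain ⟨c, d, hcd⟩ := Ideal.mem_span_pair.1 this
    refine ⟨φ c, φ d, ?_⟩
    rw [hw, ← map_pow, ← map_mul, ← map_mul, ← map_add, hcd, AlgEquiv.apply_symm_apply]
  -- Replace the generator φ (X 0) by X 0 itself: they differ by a unit modulo w^k. The gain is that
  -- ∂_2 kills X 0.
  have hpair' : ∀ g ∈ J.map x.taylor, ∃ c d, g = c * X 0 + d * w ^ k := by
    obtain ⟨α, β, hαβ⟩ := hpair _ hX0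
    have hα : IsUnit α := by
      rw [isUnit_iff_notMem_orderIdeal]
      intro hα
      refine X_notMem_orderIdeal_two (K := K) 0 ?_
      rw [hαβ]
      exact add_mem (mul_mem_orderIdeal hα (hφ1 0)) (hw2 β)
    obtain ⟨α', hα'⟩ := hα.exists_left_inv
    intro g hg
    obtain ⟨c, d, rfl⟩ := hpair g hg
    refine ⟨c * α', d - c * α' * β, ?_⟩
    linear_combination (-(c * φ (X 0))) * hα' - c * α' * hαβ
  -- If a = c X 0 + d w^k in the completion, then ∂_2 a is a multiple of w^(k-1) modulo Ĵ. Its k-th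
  -- power is in Ĵ because (k-1)k ≥ k, so (d 2 a)^k ∈ J, and J is radical. This avoids proving that
  -- completion preserves reducedness.
  have hd : ∀ a ∈ J, x.d 2 a ∈ J := by
    intro a ha
    refine hJ.isRadical ⟨k, (x.taylor_mem_map_iff hJ).1 ?_⟩
    obtain ⟨c, d, hcd⟩ := hpair' _ (Ideal.mem_map_of_mem _ ha)
    have hd1 : x.taylor (x.d 2 a) = (pderiv K 2 c * X 0 + pderiv K 2 d * w ^ k) +
        (d * (k : MvPowerSeries (Fin 3) K) * pderiv K 2 w) * w ^ (k - 1) := by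
      rw [x.taylor_d, hcd, map_add, Derivation.leibniz, Derivation.leibniz, Derivation.leibniz_pow,
        pderiv_X, Pi.single_eq_of_ne (by decide)]
      simp only [smul_eq_mul, nsmul_eq_mul]
      ring
    rw [map_pow, hd1]
    obtain ⟨y, hy⟩ := sub_dvd_pow_sub_pow ((pderiv K 2 c * X 0 + pderiv K 2 d * w ^ k) +
        (d * (k : MvPowerSeries (Fin 3) K) * pderiv K 2 w) * w ^ (k - 1)) ((d * (k : MvPowerSeries (Fin 3) K) * pderiv K 2 w) * w ^ (k - 1)) k
    rw [sub_eq_iff_eq_add, add_sub_cancel_right] at hy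
    rw [hy, mul_pow, ← pow_mul]
    refine add_mem (Ideal.mul_mem_right _ _ (add_mem (Ideal.mul_mem_left _ _ hX0)
      (Ideal.mul_mem_left _ _ hX2))) (Ideal.mul_mem_left _ _ ?_)
    obtain ⟨l, hl⟩ : ∃ l, (k - 1) * k = k + l := by
      obtain ⟨m, rfl⟩ := Nat.exists_eq_add_of_le hk
      refine ⟨m * (2 + m), ?_⟩
      rw [show 2 + m - 1 = 1 + m by omega]
      ring
    rw [hl, pow_add]
    exact Ideal.mul_mem_right _ _ hX2
  have hstab : ∀ g ∈ J.map x.taylor, pderiv K 2 g ∈ J.map x.taylor := by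
    intro g hg
    induction hg using Submodule.span_induction with
    | mem g hg =>
      obtain ⟨a, ha, rfl⟩ := hg
      change pderiv K 2 (x.taylor a) ∈ _
      rw [← x.taylor_d]
      exact Ideal.mem_map_of_mem _ (hd a ha)
    | zero => rw [map_zero]; exact zero_mem _
    | add g g' _ _ h h' => rw [map_add]; exact add_mem h h'
    | smul c g hg h =>
      rw [smul_eq_mul, Derivation.leibniz, smul_eq_mul, smul_eq_mul]
      exact add_mem (Ideal.mul_mem_left _ _ h) (Ideal.mul_mem_right _ _ hg)
  -- Adjoining X 1 keeps the ideal proper and stable under ∂_2, and puts a power of X 2 in it, which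
  -- `Derivation.pow_notMem` forbids since ∂_2 X 2 = 1.
  let L : Ideal (MvPowerSeries (Fin 3) K) := J.map x.taylor ⊔ Ideal.span {X 1}
  have hL1 : (X 1 : MvPowerSeries (Fin 3) K) ∈ L := Ideal.mem_sup_right (Ideal.mem_span_singleton_self _)
  have hLstab : ∀ g ∈ L, pderiv K 2 g ∈ L := by
    intro g hg
    obtain ⟨a, ha, b, hb, rfl⟩ := Submodule.mem_sup.1 hg
    obtain ⟨b, rfl⟩ := Ideal.mem_span_singleton'.1 hb
    rw [map_add, Derivation.leibniz, pderiv_X, Pi.single_eq_of_ne (by decide), smul_zero, zero_add]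
    exact add_mem (Ideal.mem_sup_left (hstab a ha)) (Ideal.mul_mem_right _ _ hL1)
  have hLtop : L ≠ ⊤ := by
    intro h
    have hle : L ≤ orderIdeal (Fin 3) K 1 := by
      refine sup_le ?_ ?_
      · intro g hg
        obtain ⟨c, d, rfl⟩ := hpair' g hg
        exact add_mem (Ideal.mul_mem_left _ _ (X_mem_orderIdeal_one _))
          (orderIdeal_antitone one_le_two (hw2 d))
      · rw [Ideal.span_le, Set.singleton_subset_iff]
        exact X_mem_orderIdeal_one _
    rw [h, ← maximalIdeal_eq_orderIdeal] at hle
    exact (maximalIdeal.isMaximal (MvPowerSeries (Fin 3) K)).ne_top (top_le_iff.1 hle)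
  -- Modulo X 0 and X 1, w is a unit times X 2.
  have hX2k : (X 2 : MvPowerSeries (Fin 3) K) ^ k ∈ L := by
    obtain ⟨g, hg1, hg⟩ := exists_eq_sum_X_mul (k := 1) (hφ 2)
    rw [Fin.sum_univ_three, ← hw] at hg
    have hu : IsUnit (1 + g 2) := by
      rw [isUnit_iff_notMem_orderIdeal]
      intro h
      have := sub_mem h (hg1 2)
      rw [add_sub_cancel_right, mem_orderIdeal_one, map_one] at this
      exact one_ne_zero this
    obtain ⟨y, hy⟩ := sub_dvd_pow_sub_pow (X 2 * (1 + g 2)) w k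
    have h1 : (X 2 * (1 + g 2)) ^ k ∈ L := by
      rw [sub_eq_iff_eq_add] at hy
      rw [hy]
      refine add_mem (Ideal.mul_mem_right _ _ ?_) (Ideal.mem_sup_left hX2)
      have e : X 2 * (1 + g 2) - w = -(X 0 * g 0 + X 1 * g 1) := by
        linear_combination -hg
      rw [e]
      exact neg_mem (add_mem (Ideal.mul_mem_right _ _ (Ideal.mem_sup_left hX0))
        (Ideal.mul_mem_right _ _ hL1))
    rw [mul_pow] at h1
    exact (Ideal.mul_unit_mem_iff_mem _ (hu.pow k)).1 h1
  exact (pderiv K (2 : Fin 3)).pow_notMem hLstab hLtop (b := X 2) (by simp) k hX2k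

end

end DualCoordinates

open PoissonTriples in
theorem PoissonBracket.eq_bivectorBracket {K : Type*} [Field K]
    (P : PoissonBracket K (MvPowerSeries (Fin 3) K)) {r : MvPowerSeries (Fin 3) K}
    (h01 : P.ham (MvPowerSeries.X 0) (MvPowerSeries.X 1) = r)
    (h02 : P.ham (MvPowerSeries.X 0) (MvPowerSeries.X 2) = 0)
    (h12 : P.ham (MvPowerSeries.X 1) (MvPowerSeries.X 2) = 0) (f g : MvPowerSeries (Fin 3) K) :
    P.ham f g = bivectorBracket r 0 1 f g := by
  have h0 : ∀ g, P.ham (MvPowerSeries.X 0) g = r * MvPowerSeries.pderiv K 1 g := by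
    intro g
    rw [MvPowerSeries.derivation_eq_sum_pderiv, Fin.sum_univ_three, P.self, h01, h02]
    ring
  have h1 : ∀ g, P.ham (MvPowerSeries.X 1) g = -(r * MvPowerSeries.pderiv K 0 g) := by
    intro g
    rw [MvPowerSeries.derivation_eq_sum_pderiv, Fin.sum_univ_three, P.self,
      P.skew (MvPowerSeries.X 1) (MvPowerSeries.X 0), h01, h12]
    ring
  have h2 : ∀ g, P.ham (MvPowerSeries.X 2) g = 0 := by
    intro g
    rw [MvPowerSeries.derivation_eq_sum_pderiv, Fin.sum_univ_three, P.self,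
      P.skew (MvPowerSeries.X 2) (MvPowerSeries.X 0), h02,
      P.skew (MvPowerSeries.X 2) (MvPowerSeries.X 1), h12]
    ring
  rw [MvPowerSeries.derivation_eq_sum_pderiv, Fin.sum_univ_three, P.skew f, P.skew f, P.skew f,
    h0, h1, h2, bivectorBracket]
  ring

/-! ### The normal form in a local ring with coordinates. -/

namespace DualCoordinates

variable {K O : Type*} [Field K] [CharZero K] [CommRing O] [IsLocalRing O] [Algebra K O]
  (x : DualCoordinates (Fin 3) K O) {J : Ideal O} (hJ : IsCurveIdeal J)
  (B : PoissonBracket K O) (hB : ∀ a, ∀ b ∈ J, B.ham a b ∈ J)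

open MvPowerSeries PoissonTriples

include x hJ hB

/-- The normal form of a Poisson bracket and a Poisson curve in three variables at a singular point
of the curve at which the linearization of the bracket is not two-step nilpotent. -/
theorem exists_normal_form (hsing : ¬ IsRegularLocalRing (O ⧸ J)) {a b c : O}
    (h : B.ham c (B.ham a b) ∉ maximalIdeal O ^ 2) :
    ∃ (e : MvPowerSeries (Fin 3) K ≃+* AdicCompletion (maximalIdeal O) O)
      (f : MvPowerSeries (Fin 2) K),
      (∀ r : K, e (C r) = algebraMap O _ (algebraMap K O r)) ∧
      (∀ a b : O, algebraMap O (AdicCompletion (maximalIdeal O) O) (B.ham a b) =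
        e (bivectorBracket (X 0) 0 1 (e.symm (algebraMap O _ a)) (e.symm (algebraMap O _ b)))) ∧
      J.map (algebraMap O (AdicCompletion (maximalIdeal O) O)) =
        (Ideal.span {X 0, rename Fin.succ f}).map e := by
  obtain ⟨x, h0, hline, h01, h02, h12⟩ := x.exists_adapted hJ B hB hsing h
  have hmem := hJ.ham_mem x.exists_const x.maximalIdeal_fg B hB
  obtain ⟨φ, hφ, G, hG0, hG1, r01, r02, r12⟩ := exists_formal_normal_form (x.taylorBracket B)
    (by rw [← x.taylor_t, ← x.taylor_t, taylorBracket_taylor, ← map_sub, taylor_mem_iff]; exact h01)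
    (by rw [← x.taylor_t, ← x.taylor_t, taylorBracket_taylor, taylor_mem_iff]; exact h02)
    (by rw [← x.taylor_t, ← x.taylor_t, taylorBracket_taylor, taylor_mem_iff]; exact h12)
  let I : Ideal (MvPowerSeries (Fin 3) K) :=
    (J.map x.taylor).comap (φ : MvPowerSeries (Fin 3) K →ₐ[K] MvPowerSeries (Fin 3) K)
  have hI : ∀ f, f ∈ I ↔ φ f ∈ J.map x.taylor := fun f => Iff.rfl
  -- The extended bracket is a combination of brackets of coordinates, which lie in J.
  have hbr : ∀ f g, ((x.taylorBracket B).comap φ).ham f g ∈ I := by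
    intro f g
    rw [hI, PoissonBracket.comap_ham, AlgEquiv.apply_symm_apply]
    change x.taylorHam B _ _ ∈ _
    rw [taylorHam_apply]
    exact sum_mem fun j _ => Ideal.mul_mem_right _ _
      (sum_mem fun i _ => Ideal.mul_mem_right _ _ (Ideal.mem_map_of_mem _ (hmem _ _)))
  have hX0 : X 0 ∈ I := r01 ▸ hbr _ _
  obtain ⟨f, hf⟩ := exists_eq_span_pair hX0 fun τ f N hN hτf => by
    rw [hI, map_mul] at hτf
    refine x.mem_map_taylor_of_mul_mem hJ (N := N) (fun g hg => ?_) hτf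
    have hg' : φ.symm g ∈ orderIdeal (Fin 3) K N :=
      mem_orderIdeal_of_algHom_mem
        (φ := (φ : MvPowerSeries (Fin 3) K →ₐ[K] MvPowerSeries (Fin 3) K)) hφ (by
          change φ (φ.symm g) ∈ _
          rwa [AlgEquiv.apply_symm_apply])
    obtain ⟨p, hp, q, hq, hpq⟩ := Submodule.mem_sup.1 (hN hg')
    obtain ⟨q, rfl⟩ := Ideal.mem_span_singleton'.1 hq
    rw [← φ.apply_symm_apply g, ← hpq, map_add, map_mul]
    exact Submodule.add_mem_sup hp (Ideal.mem_span_singleton'.2 ⟨_, rfl⟩)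
  -- A nonzero G is z^l times a unit, so z^l ∈ I = (x, f).
  have hG : G = 0 := by
    by_contra hGne
    obtain ⟨l, u, hu, hGu⟩ := exists_eq_X_pow_mul_of_coeff_eq_zero (i := 2) hGne fun n hn => by
      have n0 : n 0 = 0 := by
        by_contra hc
        exact hn (pderiv_eq_zero_iff.1 hG0 n hc)
      have n1 : n 1 = 0 := by
        by_contra hc
        exact hn (pderiv_eq_zero_iff.1 hG1 n hc)
      ext i
      fin_cases i
      · simp [n0]
      · simp [n1]
      · simp
    have hGI : X 2 ^ l ∈ I := by
      rw [← Ideal.mul_unit_mem_iff_mem I hu, ← hGu, ← r12]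
      exact hbr _ _
    rw [hf] at hGI
    obtain ⟨p, q, hpq⟩ := Ideal.mem_span_pair.1 hGI
    -- Set x = 0 in z^l = p x + q f; z is X 1 in the plane. As z is prime, f is z^k up to a unit, so
    -- I = (x, z^k), which is excluded.
    have hdvd : f ∣ X 1 ^ l := by
      have h3 := congrArg restrictPlane hpq
      rw [map_add, map_mul, map_mul, (restrictPlane_eq_zero_iff (X 0)).2 dvd_rfl,
        restrictPlane_rename, map_pow, restrictPlane_X_two, mul_zero, zero_add] at h3
      exact ⟨restrictPlane q, by rw [← h3, mul_comm]⟩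
    obtain ⟨k, -, v, hv⟩ := (dvd_prime_pow X_one_prime l).1 hdvd
    refine x.comap_ne_span_pow hJ hφ h0 hline (k := k) (hf.trans ?_)
    have e2 : (X 2 ^ k : MvPowerSeries (Fin 3) K) = rename Fin.succ (X 1 ^ k) := by
      rw [map_pow, rename_X]; rfl
    rw [e2, ← hv, map_mul, Ideal.span_insert, Ideal.span_insert,
      Ideal.span_singleton_mul_right_unit (v.isUnit.map _)]
  rw [hG] at r12
  refine ⟨φ.toRingEquiv.trans x.equiv, f, fun r => ?_, fun a b => ?_, ?_⟩
  · have h1 := x.equiv_taylor (algebraMap K O r)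
    rw [AlgHom.commutes] at h1
    rw [← h1, RingEquiv.trans_apply]
    congr 1
    exact φ.commutes r
  · have hsymm : ∀ a : O, (φ.toRingEquiv.trans x.equiv).symm (algebraMap O _ a) =
        φ.symm (x.taylor a) := fun a => rfl
    rw [hsymm, hsymm, ← PoissonBracket.eq_bivectorBracket _ r01 r02 r12, PoissonBracket.comap_ham,
      RingEquiv.trans_apply, AlgEquiv.apply_symm_apply, AlgEquiv.apply_symm_apply,
      taylorBracket_taylor, ← x.equiv_taylor]
    congr 1
    exact (φ.apply_symm_apply _).symm
  · rw [← hf]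
    apply le_antisymm
    · rw [Ideal.map_le_iff_le_comap]
      intro a ha
      have h1 : φ.symm (x.taylor a) ∈ I := by
        rw [hI, AlgEquiv.apply_symm_apply]
        exact Ideal.mem_map_of_mem _ ha
      have h2 := Ideal.mem_map_of_mem (φ.toRingEquiv.trans x.equiv) h1
      rw [Ideal.mem_comap, ← x.equiv_taylor]
      convert h2 using 1
      rw [RingEquiv.trans_apply]
      congr 1
      exact (φ.apply_symm_apply _).symm
    · rw [Ideal.map_le_iff_le_comap]
      intro g hg
      rw [hI] at hg
      have hle : J.map x.taylor ≤
          (J.map (algebraMap O (AdicCompletion (maximalIdeal O) O))).comap x.equiv := by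
        rw [Ideal.map_le_iff_le_comap]
        intro a ha
        rw [Ideal.mem_comap, Ideal.mem_comap, x.equiv_taylor]
        exact Ideal.mem_map_of_mem _ ha
      exact hle hg

end DualCoordinates

/-! ### From sheaves to local rings. -/

namespace PoissonTriples

universe v

variable {K : Type v} [Field K] {X : KSpace K}

/-- The local rings of a space over `K` are `K`-algebras. -/
@[reducible]
noncomputable def KSpace.stalkAlgebra (X : KSpace K) (p : X.toLRS) : Algebra K (X.Stalk p) :=
  ((X.germ ⊤ p trivial).comp (X.const ⊤)).toAlgebra

attribute [local instance] KSpace.stalkAlgebra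

theorem KSpace.algebraMap_stalk (p : X.toLRS) (c : K) :
    algebraMap K (X.Stalk p) c = X.germ ⊤ p trivial (X.const ⊤ c) := rfl

theorem KSpace.germ_const {p : X.toLRS} (V : Opens X.toLRS) (hp : p ∈ V) (c : K) :
    X.germ V p hp (X.const V c) = algebraMap K (X.Stalk p) c := by
  rw [KSpace.algebraMap_stalk]
  exact (PoissonStructure.germ_res le_top p hp (X.scalars c)).trans
    (PoissonStructure.germ_res (V := ⊤) le_top p trivial (X.scalars c)).symm

namespace CoherentIdealSheaf

variable (J : CoherentIdealSheaf X)

theorem mem_stalk_iff {p : X.toLRS} {a : X.Stalk p} :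
    a ∈ J.stalk p ↔ ∃ (V : Opens X.toLRS) (hp : p ∈ V), ∃ f ∈ J.ideal V, a = X.germ V p hp f := by
  refine ⟨fun h => ?_, fun h => Ideal.subset_span h⟩
  induction h using Submodule.span_induction with
  | mem a h => exact h
  | zero => exact ⟨⊤, trivial, 0, zero_mem _, by simp⟩
  | add a b _ _ ha hb =>
    obtain ⟨V, hV, f, hf, rfl⟩ := ha
    obtain ⟨W, hW, g, hg, rfl⟩ := hb
    have hVW : p ∈ V ⊓ W := ⟨hV, hW⟩
    refine ⟨V ⊓ W, hVW, X.res inf_le_left f + X.res inf_le_right g,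
      add_mem (J.res_mem _ _ hf) (J.res_mem _ _ hg), ?_⟩
    rw [map_add, PoissonStructure.germ_res, PoissonStructure.germ_res]
  | smul c a _ ha =>
    obtain ⟨V, hV, f, hf, rfl⟩ := ha
    obtain ⟨W, hW, g, rfl⟩ := X.toLRS.presheaf.exists_germ_eq c
    have hVW : p ∈ V ⊓ W := ⟨hV, hW⟩
    refine ⟨V ⊓ W, hVW, X.res inf_le_right g * X.res inf_le_left f,
      Ideal.mul_mem_left _ _ (J.res_mem _ _ hf), ?_⟩
    rw [map_mul, PoissonStructure.germ_res, PoissonStructure.germ_res]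
    rfl

theorem germ_mem_stalk {p : X.toLRS} {V : Opens X.toLRS} (hp : p ∈ V) {f : X.Fun V}
    (hf : f ∈ J.ideal V) : X.germ V p hp f ∈ J.stalk p :=
  J.mem_stalk_iff.2 ⟨V, hp, f, hf, rfl⟩

theorem isRadical_stalk (h : J.IsReduced) (p : X.toLRS) : (J.stalk p).IsRadical := by
  rintro a ⟨n, hn⟩
  obtain ⟨V, hV, f, rfl⟩ := X.toLRS.presheaf.exists_germ_eq a
  obtain ⟨W, hW, g, hg, hfg⟩ := J.mem_stalk_iff.1 hn
  have hfg' : X.germ V p hV (f ^ n) = X.germ W p hW g := by rw [map_pow]; exact hfg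
  obtain ⟨A, hA, iV, iW, e⟩ := X.toLRS.presheaf.germ_eq p hV hW _ _ hfg'
  have e' : X.res iV.le f ^ n = X.res iW.le g := by rw [← map_pow]; exact e
  have h1 : X.res iV.le f ∈ J.ideal A := h A ⟨n, e' ▸ J.res_mem _ _ hg⟩
  have := J.germ_mem_stalk hA h1
  rwa [PoissonStructure.germ_res] at this

theorem isCurveIdeal_stalk (h : J.IsReduced) (hd : J.HasPureDimension 1) {p : X.toLRS}
    (hp : p ∈ J.support) (hcl : IsClosed {p}) : IsCurveIdeal (J.stalk p) where
  isRadical := J.isRadical_stalk h p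
  ne_top := hp
  dim P hP := by rw [hd p hp hcl P hP]; rfl

end CoherentIdealSheaf

namespace PoissonStructure

variable (σ : PoissonStructure X)

/-- The Poisson bracket on a local ring. -/
noncomputable def stalkPoissonBracket (p : X.toLRS) : PoissonBracket K (X.Stalk p) where
  ham a := Derivation.mk'
    { toFun := σ.stalkBracket p a
      map_add' := σ.stalkBracket_add a
      map_smul' := fun c b => by
        have h0 : σ.stalkBracket p a (algebraMap K (X.Stalk p) c) = 0 := by
          obtain ⟨V, hV, f, rfl⟩ := X.toLRS.presheaf.exists_germ_eq a
          rw [← KSpace.germ_const V hV]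
          refine (σ.stalkBracket_germ hV f (X.const V c)).trans ?_
          rw [σ.bracket_skew, σ.const_bracket, neg_zero, map_zero]
        rw [Algebra.smul_def, σ.stalkBracket_mul, h0, zero_mul, zero_add, RingHom.id_apply,
          Algebra.smul_def] }
    (fun b c => by
      change σ.stalkBracket p a (b * c) = b • σ.stalkBracket p a c + c • σ.stalkBracket p a b
      rw [σ.stalkBracket_mul, smul_eq_mul, smul_eq_mul]
      ring)
  self := σ.stalkBracket_self
  skew := σ.stalkBracket_skew
  jacobi := σ.stalkBracket_jacobi

theorem stalkPoissonBracket_apply (p : X.toLRS) (a b : X.Stalk p) :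
    (σ.stalkPoissonBracket p).ham a b = σ.stalkBracket p a b := rfl

theorem stalkBracket_mem {J : CoherentIdealSheaf X} (h : J.IsPoisson σ) {p : X.toLRS}
    (a : X.Stalk p) {b : X.Stalk p} (hb : b ∈ J.stalk p) : σ.stalkBracket p a b ∈ J.stalk p := by
  obtain ⟨V, hV, f, rfl⟩ := X.toLRS.presheaf.exists_germ_eq a
  obtain ⟨W, hW, g, hg, rfl⟩ := J.mem_stalk_iff.1 hb
  have hVW : p ∈ V ⊓ W := ⟨hV, hW⟩
  have h1 := J.germ_mem_stalk hVW
    (h (V ⊓ W) (X.res inf_le_left f) _ (J.res_mem inf_le_right _ hg))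
  rwa [← stalkBracket_germ, germ_res, germ_res] at h1

/-- The hypothesis says that the derived algebra is central. Contrapositively, non-nilpotency yields
one triple with {c,{a,b}} ∉ m², which is all the local argument needs. -/
theorem isNilpotent_linearization {p : X.toLRS} (hσ : σ.VanishesAt p)
    (h : ∀ a b c : X.Stalk p,
      σ.stalkBracket p c (σ.stalkBracket p a b) ∈ maximalIdeal (X.Stalk p) ^ 2) :
    LieRing.IsNilpotent (σ.Linearization p hσ) := by
  refine (LieModule.isNilpotent_iff_int _ _).2 ⟨2, ?_⟩
  rw [LieModule.lowerCentralSeries_succ, LieModule.lowerCentralSeries_succ,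
    LieModule.lowerCentralSeries_zero, eq_bot_iff, LieSubmodule.lie_le_iff]
  have h1 : ⁅(⊤ : LieIdeal ℤ (σ.Linearization p hσ)), (⊤ : LieIdeal ℤ (σ.Linearization p hσ))⁆ ≤
      LieModule.maxTrivSubmodule ℤ (σ.Linearization p hσ) (σ.Linearization p hσ) := by
    rw [LieSubmodule.lie_le_iff]
    intro v _ w _
    rw [LieModule.mem_maxTrivSubmodule]
    intro u
    obtain ⟨a, rfl⟩ := Linearization.diff_surjective hσ v
    obtain ⟨b, rfl⟩ := Linearization.diff_surjective hσ w
    obtain ⟨c, rfl⟩ := Linearization.diff_surjective hσ u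
    rw [Linearization.diff_lie, Linearization.diff_lie, ← map_zero (Linearization.diff hσ),
      Linearization.diff_eq_iff]
    rw [ZeroMemClass.coe_zero, sub_zero]
    exact h a b c
  intro u _ m hm
  rw [(LieModule.mem_maxTrivSubmodule _ _ _ _).1 (h1 hm) u]
  exact zero_mem _

end PoissonStructure

/-- The normal form at a closed point with smooth local ring. -/
theorem PoissonTriple.hasNormalFormAt_of_dualCoordinates [CharZero K] {X : Presentation K}
    (T : PoissonTriple X 1) {p : X.U.toLRS} (hp : T.IsNonNilpotentPoint p) (hcl : IsClosed {p})
    (x : DualCoordinates (Fin 3) K (X.U.Stalk p)) : T.HasNormalFormAt p := by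
  have hJ := T.J.isCurveIdeal_stalk T.reduced T.pureDimension hp.1.1 hcl
  have hB : ∀ a, ∀ b ∈ T.J.stalk p, (T.σ.stalkPoissonBracket p).ham a b ∈ T.J.stalk p :=
    fun a b hb => T.σ.stalkBracket_mem T.poisson a hb
  -- Vanishing of σ at p is proved here, so the quantified condition in `IsNonNilpotentPoint` is not
  -- vacuous.
  have hσ : T.σ.VanishesAt p :=
    hJ.ham_mem_maximalIdeal x.exists_const x.maximalIdeal_fg (T.σ.stalkPoissonBracket p) hB
  obtain ⟨a, b, c, habc⟩ : ∃ a b c : X.U.Stalk p,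
      T.σ.stalkBracket p c (T.σ.stalkBracket p a b) ∉ maximalIdeal (X.U.Stalk p) ^ 2 := by
    by_contra! hcon
    exact hp.2 hσ (T.σ.isNilpotent_linearization hσ hcon)
  obtain ⟨e, f, he, hbr, hid⟩ := x.exists_normal_form hJ (T.σ.stalkPoissonBracket p) hB hp.1.2 habc
  refine ⟨⟨e, he⟩, f, fun V hV g h => ?_, hid⟩
  have := hbr (X.U.germ V p hV g) (X.U.germ V p hV h)
  rw [PoissonStructure.stalkPoissonBracket_apply, PoissonStructure.stalkBracket_germ] at this
  exact this

end PoissonTriples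

/-! ### Coordinates on smooth algebras. -/

/-- In a local ring with residue field `K`, functions whose differentials form a basis of the
Kähler differentials are coordinates. -/
theorem DualCoordinates.exists_of_basis_kaehlerDifferential {σ K O : Type*} [DecidableEq σ]
    [Fintype σ] [Field K] [CommRing O] [IsLocalRing O] [Algebra K O]
    (hc : ∀ a : O, ∃ c : K, a - algebraMap K O c ∈ maximalIdeal O)
    (hfg : (maximalIdeal O).FG) (b : Module.Basis σ O (Ω[O⁄K])) (t : σ → O)
    (ht : ∀ i, t i ∈ maximalIdeal O) (hb : ∀ i, b i = KaehlerDifferential.D K O (t i)) :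
    Nonempty (DualCoordinates σ K O) := by
  let d : σ → Derivation K O O := fun i => (b.coord i).compDer (KaehlerDifferential.D K O)
  have hd : ∀ i j, d i (t j) = if i = j then 1 else 0 := by
    intro i j
    change b.coord i (KaehlerDifferential.D K O (t j)) = _
    rw [← hb, Module.Basis.coord_apply, Module.Basis.repr_self, Finsupp.single_apply]
    simp only [eq_comm]
  have hD : ∀ a, KaehlerDifferential.D K O a = ∑ i, d i a • KaehlerDifferential.D K O (t i) := by
    intro a
    rw [← b.sum_repr (KaehlerDifferential.D K O a)]
    exact Finset.sum_congr rfl fun i _ => by rw [hb]; rfl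
  have huniq : ∀ c : K, algebraMap K O c ∈ maximalIdeal O → c = 0 := by
    intro c hcm
    by_contra h0
    exact (mem_nonunits_iff.1 ((mem_maximalIdeal _).1 hcm)) ((IsUnit.mk0 c h0).map _)
  choose ε hε using hc
  have hε_eq : ∀ a c, a - algebraMap K O c ∈ maximalIdeal O → ε a = c := by
    intro a c h
    rw [← sub_eq_zero]
    refine huniq _ ?_
    convert sub_mem h (hε a) using 1
    rw [map_sub]; ring
  let I := maximalIdeal O ^ 2
  -- Subtracting the value at the point is a derivation into O/m². It factors through the Kähler
  -- differentials, so a ∈ m with all d i a ∈ m lies in m².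
  let δ : Derivation K O (O ⧸ I) := Derivation.mk'
    { toFun := fun a => Ideal.Quotient.mk I (a - algebraMap K O (ε a))
      map_add' := fun a a' => by
        have : ε (a + a') = ε a + ε a' := hε_eq _ _ (by
          convert add_mem (hε a) (hε a') using 1
          rw [map_add]; ring)
        rw [this, ← map_add, map_add]
        congr 1
        ring
      map_smul' := fun c a => by
        have : ε (c • a) = c * ε a := hε_eq _ _ (by
          convert Ideal.mul_mem_left _ (algebraMap K O c) (hε a) using 1
          rw [map_mul, Algebra.smul_def]; ring)
        rw [this, RingHom.id_apply, ← Ideal.Quotient.mkₐ_eq_mk K, ← map_smul]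
        congr 1
        rw [map_mul, smul_sub, Algebra.smul_def, Algebra.smul_def] }
    (fun a a' => by
      have : ε (a * a') = ε a * ε a' := hε_eq _ _ (by
        convert add_mem (Ideal.mul_mem_left _ a (hε a'))
          (Ideal.mul_mem_left _ (algebraMap K O (ε a')) (hε a)) using 1
        rw [map_mul]; ring)
      change Ideal.Quotient.mk I _ = a • Ideal.Quotient.mk I _ + a' • Ideal.Quotient.mk I _
      rw [this, Algebra.smul_def, Algebra.smul_def, Ideal.Quotient.algebraMap_eq, ← map_mul,
        ← map_mul, ← map_add, Ideal.Quotient.eq]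
      have h2 := neg_mem (Ideal.mul_mem_mul (hε a) (hε a'))
      rw [← pow_two] at h2
      convert h2 using 1
      rw [map_mul]; ring)
  have hδ : ∀ a ∈ maximalIdeal O, δ a = Ideal.Quotient.mk I a := by
    intro a ha
    have : ε a = 0 := hε_eq a 0 (by simpa using ha)
    change Ideal.Quotient.mk I (a - algebraMap K O (ε a)) = _
    rw [this, map_zero, sub_zero]
  have hsq : ∀ a ∈ maximalIdeal O, (∀ i, d i a ∈ maximalIdeal O) → a ∈ I := by
    intro a ha hda
    rw [← Ideal.Quotient.eq_zero_iff_mem, ← hδ a ha, ← δ.liftKaehlerDifferential_comp_D, hD,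
      map_sum]
    refine Finset.sum_eq_zero fun i _ => ?_
    rw [map_smul, δ.liftKaehlerDifferential_comp_D, hδ _ (ht i), Algebra.smul_def,
      Ideal.Quotient.algebraMap_eq, ← map_mul, Ideal.Quotient.eq_zero_iff_mem]
    change _ ∈ maximalIdeal O ^ 2
    rw [pow_two]
    exact Ideal.mul_mem_mul (hda i) (ht i)
  refine ⟨⟨t, d, le_antisymm ?_ ?_, hd, fun a => ⟨ε a, hε a⟩⟩⟩
  · refine Submodule.le_of_le_smul_of_le_jacobson_bot (I := maximalIdeal O) hfg
      (IsLocalRing.maximalIdeal_le_jacobson _) fun a ha => ?_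
    have hsum : ∑ i, d i a * t i ∈ Ideal.span (Set.range t) :=
      sum_mem fun i _ => Ideal.mul_mem_left _ _ (Ideal.subset_span ⟨i, rfl⟩)
    have hsum' : ∑ i, d i a * t i ∈ maximalIdeal O :=
      sum_mem fun i _ => Ideal.mul_mem_left _ _ (ht i)
    -- The first-order Taylor remainder a - Σ d i a · t i has all partial derivatives in m, hence
    -- lies in m²; Nakayama then shows that the t i generate m.
    have h := hsq (a - ∑ i, d i a * t i) (sub_mem ha hsum') fun j => by
      rw [map_sub, map_sum]
      have e : ∑ i, d j (d i a * t i) = d j a + ∑ i, t i * d j (d i a) := by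
        simp only [Derivation.leibniz, hd, smul_eq_mul, Finset.sum_add_distrib]
        congr 1
        simp
      rw [e, sub_add_cancel_left]
      exact neg_mem (sum_mem fun i _ => Ideal.mul_mem_right _ _ (ht i))
    change _ ∈ maximalIdeal O ^ 2 at h
    rw [pow_two] at h
    exact Submodule.mem_sup.2 ⟨_, hsum, _, h, by ring⟩
  · rw [Ideal.span_le]
    rintro _ ⟨i, rfl⟩
    exact ht i

/-- In a submersive presentation the variables not used by the Jacobian have differentials forming a
basis; the rank counts them as n. -/
theorem Algebra.IsStandardSmoothOfRelativeDimension.exists_basis {R A : Type*} [CommRing R]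
    [CommRing A] [Algebra R A] [Nontrivial A] (n : ℕ)
    [h : Algebra.IsStandardSmoothOfRelativeDimension n R A] :
    ∃ (a : Fin n → A) (b : Module.Basis (Fin n) A (Ω[A⁄R])),
      ∀ i, b i = KaehlerDifferential.D R A (a i) := by
  obtain ⟨ι, σ, hσ, hι, P, hP⟩ := h.out
  have : Fintype ((Set.range P.map)ᶜ : Set _) := Fintype.ofFinite _
  have hcard : Fintype.card ((Set.range P.map)ᶜ : Set _) = n := by
    have h1 := P.rank_kaehlerDifferential
    rw [rank_eq_card_basis P.basisKaehler, hP] at h1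
    exact_mod_cast h1
  let e : ((Set.range P.map)ᶜ : Set _) ≃ Fin n := Fintype.equivFinOfCardEq hcard
  exact ⟨fun i => P.val (e.symm i), P.basisKaehler.reindex e, fun i => by
    rw [Module.Basis.reindex_apply, P.basisKaehler_apply]⟩

/-- The local ring of a smooth algebra at a closed point has coordinates. -/
theorem DualCoordinates.exists_of_isStandardSmooth {K A O : Type*} [Field K] [IsAlgClosed K]
    [CommRing A] [Algebra K A] (n : ℕ) [h : Algebra.IsStandardSmoothOfRelativeDimension n K A]
    (P : Ideal A) [hP : P.IsMaximal] [CommRing O] [Algebra A O] [Algebra K O]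
    [IsScalarTower K A O] [IsLocalization.AtPrime O P] [IsLocalRing O] :
    Nonempty (DualCoordinates (Fin n) K O) := by
  have hnt : Nontrivial A := ⟨0, 1, fun h01 => hP.ne_top ((Ideal.eq_top_iff_one _).2 (by
    rw [← h01]; exact zero_mem _))⟩
  have hss : Algebra.IsStandardSmooth K A :=
    Algebra.IsStandardSmoothOfRelativeDimension.isStandardSmooth n
  have hft : Algebra.FiniteType K A := inferInstance
  let _ := Ideal.Quotient.field P
  -- Nullstellensatz: over an algebraically closed field the residue field at a maximal ideal is K.
  have hfin : Module.Finite K (A ⧸ P) := finite_of_finite_type_of_isJacobsonRing K (A ⧸ P)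
  have hconst : ∀ a : A, ∃ c : K, a - algebraMap K A c ∈ P := by
    intro a
    obtain ⟨c, hc⟩ := (IsAlgClosed.algebraMap_bijective_of_isIntegral (k := K) (K := A ⧸ P)).2
      (Ideal.Quotient.mk P a)
    refine ⟨c, Ideal.Quotient.eq.1 ?_⟩
    rw [← hc]
    rfl
  have hmax : ∀ a : A, algebraMap A O a ∈ maximalIdeal O ↔ a ∈ P := fun a =>
    IsLocalization.AtPrime.to_map_mem_maximal_iff O P a
  have hN : IsNoetherianRing A := Algebra.FiniteType.isNoetherianRing K A
  have hNO : IsNoetherianRing O := IsLocalization.isNoetherianRing P.primeCompl O hN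
  obtain ⟨a, b, hab⟩ := Algebra.IsStandardSmoothOfRelativeDimension.exists_basis (R := K) (A := A) n
  choose c hc using fun i => hconst (a i)
  refine exists_of_basis_kaehlerDifferential (fun x => ?_) (IsNoetherian.noetherian _)
    (b.ofIsLocalizedModule O P.primeCompl (KaehlerDifferential.map K K A O))
    (fun i => algebraMap A O (a i - algebraMap K A (c i))) (fun i => (hmax _).2 (hc i))
    fun i => ?_
  · obtain ⟨y, s, rfl⟩ := IsLocalization.exists_mk'_eq P.primeCompl x
    obtain ⟨r, hr⟩ := hconst y
    obtain ⟨r', hr'⟩ := hconst s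
    have hr0 : r' ≠ 0 := by
      rintro rfl
      rw [map_zero, sub_zero] at hr'
      exact s.2 hr'
    have hs : IsUnit (algebraMap A O s) := IsLocalization.map_units O s
    refine ⟨r / r', ?_⟩
    rw [← Ideal.unit_mul_mem_iff_mem _ hs, mul_sub, IsLocalization.mk'_spec',
      IsScalarTower.algebraMap_apply K A O, ← map_mul, ← map_sub, hmax]
    have e : y - s * algebraMap K A (r / r') = (y - algebraMap K A r) -
        (s - algebraMap K A r') * algebraMap K A (r / r') := by
      have : algebraMap K A r' * algebraMap K A (r / r') = algebraMap K A r := by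
        rw [← map_mul, mul_div_cancel₀ _ hr0]
      linear_combination -this
    rw [e]
    exact sub_mem hr (Ideal.mul_mem_right _ _ hr')
  · rw [Module.Basis.ofIsLocalizedModule_apply, hab, map_sub, ← IsScalarTower.algebraMap_apply,
      map_sub, Derivation.map_algebraMap, sub_zero]
    exact KaehlerDifferential.map_D _ _ _ _ _

/-- At a proper generization of a point where all components of a reduced subspace have dimension
one, this subspace is a point. -/
theorem Ideal.isRegularLocalRing_of_lt_of_ringKrullDim_eq_one {A Oq Op : Type*} [CommRing A]
    [CommRing Oq] [CommRing Op] [Algebra A Oq] [Algebra A Op] {I p q : Ideal A} [p.IsPrime]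
    [q.IsPrime] [IsLocalization.AtPrime Oq q] [IsLocalization.AtPrime Op p] [IsLocalRing Op]
    (hI : I ≤ p) (hpq : p < q)
    (hdim : ∀ P ∈ (I.map (algebraMap A Oq)).minimalPrimes, ringKrullDim (Oq ⧸ P) = 1)
    (hrad : (I.map (algebraMap A Op)).IsRadical) :
    IsRegularLocalRing (Op ⧸ I.map (algebraMap A Op)) := by
  obtain ⟨p₀, hp₀, hle⟩ := Ideal.exists_minimalPrimes_le hI
  have hp₀p : p₀.IsPrime := hp₀.1.1
  have hpp : p.IsPrime := ‹p.IsPrime›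
  have hqp : q.IsPrime := ‹q.IsPrime›
  have disj : ∀ r : Ideal A, r ≤ q → Disjoint (q.primeCompl : Set A) (r : Set A) := by
    intro r hr
    rw [Set.disjoint_left]
    exact fun x hx hxr => hx (hr hxr)
  have hc : ∀ r : Ideal A, r.IsPrime → r ≤ q → (r.map (algebraMap A Oq)).under A = r :=
    fun r hr hrq => IsLocalization.under_map_of_isPrime_disjoint q.primeCompl Oq hr (disj r hrq)
  have h₀ : (p₀.map (algebraMap A Oq)) ∈ (I.map (algebraMap A Oq)).minimalPrimes := by
    rw [IsLocalization.minimalPrimes_map q.primeCompl Oq]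
    change (p₀.map (algebraMap A Oq)).under A ∈ I.minimalPrimes
    rwa [hc p₀ hp₀p (hle.trans hpq.le)]
  have hpr : (p.map (algebraMap A Oq)).IsPrime :=
    IsLocalization.isPrime_of_isPrime_disjoint q.primeCompl Oq p hpp (disj p hpq.le)
  -- If p₀ < p, then p would already be maximal in O_q because O_q/p₀ has dimension one; but p < q.
  have hp₀eq : p₀ = p := by
    by_contra hne
    have hlt : p₀.map (algebraMap A Oq) < p.map (algebraMap A Oq) := by
      refine lt_of_le_of_ne (Ideal.map_mono hle) fun h => hne ?_
      rw [← hc p₀ hp₀p (hle.trans hpq.le), h, hc p hpp hpq.le]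
    have : (p₀.map (algebraMap A Oq)).IsPrime := h₀.1.1
    have hmax := Ideal.isMaximal_of_lt_of_ringKrullDim_le_one hpr hlt (hdim _ h₀).le
    have hq : (q.map (algebraMap A Oq)).IsPrime :=
      IsLocalization.isPrime_of_isPrime_disjoint q.primeCompl Oq q hqp (disj q le_rfl)
    have heq := hmax.eq_of_le hq.ne_top (Ideal.map_mono hpq.le)
    refine hpq.ne ?_
    rw [← hc p hpp hpq.le, heq, hc q hqp le_rfl]
  subst hp₀eq
  have h1 := IsLocalization.AtPrime.radical_map_of_mem_minimalPrimes Op p₀ I hp₀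
  rw [hrad.radical, IsLocalization.AtPrime.map_eq_maximalIdeal p₀ Op] at h1
  rw [h1]
  let := Ideal.Quotient.field (maximalIdeal Op)
  infer_instance

/-! ### Schemes: singular points of the curve are closed, and closed points have coordinates. -/

namespace PoissonTriples

universe v

/-- Coherence provides finitely many sections that generate every stalk near q. -/
theorem CoherentIdealSheaf.exists_stalk_eq_map {K : Type v} [Field K] {X : KSpace K}
    (J : CoherentIdealSheaf X) (q : X.toLRS) :
    ∃ (W : Opens X.toLRS) (_ : q ∈ W) (I : Ideal (X.Fun W)), ∀ (V : Opens X.toLRS) (h : V ≤ W)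
      (x : X.toLRS) (hx : x ∈ V), J.stalk x = (I.map (X.res h)).map (X.germ V x hx) := by
  obtain ⟨W, hqW, s, hs, hgen⟩ := J.locally_finitely_generated q
  refine ⟨W, hqW, Ideal.span s, fun V h x hx => ?_⟩
  have hcomp : (X.germ V x hx).comp (X.res h) = X.germ W x (h hx) :=
    RingHom.ext fun f => PoissonStructure.germ_res h x hx f
  rw [Ideal.map_map, hcomp, Ideal.map_span]
  apply le_antisymm
  · intro a ha
    obtain ⟨V', hV', g, hg, rfl⟩ := J.mem_stalk_iff.1 ha
    have hx' : x ∈ V' ⊓ W := ⟨hV', h hx⟩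
    have := hgen (V' ⊓ W) inf_le_right _ (J.res_mem inf_le_left _ hg) x hx'
    rwa [PoissonStructure.germ_res] at this
  · rw [Ideal.span_le]
    rintro _ ⟨f, hf, rfl⟩
    exact J.germ_mem_stalk _ (hs f hf)

variable {K : Type v} [Field K] {X : Scheme.{v}} {π : X ⟶ Spec (CommRingCat.of K)}

/-- A coherent ideal sheaf on a scheme is given by ideals of affine open sets. -/
theorem CoherentIdealSheaf.exists_affine (J : CoherentIdealSheaf (schemeSpace X π)) (q : X) :
    ∃ (V : X.Opens) (_ : IsAffineOpen V) (_ : q ∈ V) (I : Ideal Γ(X, V)),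
      ∀ (x : X) (hx : x ∈ V), J.stalk x = I.map (X.presheaf.germ V x hx).hom := by
  obtain ⟨W, hqW, I, hI⟩ := J.exists_stalk_eq_map q
  obtain ⟨V, hV, hqV, hVW⟩ := exists_isAffineOpen_mem_and_subset (X := X) (x := q) (U := W) hqW
  exact ⟨V, hV, hqV, _, hI V hVW⟩

/-- A reduced curve in a scheme of finite type over a field is regular at its generic points. -/
theorem CoherentIdealSheaf.isClosed_of_isSingularAt [CompactSpace X]
    (J : CoherentIdealSheaf (schemeSpace X π)) (hred : J.IsReduced)
    (hdim : J.HasPureDimension 1) {p : X} (hp : J.IsSingularAt p) :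
    IsClosed ({p} : Set X) := by
  have hloc (x : X) : IsLocalRing ((schemeSpace X π).Stalk x) :=
    inferInstanceAs (IsLocalRing (X.presheaf.stalk x))
  -- By quasi-compactness p specializes to a closed point q. If p ≠ q, dimension one at q makes p a
  -- generic point of Y, where Y is regular.
  obtain ⟨q, hq, hqc⟩ := IsClosed.exists_closed_singleton (isClosed_closure (s := ({p} : Set X)))
    ⟨p, subset_closure rfl⟩
  obtain ⟨V, hV, hqV, I, hI⟩ := J.exists_affine q
  have hpV : p ∈ V := by
    obtain ⟨y, hy, rfl⟩ := mem_closure_iff.1 hq V V.isOpen hqV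
    exact hy
  have hmem : ∀ (x : X) (hx : x ∈ V) (f : Γ(X, V)),
      f ∈ (hV.primeIdealOf ⟨x, hx⟩).asIdeal ↔ ¬ IsUnit (X.presheaf.germ V x hx f) := by
    intro x hx f
    have := hV.isLocalization_stalk ⟨x, hx⟩
    let := X.presheaf.algebra_section_stalk (⟨x, hx⟩ : V)
    rw [← IsLocalization.AtPrime.under_maximalIdeal (X.presheaf.stalk x)
      (hV.primeIdealOf ⟨x, hx⟩).asIdeal]
    rfl
  have hle : (hV.primeIdealOf ⟨p, hpV⟩).asIdeal ≤ (hV.primeIdealOf ⟨q, hqV⟩).asIdeal := by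
    intro f hf
    rw [hmem] at hf ⊢
    contrapose! hf
    rw [← X.mem_basicOpen f q hqV] at hf
    rw [← X.mem_basicOpen f p hpV]
    obtain ⟨y, hy, rfl⟩ := mem_closure_iff.1 hq _ (X.basicOpen f).isOpen hf
    exact hy
  have hIp : I ≤ (hV.primeIdealOf ⟨p, hpV⟩).asIdeal := by
    intro f hf
    rw [hmem]
    intro hu
    refine hp.1 ?_
    rw [hI p hpV]
    exact Ideal.eq_top_of_isUnit_mem _ (Ideal.mem_map_of_mem _ hf) hu
  by_cases heq : (hV.primeIdealOf ⟨p, hpV⟩) = hV.primeIdealOf ⟨q, hqV⟩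
  · have : p = q := by
      have h1 := hV.fromSpec_primeIdealOf ⟨p, hpV⟩
      have h2 := hV.fromSpec_primeIdealOf ⟨q, hqV⟩
      rw [heq] at h1
      exact h1.symm.trans h2
    rwa [this]
  · exfalso
    refine hp.2 ?_
    have hqJ : q ∈ J.support := by
      intro htop
      rw [hI q hqV] at htop
      have := hV.isLocalization_stalk ⟨q, hqV⟩
      have h1 : I.map (X.presheaf.germ V q hqV).hom ≤ maximalIdeal _ := by
        rw [Ideal.map_le_iff_le_comap]
        intro f hf
        exact (hmem q hqV f).1 (hle (hIp hf))
      exact (maximalIdeal.isMaximal _).ne_top (top_le_iff.1 (htop ▸ h1))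
    have hd := hdim q hqJ hqc
    have hr := J.isRadical_stalk hred p
    rw [hI q hqV] at hd
    rw [hI p hpV] at hr ⊢
    let := X.presheaf.algebra_section_stalk (⟨q, hqV⟩ : V)
    let := X.presheaf.algebra_section_stalk (⟨p, hpV⟩ : V)
    have := hV.isLocalization_stalk ⟨q, hqV⟩
    have := hV.isLocalization_stalk ⟨p, hpV⟩
    exact Ideal.isRegularLocalRing_of_lt_of_ringKrullDim_eq_one (A := Γ(X, V))
      (Oq := X.presheaf.stalk q) (Op := X.presheaf.stalk p)
      (p := (hV.primeIdealOf ⟨p, hpV⟩).asIdeal)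
      (q := (hV.primeIdealOf ⟨q, hqV⟩).asIdeal) hIp
      (lt_of_le_of_ne hle fun h => heq (PrimeSpectrum.ext h)) hd hr

attribute [local instance] KSpace.stalkAlgebra

theorem schemeSpace.exists_dualCoordinates [IsAlgClosed K] {n : ℕ}
    [SmoothOfRelativeDimension n π] {p : (schemeSpace X π).toLRS}
    (hp : IsClosed ({p} : Set (schemeSpace X π).toLRS)) :
    Nonempty (DualCoordinates (Fin n) K ((schemeSpace X π).Stalk p)) := by
  obtain ⟨U, hU, V, hV, hpV, e, hsm⟩ :=
    SmoothOfRelativeDimension.exists_isStandardSmoothOfRelativeDimension (n := n) (f := π) p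
  -- Spec K has a single point, so the smooth chart is over all of it.
  have hUtop : U = ⊤ := by
    ext x
    have : x = π p := Subsingleton.elim _ _
    rw [this]
    exact iff_of_true (e hpV) trivial
  subst hUtop
  let c : K →+* Γ(X, V) := (schemeSpace X π).const V
  have hc : c = (π.appLE ⊤ V e).hom.comp
      ((Scheme.ΓSpecIso (CommRingCat.of K)).commRingCatIsoToRingEquiv.symm : K →+* _) := rfl
  have hsm' : RingHom.IsStandardSmoothOfRelativeDimension n c := by
    rw [hc]
    exact hsm.comp (RingHom.IsStandardSmoothOfRelativeDimension.equiv _)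
  let : Algebra K Γ(X, V) := c.toAlgebra
  have hst : Algebra.IsStandardSmoothOfRelativeDimension n K Γ(X, V) := hsm'
  have := hV.primeIdealOf_isMaximal_of_isClosed ⟨p, hpV⟩ hp
  let : Algebra Γ(X, V) ((schemeSpace X π).Stalk p) :=
    X.presheaf.algebra_section_stalk (⟨p, hpV⟩ : V)
  have : IsScalarTower K Γ(X, V) ((schemeSpace X π).Stalk p) :=
    IsScalarTower.of_algebraMap_eq fun k => (KSpace.germ_const (X := schemeSpace X π) V hpV k).symm
  have : IsLocalization.AtPrime ((schemeSpace X π).Stalk p) (hV.primeIdealOf ⟨p, hpV⟩).asIdeal :=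
    hV.isLocalization_stalk ⟨p, hpV⟩
  exact DualCoordinates.exists_of_isStandardSmooth n (hV.primeIdealOf ⟨p, hpV⟩).asIdeal

/-- The normal form at non-nilpotent points of Poisson triples on algebraic orbifolds. -/
theorem AlgebraicOrbifold.hasNormalFormAt [IsAlgClosed K] [CharZero K]
    (X : AlgebraicOrbifold K 3) (T : PoissonTriple X.presentation 1) (p : X.presentation.U.toLRS)
    (hp : T.IsNonNilpotentPoint p) : T.HasNormalFormAt p := by
  have := X.smooth
  have := X.quasiCompact
  have : CompactSpace X.U := QuasiCompact.compactSpace_of_compactSpace X.π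
  have hcl : IsClosed {p} := CoherentIdealSheaf.isClosed_of_isSingularAt (X := X.U) (π := X.π)
    T.J T.reduced T.pureDimension hp.1
  obtain ⟨x⟩ := schemeSpace.exists_dualCoordinates (n := 3) (π := X.π) hcl
  exact T.hasNormalFormAt_of_dualCoordinates hp hcl x

end PoissonTriples

/-! ### Hadamard's lemma for holomorphic functions. -/

section ParametricIntegral

universe w

open MeasureTheory Metric

variable {E : Type w} [NormedAddCommGroup E] [NormedSpace ℂ E] [ProperSpace E]

/-- Differentiation of a weighted average along rays under the integral sign. -/
theorem hasFDerivAt_integral_ray {F : Type w} [NormedAddCommGroup F] [NormedSpace ℂ F]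
    [CompleteSpace F] {g : E → F} {r : ℝ} (hg : ContDiffOn ℂ 1 g (ball 0 r)) (k : ℕ) {v : E}
    (hv : v ∈ ball (0 : E) r) :
    HasFDerivAt (fun v => ∫ t : ℝ in 0..1, ((t ^ k : ℝ) : ℂ) • g ((t : ℂ) • v))
      (∫ t : ℝ in 0..1, ((t ^ (k + 1) : ℝ) : ℂ) • fderiv ℂ g ((t : ℂ) • v)) v := by
  -- A closed ball of intermediate radius is compact, which gives the uniform bound on the
  -- derivative for dominated convergence.
  obtain ⟨ρ, hvρ, hρr⟩ := exists_between (mem_ball_zero_iff.1 hv)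
  have hfd : ContinuousOn (fderiv ℂ g) (ball 0 r) :=
    hg.continuousOn_fderiv_of_isOpen isOpen_ball le_rfl
  obtain ⟨C, hC⟩ := (isCompact_closedBall (0 : E) ρ).exists_bound_of_continuousOn
    (hfd.mono (closedBall_subset_ball hρr))
  have hmem : ∀ t ∈ Set.Icc (0 : ℝ) 1, ∀ x : E, ∀ R, x ∈ ball (0 : E) R →
      (t : ℂ) • x ∈ ball (0 : E) R := by
    intro t ht x R hx
    rw [mem_ball_zero_iff] at hx ⊢
    rw [norm_smul, Complex.norm_real, Real.norm_of_nonneg ht.1]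
    exact (mul_le_of_le_one_left (norm_nonneg x) ht.2).trans_lt hx
  have hcont : ∀ {G : Type w} [NormedAddCommGroup G] [NormedSpace ℂ G] (h : E → G) (m : ℕ),
      ContinuousOn h (ball 0 r) → ∀ x ∈ ball (0 : E) r,
      ContinuousOn (fun t : ℝ => ((t ^ m : ℝ) : ℂ) • h ((t : ℂ) • x)) (Set.uIcc 0 1) := by
    intro G _ _ h m hh x hx
    rw [Set.uIcc_of_le zero_le_one]
    refine ContinuousOn.smul (by fun_prop) (hh.comp (by fun_prop) fun t ht => hmem t ht x r hx)
  have hmeas : ∀ {G : Type w} [NormedAddCommGroup G] [NormedSpace ℂ G] (h : E → G) (m : ℕ),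
      ContinuousOn h (ball 0 r) → ∀ x ∈ ball (0 : E) r,
      IntervalIntegrable (fun t : ℝ => ((t ^ m : ℝ) : ℂ) • h ((t : ℂ) • x)) volume 0 1 :=
    fun h m hh x hx => (hcont h m hh x hx).intervalIntegrable
  refine intervalIntegral.hasFDerivAt_integral_of_dominated_of_fderiv_le
    (F' := fun v t => ((t ^ (k + 1) : ℝ) : ℂ) • fderiv ℂ g ((t : ℂ) • v)) (bound := fun _ => C)
    (s := ball 0 ρ) (isOpen_ball.mem_nhds (mem_ball_zero_iff.2 hvρ)) ?_
    (hmeas g k hg.continuousOn v hv) (hmeas _ (k + 1) hfd v hv).def'.aestronglyMeasurable ?_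
    intervalIntegrable_const ?_
  · filter_upwards [isOpen_ball.mem_nhds hv] with x hx
    exact (hmeas g k hg.continuousOn x hx).def'.aestronglyMeasurable
  · refine Filter.Eventually.of_forall fun t ht x hx => ?_
    rw [Set.uIoc_of_le zero_le_one] at ht
    have ht' : t ∈ Set.Icc (0 : ℝ) 1 := Set.Ioc_subset_Icc_self ht
    rw [norm_smul, Complex.norm_real, Real.norm_of_nonneg (pow_nonneg ht'.1 _)]
    refine (mul_le_of_le_one_left (norm_nonneg _) (pow_le_one₀ ht'.1 ht'.2)).trans
      (hC _ (ball_subset_closedBall (hmem t ht' x ρ hx)))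
  · refine Filter.Eventually.of_forall fun t ht x hx => ?_
    rw [Set.uIoc_of_le zero_le_one] at ht
    have hx' := hmem t (Set.Ioc_subset_Icc_self ht) x r (ball_subset_ball hρr.le hx)
    have h1 : HasFDerivAt g (fderiv ℂ g ((t : ℂ) • x)) ((t : ℂ) • x) :=
      ((hg.differentiableOn one_ne_zero).differentiableAt (isOpen_ball.mem_nhds hx')).hasFDerivAt
    have h2 : HasFDerivAt (fun x : E => (t : ℂ) • x) ((t : ℂ) • ContinuousLinearMap.id ℂ E) x :=
      (hasFDerivAt_id x).const_smul (t : ℂ)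
    refine ((h1.comp x h2).const_smul ((t ^ k : ℝ) : ℂ)).congr_fderiv
      (ContinuousLinearMap.ext fun y => ?_)
    simp [pow_succ, mul_smul]

/-- Averages of smooth functions along rays are smooth. -/
theorem contDiffOn_integral_ray (n : ℕ) : ∀ {F : Type w} [NormedAddCommGroup F] [NormedSpace ℂ F]
    [CompleteSpace F] {g : E → F} {r : ℝ} (_ : ContDiffOn ℂ ∞ g (ball 0 r)) (k : ℕ),
    ContDiffOn ℂ n (fun v => ∫ t : ℝ in 0..1, ((t ^ k : ℝ) : ℂ) • g ((t : ℂ) • v))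
      (ball 0 r) := by
  induction n with
  | zero =>
    intro F _ _ _ g r hg k
    rw [Nat.cast_zero, contDiffOn_zero]
    exact fun v hv => (hasFDerivAt_integral_ray (hg.of_le (mod_cast le_top)) k
      hv).continuousAt.continuousWithinAt
  | succ n ih =>
    intro F _ _ _ g r hg k
    have h1 : ContDiffOn ℂ 1 g (ball 0 r) := hg.of_le (mod_cast le_top)
    rw [Nat.cast_succ, contDiffOn_succ_iff_fderiv_of_isOpen isOpen_ball]
    refine ⟨fun v hv => (hasFDerivAt_integral_ray h1 k hv).differentiableAt.differentiableWithinAt,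
      by simp, ?_⟩
    -- The derivative is again such an average, with exponent k + 1 and operator values, which is
    -- why F and k vary in the induction.
    exact (ih (hg.fderiv_of_isOpen isOpen_ball (m := ∞) (by simp)) (k + 1)).congr
      fun v hv => (hasFDerivAt_integral_ray h1 k hv).fderiv

/-- Hadamard's lemma. -/
theorem ContDiffOn.exists_eq_add_apply {F : Type w} [NormedAddCommGroup F] [NormedSpace ℂ F]
    [CompleteSpace F] {f : E → F} {r : ℝ} (hf : ContDiffOn ℂ ∞ f (ball 0 r)) :
    ∃ G : E → E →L[ℂ] F, ContDiffOn ℂ ∞ G (ball 0 r) ∧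
      ∀ v ∈ ball (0 : E) r, f v = f 0 + G v v := by
  have hd := hf.fderiv_of_isOpen isOpen_ball (m := ∞) (by simp)
  -- G is the average of the derivative of f over the segment from 0 to v.
  refine ⟨_, contDiffOn_infty.2 fun n => contDiffOn_integral_ray n hd 0, fun v hv => ?_⟩
  have hmem : ∀ t ∈ Set.uIcc (0 : ℝ) 1, (t : ℂ) • v ∈ ball (0 : E) r := by
    intro t ht
    rw [Set.uIcc_of_le zero_le_one] at ht
    rw [mem_ball_zero_iff] at hv ⊢
    rw [norm_smul, Complex.norm_real, Real.norm_of_nonneg ht.1]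
    exact (mul_le_of_le_one_left (norm_nonneg v) ht.2).trans_lt hv
  have hc : ContinuousOn (fun t : ℝ => fderiv ℂ f ((t : ℂ) • v)) (Set.uIcc 0 1) :=
    hd.continuousOn.comp (by fun_prop) hmem
  have hcv : ContinuousOn (fun t : ℝ => fderiv ℂ f ((t : ℂ) • v) v) (Set.uIcc 0 1) :=
    hc.clm_apply continuousOn_const
  have hder : ∀ t ∈ Set.uIcc (0 : ℝ) 1,
      HasDerivAt (fun t : ℝ => f ((t : ℂ) • v)) (fderiv ℂ f ((t : ℂ) • v) v) t := by
    intro t ht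
    have h1 : HasFDerivAt f (fderiv ℂ f ((t : ℂ) • v)) ((t : ℂ) • v) :=
      ((hf.differentiableOn (by simp)).differentiableAt
        (isOpen_ball.mem_nhds (hmem t ht))).hasFDerivAt
    have h2 : HasDerivAt (fun t : ℝ => (t : ℂ) • v) v t := by
      simpa using (Complex.ofRealCLM.hasDerivAt (x := t)).smul_const v
    exact (h1.restrictScalars ℝ).comp_hasDerivAt t h2
  have key := intervalIntegral.integral_eq_sub_of_hasDerivAt hder hcv.intervalIntegrable
  simp only [pow_zero, Complex.ofReal_one, one_smul]
  rw [ContinuousLinearMap.intervalIntegral_apply hc.intervalIntegrable, key]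
  simp

end ParametricIntegral

/-! ### Coordinates on germs of holomorphic functions. -/

section SmoothGerms

open Filter Topology

/-- Hadamard's lemma in coordinates, for germs. -/
theorem Filter.Eventually.exists_eventuallyEq_sum {n : ℕ} {a : EuclideanSpace ℂ (Fin n)}
    {f : EuclideanSpace ℂ (Fin n) → ℂ} (hf : ∀ᶠ y in 𝓝 a, ContDiffAt ℂ ∞ f y) :
    ∃ g : Fin n → EuclideanSpace ℂ (Fin n) → ℂ,
      (∀ i, ∀ᶠ y in 𝓝 a, ContDiffAt ℂ ∞ (g i) y) ∧
      f =ᶠ[𝓝 a] fun y => f a + ∑ i, (y i - a i) * g i y := by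
  obtain ⟨r, hr, hball⟩ := Metric.eventually_nhds_iff_ball.1 hf
  have hsub : ∀ y, y - a ∈ Metric.ball (0 : EuclideanSpace ℂ (Fin n)) r ↔ y ∈ Metric.ball a r := by
    intro y
    rw [mem_ball_zero_iff, Metric.mem_ball, dist_eq_norm]
  have hf' : ContDiffOn ℂ ∞ (fun v => f (v + a)) (Metric.ball 0 r) := by
    intro v hv
    have h1 : ContDiffAt ℂ ∞ f (v + a) := hball _ (by rwa [← hsub, add_sub_cancel_right])
    exact (h1.comp v (by fun_prop : ContDiffAt ℂ ∞ (fun v => v + a) v)).contDiffWithinAt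
  obtain ⟨G, hG, hfG⟩ := hf'.exists_eq_add_apply
  refine ⟨fun i y => G (y - a) (EuclideanSpace.single i 1), fun i => ?_, ?_⟩
  · filter_upwards [Metric.ball_mem_nhds a hr] with y hy
    have h1 : ContDiffAt ℂ ∞ G (y - a) :=
      hG.contDiffAt (Metric.isOpen_ball.mem_nhds ((hsub y).2 hy))
    exact (h1.comp y (by fun_prop : ContDiffAt ℂ ∞ (fun y => y - a) y)).clm_apply contDiffAt_const
  · filter_upwards [Metric.ball_mem_nhds a hr] with y hy
    have h1 := hfG (y - a) ((hsub y).2 hy)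
    simp only [sub_add_cancel, zero_add] at h1
    rw [h1]
    congr 1
    generalize G (y - a) = L
    rw [← (EuclideanSpace.basisFun (Fin n) ℂ).sum_repr (y - a), map_sum]
    exact Finset.sum_congr rfl fun i _ => by simp

/-- Germs of holomorphic functions have coordinates. -/
theorem DualCoordinates.exists_of_smoothGerms {n : ℕ} {a : EuclideanSpace ℂ (Fin n)} {O : Type*}
    [CommRing O] [IsLocalRing O] [Algebra ℂ O] (Φ : O →+* Germ (𝓝 a) ℂ)
    (hinj : Function.Injective Φ)
    (hconst : ∀ c : ℂ, Φ (algebraMap ℂ O c) = ((fun _ => c : EuclideanSpace ℂ (Fin n) → ℂ) : Germ (𝓝 a) ℂ))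
    (hsmooth : ∀ s, ∃ f : EuclideanSpace ℂ (Fin n) → ℂ,
      Φ s = f ∧ ∀ᶠ y in 𝓝 a, ContDiffAt ℂ ∞ f y)
    (hsurj : ∀ f : EuclideanSpace ℂ (Fin n) → ℂ, (∀ᶠ y in 𝓝 a, ContDiffAt ℂ ∞ f y) →
      ∃ s, Φ s = f) :
    Nonempty (DualCoordinates (Fin n) ℂ O) := by
  -- The maximal ideal consists of the germs vanishing at a, since a nonvanishing germ has a smooth
  -- reciprocal.
  have hmax : ∀ (s : O) (f : EuclideanSpace ℂ (Fin n) → ℂ), Φ s = f →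
      (∀ᶠ y in 𝓝 a, ContDiffAt ℂ ∞ f y) → (s ∈ maximalIdeal O ↔ f a = 0) := by
    intro s f hs hf
    rw [mem_maximalIdeal, mem_nonunits_iff, not_iff_comm]
    constructor
    · intro h0
      have hne : ∀ᶠ y in 𝓝 a, f y ≠ 0 := hf.self_of_nhds.continuousAt.eventually_ne h0
      obtain ⟨s', hs'⟩ := hsurj (fun y => (f y)⁻¹) (by
        filter_upwards [hf, hne] with y h1 h2
        exact h1.inv h2)
      refine IsUnit.of_mul_eq_one s' (hinj ?_)
      rw [map_mul, map_one, hs, hs', ← Germ.coe_mul]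
      refine Germ.coe_eq.2 ?_
      filter_upwards [hne] with y hy
      exact mul_inv_cancel₀ hy
    · rintro ⟨u, rfl⟩ h0
      obtain ⟨f', hf', -⟩ := hsmooth ((u⁻¹ : Oˣ) : O)
      have h1 := congrArg Φ u.mul_inv
      rw [map_mul, map_one, hs, hf', ← Germ.coe_mul] at h1
      have h2 := (Germ.coe_eq.1 h1).self_of_nhds
      simp [h0] at h2
  choose t ht using fun i : Fin n => hsurj (fun y => y i - a i)
    (Eventually.of_forall fun y => by fun_prop)
  choose F hF hFs using hsmooth
  have hdiff : ∀ {f : EuclideanSpace ℂ (Fin n) → ℂ}, (∀ᶠ y in 𝓝 a, ContDiffAt ℂ ∞ f y) →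
      ∀ᶠ y in 𝓝 a, DifferentiableAt ℂ f y :=
    fun hf => hf.mono fun y hy => hy.differentiableAt (by simp)
  choose d hd using fun (i : Fin n) (s : O) =>
    hsurj (fun y => fderiv ℂ (F s) y (EuclideanSpace.single i 1)) (by
      filter_upwards [hFs s] with y hy
      have := hy.fderiv_right (m := ∞) (by simp)
      exact this.clm_apply contDiffAt_const)
  have hd' : ∀ (i : Fin n) (s : O) (f : EuclideanSpace ℂ (Fin n) → ℂ), Φ s = f →
      Φ (d i s) = ((fun y => fderiv ℂ f y (EuclideanSpace.single i 1) :
        EuclideanSpace ℂ (Fin n) → ℂ) : Germ (𝓝 a) ℂ) := by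
    intro i s f hf
    rw [hd]
    have h1 : F s =ᶠ[𝓝 a] f := Germ.coe_eq.1 ((hF s).symm.trans hf)
    refine Germ.coe_eq.2 ?_
    filter_upwards [h1.fderiv (𝕜 := ℂ)] with y hy
    rw [hy]
  have hdadd : ∀ i s s', d i (s + s') = d i s + d i s' := by
    intro i s s'
    refine hinj ?_
    rw [map_add, hd i s, hd i s', ← Germ.coe_add,
      hd' i (s + s') (F s + F s') (by rw [map_add, hF, hF, Germ.coe_add])]
    refine Germ.coe_eq.2 ?_
    filter_upwards [hdiff (hFs s), hdiff (hFs s')] with y h1 h2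
    rw [fderiv_add h1 h2]
    rfl
  have hdmul : ∀ i s s', d i (s * s') = s * d i s' + s' * d i s := by
    intro i s s'
    refine hinj ?_
    rw [map_add, map_mul, map_mul, hd i s, hd i s', hF s, hF s', ← Germ.coe_mul, ← Germ.coe_mul,
      ← Germ.coe_add, hd' i (s * s') (F s * F s') (by rw [map_mul, hF, hF, Germ.coe_mul])]
    refine Germ.coe_eq.2 ?_
    filter_upwards [hdiff (hFs s), hdiff (hFs s')] with y h1 h2
    rw [fderiv_mul h1 h2]
    rfl
  have hdconst : ∀ i c, d i (algebraMap ℂ O c) = 0 := by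
    intro i c
    refine hinj ?_
    rw [hd' i _ _ (hconst c), map_zero]
    refine Germ.coe_eq.2 (Eventually.of_forall fun y => ?_)
    simp
  refine ⟨⟨t, fun i => Derivation.mk' ⟨⟨d i, hdadd i⟩, fun c s => ?_⟩ (hdmul i), ?_, ?_, ?_⟩⟩
  · change d i (c • s) = c • d i s
    rw [Algebra.smul_def, hdmul, hdconst, mul_zero, add_zero, Algebra.smul_def]
  · apply le_antisymm
    · intro s hs
      -- Hadamard's lemma writes a germ vanishing at a as a combination of the coordinate functions.
      obtain ⟨g, hg, hsum⟩ := (hFs s).exists_eventuallyEq_sum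
      choose b hb using fun i => hsurj (g i) (hg i)
      have hs0 := (hmax s _ (hF s) (hFs s)).1 hs
      have : s = ∑ i, t i * b i := by
        refine hinj ?_
        rw [hF, map_sum, Germ.coe_eq.2 hsum]
        have h1 : ∀ i, Φ (t i * b i) = ((fun y => (y i - a i) * g i y : EuclideanSpace ℂ (Fin n) → ℂ) :
            Germ (𝓝 a) ℂ) := fun i => by rw [map_mul, ht, hb]; rfl
        rw [Finset.sum_congr rfl fun i _ => h1 i]
        have h2 := map_sum (Germ.coeRingHom (R := ℂ) (𝓝 a))
          (fun i y => (y i - a i) * g i y) Finset.univ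
        refine Eq.trans ?_ h2
        refine Germ.coe_eq.2 (Eventually.of_forall fun y => ?_)
        simp [hs0]
      rw [this]
      exact sum_mem fun i _ => Ideal.mul_mem_right _ _ (Ideal.subset_span ⟨i, rfl⟩)
    · rw [Ideal.span_le]
      rintro _ ⟨i, rfl⟩
      refine (hmax _ _ (ht i) (Eventually.of_forall fun y => by fun_prop)).2 (sub_self _)
  · intro i j
    change d i (t j) = _
    refine hinj ?_
    rw [hd' i _ _ (ht j)]
    have h1 : ∀ y : EuclideanSpace ℂ (Fin n),
        fderiv ℂ (fun y : EuclideanSpace ℂ (Fin n) => y j - a j) y (EuclideanSpace.single i 1) =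
          if i = j then 1 else 0 := by
      intro y
      rw [fderiv_sub_const]
      have := (EuclideanSpace.proj j : EuclideanSpace ℂ (Fin n) →L[ℂ] ℂ).hasFDerivAt (x := y)
      have := this.fderiv
      change fderiv ℂ (fun y : EuclideanSpace ℂ (Fin n) => y j) y = _ at this
      rw [this]
      simp [PiLp.single_apply, eq_comm]
    simp only [h1]
    split_ifs
    · rw [map_one]; rfl
    · rw [map_zero]; rfl
  · intro s
    refine ⟨F s a, (hmax _ (F s - fun _ => F s a) ?_ ?_).2 (sub_self _)⟩
    · rw [map_sub, hF, hconst]; rfl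
    · filter_upwards [hFs s] with y hy
      exact hy.sub contDiffAt_const

end SmoothGerms

/-! ### Local rings of complex manifolds, and the main theorem. -/

namespace PoissonTriples

open Filter Topology

section ManifoldStalk

variable {n : ℕ} {M : Type} [TopologicalSpace M] [ChartedSpace (EuclideanSpace ℂ (Fin n)) M]

open Classical in
/-- A holomorphic function on an open subset of a manifold in the preferred chart at a point. -/
noncomputable def chartFun (p : M) (U : Opens M) (f : U → ℂ) (y : EuclideanSpace ℂ (Fin n)) : ℂ :=
  if h : (chartAt (EuclideanSpace ℂ (Fin n)) p).symm y ∈ U then f ⟨_, h⟩ else 0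

theorem eventually_chart_symm_mem (p : M) {U : Opens M} (hp : p ∈ U) :
    ∀ᶠ y in 𝓝 (chartAt (EuclideanSpace ℂ (Fin n)) p p),
      (chartAt (EuclideanSpace ℂ (Fin n)) p).symm y ∈ U := by
  have h := (chartAt (EuclideanSpace ℂ (Fin n)) p).tendsto_symm
    (mem_chart_source (EuclideanSpace ℂ (Fin n)) p)
  exact h (U.isOpen.mem_nhds hp)

/-- The germ, in the preferred chart at `p`, of a holomorphic function near `p`. -/
noncomputable def chartGerm (p : M) (U : Opens M) (hp : p ∈ U) :
    C^∞⟮𝓘(ℂ, EuclideanSpace ℂ (Fin n)), U; 𝓘(ℂ), ℂ⟯ →+*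
      Germ (𝓝 (chartAt (EuclideanSpace ℂ (Fin n)) p p)) ℂ where
  toFun f := (chartFun p U f : EuclideanSpace ℂ (Fin n) → ℂ)
  map_one' := Germ.coe_eq.2 (by
    filter_upwards [eventually_chart_symm_mem p hp] with y hy
    exact dif_pos hy)
  map_mul' f g := Germ.coe_eq.2 (by
    filter_upwards [eventually_chart_symm_mem p hp] with y hy
    simp [chartFun, hy])
  map_zero' := Germ.coe_eq.2 (by
    filter_upwards [eventually_chart_symm_mem p hp] with y hy
    exact dif_pos hy)
  map_add' f g := Germ.coe_eq.2 (by
    filter_upwards [eventually_chart_symm_mem p hp] with y hy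
    simp [chartFun, hy])

/-- Germs in the preferred chart at `p`, as a cocone over the functions near `p`. -/
noncomputable def chartGermCocone (p : M) :
    Limits.Cocone ((OpenNhds.inclusion (X := TopCat.of M) p).op ⋙
      smoothPresheafCommRing 𝓘(ℂ, EuclideanSpace ℂ (Fin n)) 𝓘(ℂ) M ℂ) where
  pt := CommRingCat.of (Germ (𝓝 (chartAt (EuclideanSpace ℂ (Fin n)) p p)) ℂ)
  ι := ⟨fun U => CommRingCat.ofHom (chartGerm p U.unop.1 U.unop.2), by
    intro U V i
    ext f
    refine Germ.coe_eq.2 ?_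
    filter_upwards [eventually_chart_symm_mem p V.unop.2] with y hy
    have hy' : (chartAt (EuclideanSpace ℂ (Fin n)) p).symm y ∈ U.unop.1 := i.unop.le hy
    have h1 : chartFun p U.unop.1 f.1 y = f.1 ⟨_, hy'⟩ := dif_pos hy'
    exact (dif_pos hy).trans h1.symm⟩

/-- The germ, in the preferred chart at `p`, of an element of the local ring at `p`. -/
noncomputable def stalkChartGerm (p : M) :
    ((manifoldSpace n M).Stalk p : Type) →+*
      Germ (𝓝 (chartAt (EuclideanSpace ℂ (Fin n)) p p)) ℂ :=
  (Limits.colimit.desc _ (chartGermCocone p)).hom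

theorem stalkChartGerm_germ (p : M) (U : Opens M) (hp : p ∈ U)
    (f : C^∞⟮𝓘(ℂ, EuclideanSpace ℂ (Fin n)), U; 𝓘(ℂ), ℂ⟯) :
    stalkChartGerm p ((manifoldSpace n M).germ U p hp f) = chartGerm p U hp f :=
  congr_arg (fun a : _ ⟶ (chartGermCocone p).pt => a.hom f)
    (Limits.colimit.ι_desc (chartGermCocone (n := n) p) (op ⟨U, hp⟩))

theorem exists_manifoldSpace_germ_eq (p : M) (s : (manifoldSpace n M).Stalk p) :
    ∃ (U : Opens M) (hU : p ∈ U) (f : C^∞⟮𝓘(ℂ, EuclideanSpace ℂ (Fin n)), U; 𝓘(ℂ), ℂ⟯),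
      (manifoldSpace n M).germ U p hU f = s :=
  (manifoldSpace n M).toLRS.presheaf.exists_germ_eq s

theorem chartFun_chart (p : M) (U : Opens M) (f : U → ℂ) {x : M}
    (hx : x ∈ (chartAt (EuclideanSpace ℂ (Fin n)) p).source) (hU : x ∈ U) :
    chartFun p U f (chartAt (EuclideanSpace ℂ (Fin n)) p x) = f ⟨x, hU⟩ := by
  have h := (chartAt (EuclideanSpace ℂ (Fin n)) p).left_inv hx
  have hU' : (chartAt (EuclideanSpace ℂ (Fin n)) p).symm
      (chartAt (EuclideanSpace ℂ (Fin n)) p x) ∈ U := by rwa [h]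
  refine (dif_pos hU').trans ?_
  congr 2

theorem stalkChartGerm_injective (p : M) : Function.Injective (stalkChartGerm (n := n) p) := by
  rw [injective_iff_map_eq_zero]
  intro s hs
  obtain ⟨U, hU, f, rfl⟩ := exists_manifoldSpace_germ_eq p s
  rw [stalkChartGerm_germ p U hU f] at hs
  have h0 : ∀ᶠ y in 𝓝 (chartAt (EuclideanSpace ℂ (Fin n)) p p), chartFun p U f.1 y = 0 :=
    Germ.coe_eq.1 hs
  have h1 := ((chartAt (EuclideanSpace ℂ (Fin n)) p).continuousAt
    (mem_chart_source (EuclideanSpace ℂ (Fin n)) p)).eventually h0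
  have h2 : ∀ᶠ x in 𝓝 p, x ∈ (chartAt (EuclideanSpace ℂ (Fin n)) p).source :=
    (chartAt (EuclideanSpace ℂ (Fin n)) p).open_source.mem_nhds
      (mem_chart_source (EuclideanSpace ℂ (Fin n)) p)
  have h3 : ∀ᶠ x in 𝓝 p, x ∈ U := U.isOpen.mem_nhds hU
  obtain ⟨V, hV, hVo, hpV⟩ := eventually_nhds_iff.1 (h1.and (h2.and h3))
  let V' : Opens (manifoldSpace n M).toLRS := ⟨V, hVo⟩
  have hVU : V' ≤ U := fun x hx => (hV x hx).2.2
  have h3 : (manifoldSpace n M).res hVU f = 0 := by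
    refine Subtype.ext (funext fun x => ?_)
    obtain ⟨a1, a2, a3⟩ := hV x.1 x.2
    rw [chartFun_chart p U f.1 a2 a3] at a1
    exact a1
  have h4 := PoissonStructure.germ_res (X := manifoldSpace n M) hVU p hpV f
  rw [h3, map_zero] at h4
  exact h4.symm

theorem contDiffAt_chartFun [IsManifold 𝓘(ℂ, EuclideanSpace ℂ (Fin n)) ω M] (p : M) (U : Opens M)
    (f : C^∞⟮𝓘(ℂ, EuclideanSpace ℂ (Fin n)), U; 𝓘(ℂ), ℂ⟯) {y : EuclideanSpace ℂ (Fin n)}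
    (hy : y ∈ (chartAt (EuclideanSpace ℂ (Fin n)) p).target)
    (hU : (chartAt (EuclideanSpace ℂ (Fin n)) p).symm y ∈ U) :
    ContDiffAt ℂ ∞ (chartFun p U f) y := by
  have : IsManifold 𝓘(ℂ, EuclideanSpace ℂ (Fin n)) ∞ M := IsManifold.of_le (n := ω) le_top
  classical
  let F : M → ℂ := fun x => if h : x ∈ U then f ⟨x, h⟩ else 0
  have hF : ContMDiffAt 𝓘(ℂ, EuclideanSpace ℂ (Fin n)) 𝓘(ℂ) ∞ F
      ((chartAt (EuclideanSpace ℂ (Fin n)) p).symm y) := by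
    have h1 := contMDiffAt_subtype_iff (U := U) (f := F)
      (I := 𝓘(ℂ, EuclideanSpace ℂ (Fin n))) (I' := 𝓘(ℂ)) (n := ∞) (x := ⟨_, hU⟩)
    refine h1.1 ?_
    have h2 : (fun x : U => F x) = f := funext fun x => dif_pos x.2
    rw [h2]
    exact f.2.contMDiffAt
  have hφ := (contMDiffOn_chart_symm (I := 𝓘(ℂ, EuclideanSpace ℂ (Fin n))) (n := ∞)
    (x := p)).contMDiffAt ((chartAt (EuclideanSpace ℂ (Fin n)) p).open_target.mem_nhds hy)
  have h3 := contMDiffAt_iff_contDiffAt.1 (hF.comp y hφ)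
  have h4 : chartFun p U f = F ∘ (chartAt (EuclideanSpace ℂ (Fin n)) p).symm := by
    funext z
    simp only [chartFun, F, Function.comp_apply]
  rwa [h4]

theorem exists_stalkChartGerm_eq [IsManifold 𝓘(ℂ, EuclideanSpace ℂ (Fin n)) ω M] (p : M)
    (f : EuclideanSpace ℂ (Fin n) → ℂ)
    (hf : ∀ᶠ y in 𝓝 (chartAt (EuclideanSpace ℂ (Fin n)) p p), ContDiffAt ℂ ∞ f y) :
    ∃ s, stalkChartGerm p s = (f : Germ (𝓝 (chartAt (EuclideanSpace ℂ (Fin n)) p p)) ℂ) := by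
  have : IsManifold 𝓘(ℂ, EuclideanSpace ℂ (Fin n)) ∞ M := IsManifold.of_le (n := ω) le_top
  obtain ⟨W, hW, hWo, hpW⟩ := eventually_nhds_iff.1 hf
  let φ := chartAt (EuclideanSpace ℂ (Fin n)) p
  let U : Opens M := ⟨φ.source ∩ φ ⁻¹' W, φ.isOpen_inter_preimage hWo⟩
  have hU : p ∈ U := ⟨mem_chart_source _ p, hpW⟩
  let s : C^∞⟮𝓘(ℂ, EuclideanSpace ℂ (Fin n)), U; 𝓘(ℂ), ℂ⟯ := ⟨fun x => f (φ x), fun x => by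
    refine (contMDiffAt_subtype_iff (U := U) (f := fun x => f (φ x))).2 ?_
    have hφ := (contMDiffOn_chart (I := 𝓘(ℂ, EuclideanSpace ℂ (Fin n))) (n := ∞)
      (x := p)).contMDiffAt (φ.open_source.mem_nhds x.2.1)
    exact (hW _ x.2.2).contMDiffAt.comp x.1 hφ⟩
  refine ⟨(manifoldSpace n M).germ U p hU s, ?_⟩
  rw [stalkChartGerm_germ p U hU s]
  refine Germ.coe_eq.2 ?_
  filter_upwards [φ.open_target.mem_nhds (mem_chart_target _ p),
    eventually_chart_symm_mem p hU] with y hy hyU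
  refine (dif_pos hyU).trans ?_
  change f (φ (φ.symm y)) = f y
  rw [φ.right_inv hy]

end ManifoldStalk

attribute [local instance] KSpace.stalkAlgebra

theorem manifoldSpace.exists_dualCoordinates {n : ℕ} {M : Type} [TopologicalSpace M]
    [ChartedSpace (EuclideanSpace ℂ (Fin n)) M] [IsManifold 𝓘(ℂ, EuclideanSpace ℂ (Fin n)) ω M]
    (p : (manifoldSpace n M).toLRS) :
    Nonempty (DualCoordinates (Fin n) ℂ ((manifoldSpace n M).Stalk p)) := by
  refine DualCoordinates.exists_of_smoothGerms (stalkChartGerm (n := n) (M := M) p)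
    (stalkChartGerm_injective (n := n) (M := M) p) (fun c => ?_) (fun s => ?_)
    (exists_stalkChartGerm_eq (M := M) p)
  · rw [← KSpace.germ_const ⊤ trivial]
    refine (stalkChartGerm_germ (n := n) (M := M) p ⊤ trivial _).trans (Germ.coe_eq.2 ?_)
    filter_upwards [eventually_chart_symm_mem (n := n) (M := M) (U := ⊤) p trivial] with y hy
    exact dif_pos hy
  · obtain ⟨U, hU, f, rfl⟩ := exists_manifoldSpace_germ_eq (n := n) (M := M) p s
    refine ⟨_, stalkChartGerm_germ (n := n) (M := M) p U hU f, ?_⟩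
    filter_upwards [(chartAt (H := EuclideanSpace ℂ (Fin n)) (M := M) p).open_target.mem_nhds
      (mem_chart_target (M := M) _ p), eventually_chart_symm_mem (M := M) p hU] with y hy hyU
    exact contDiffAt_chartFun (M := M) p U f hy hyU

/-- The normal form at non-nilpotent points of Poisson triples on analytic orbifolds. -/
theorem AnalyticOrbifold.hasNormalFormAt (X : AnalyticOrbifold 3)
    (T : PoissonTriple X.presentation 1) (p : X.presentation.U.toLRS)
    (hp : T.IsNonNilpotentPoint p) : T.HasNormalFormAt p := by
  obtain ⟨x⟩ := manifoldSpace.exists_dualCoordinates (n := 3) (M := X.U) p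
  exact T.hasNormalFormAt_of_dualCoordinates hp (isClosed_singleton (X := X.U)) x

end PoissonTriples

theorem mainTheorem7 :
    (∀ (K : Type u) [Field K] [IsAlgClosed K] [CharZero K]
      (X : PoissonTriples.AlgebraicOrbifold K 3)
      (T : PoissonTriples.PoissonTriple X.presentation 1) (p : X.presentation.U.toLRS),
      T.IsNonNilpotentPoint p → T.HasNormalFormAt p) ∧
    (∀ (X : PoissonTriples.AnalyticOrbifold 3)
      (T : PoissonTriples.PoissonTriple X.presentation 1) (p : X.presentation.U.toLRS),
      T.IsNonNilpotentPoint p → T.HasNormalFormAt p) :=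
  ⟨fun _ _ _ _ X T p hp => X.hasNormalFormAt T p hp, fun X T p hp => X.hasNormalFormAt T p hp⟩
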